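/- Notation. For $x,v\in\mathbb R^3$ write $\bar x=(x_1,x_2)$, $\bar v=(v_1,v_2)$, and ${}^\perp(a_1,a_2)=(a_2,-a_1)$; let $\omega_c\in\mathbb R\setminus\{0\}$ and $\mathcal T f=\bar v\cdot\nabla_{\bar x}f+\omega_c\,{}^\perp\bar v\cdot\nabla_{\bar v}f$. The flow of $\mathcal T$ is $\bar V(s)=R(-\omega_c s)\bar v$, $\bar X(s)=\bar x+\frac{{}^\perp\bar v}{\omega_c}-\frac{{}^\perp\bar V(s)}{\omega_c}$, $X_3=x_3$, $V_3=v_3$ ($R(\alpha)$ being the rotation of angle $\alpha$), and the gyroaverage of $u$ is $\langle u\rangle(x,v)=\frac1{T_c}\int_0^{T_c}u(X(s),V(s))\,ds$, $T_c=2\pi/\omega_c$. Put $\nabla_{\omega_c x,v}=(\omega_c^{-1}\nabla_x,\nabla_v)$, $\mathrm{div}_{\omega_c x,v}(F_x,F_v)=\omega_c^{-1}\mathrm{div}_xF_x+\mathrm{div}_vF_v$, and $(a\otimes b)y=(b\cdot y)a$, $a^{\otimes2}=a\otimes a$ on $\mathbb R^6$. Let $\sigma\ge 0$ be measurable on $(0,\infty)$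 with $\int_0^\infty\sigma(\rho)\rho^2(1+\rho)^{-N}d\rho<\infty$ for some $N$, let $S(w)=I-\frac{w\otimes w}{|w|^2}$, and let $$Q(f,f)=\mathrm{div}_v\int_{\mathbb R^3}\sigma(|v-v'|)S(v-v')\big[f(x,v')\nabla_vf(x,v)-f(x,v)\nabla_{v'}f(x,v')\big]dv'=Q^+(f,f)-Q^-(f,f)$$ be the Fokker–Planck–Landau kernel; $Q^+$ and $Q^-$ are the terms with $f(x,v')\nabla_vf(x,v)$ and with $f(x,v)\nabla_{v'}f(x,v')$. For $(\bar x,v),(\bar x',v')\in\mathbb R^2\times\mathbb R^3$ put $r=|\bar v|$, $r'=|\bar v'|$, $z=(\omega_c\bar x+{}^\perp\bar v)-(\omega_c\bar x'+{}^\perp\bar v')$, $d=v_3-v_3'$, $\rho=\sqrt{|z|^2+d^2}$, $\sigma=\sigma(\rho)$, $$\chi=\frac{\mathbf 1_{\{|r-r'|<|z|<r+r'\}}}{\pi^2\sqrt{|z|^2-(r-r')^2}\sqrt{(r+r')^2-|z|^2}},$$ and, where $|r-r'|<|z|<r+r'$, let $\varphi\in(0,\pi)$ be given by $|z|^2=r^2+r'^2-2rr'\cos\varphi$.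 Put $$a=\Big(\tfrac{(\bar v,0)}{|\bar v|},\tfrac{({}^\perp\bar v,0)}{|\bar v|}\Big),\quad b=\Big(\tfrac{({}^\perp\bar v,0)}{|\bar v|},-\tfrac{(\bar v,0)}{|\bar v|}\Big),\quad c=\Big(\tfrac{({}^\perp z,0)}{|z|},0\Big),\quad e=\tfrac1\rho\Big(d\,\tfrac{(z,0)}{|z|},-|z|e_3\Big),$$ let $a',b'$ be $a,b$ with $v'$ in place of $v$, and $$A^+=\tfrac{r'^2\sin^2\varphi\,d^2}{|z|^2\rho^2}a^{\otimes2}+\Big[\tfrac{r-r'\cos\varphi}{|z|}a+c\Big]^{\otimes2}+\tfrac{r'^2\sin^2\varphi}{|z|^2}b^{\otimes2}+\Big[\tfrac{(r'\cos\varphi-r)d}{|z|\rho}b+e\Big]^{\otimes2},$$ $$A^-=\tfrac{rr'\sin^2\varphi\,d^2}{|z|^2\rho^2}a\otimes a'+\Big[\tfrac{r-r'\cos\varphi}{|z|}a+c\Big]\otimes\Big[\tfrac{r\cos\varphi-r'}{|z|}a'+c\Big]+\tfrac{rr'\sin^2\varphi}{|z|^2}b\otimes b'+\Big[\tfrac{(r'\cos\varphi-r)d}{|z|\rho}b+e\Big]\otimes\Big[\tfrac{(r'-r\cos\varphi)d}{|z|\rho}b'+e\Big],$$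 $$\xi^1=\sqrt{\sigma\chi}\,\tfrac{r'\sin\varphi\,d}{|z|\rho}a,\quad \xi^2=\sqrt{\sigma\chi}\Big[\tfrac{r-r'\cos\varphi}{|z|}a+c\Big],\quad \xi^3=\sqrt{\sigma\chi}\,\tfrac{r'\sin\varphi}{|z|}b,\quad \xi^4=\sqrt{\sigma\chi}\Big[\tfrac{(r'\cos\varphi-r)d}{|z|\rho}b+e\Big],$$ as functions $\xi^i(\bar x,v,\bar x',v')$, and $\varepsilon_1=\varepsilon_2=-1$, $\varepsilon_3=\varepsilon_4=1$. Proposition. Let $f=f(x,v)$ be of class $C^2$ on $\mathbb R^3\times\mathbb R^3$ with $\mathcal Tf=0$, such that $f$ and its derivatives of order at most $2$ decay in $v$ faster than any power of $|v|$, locally uniformly in $x$. Then the integrals and the divergences that define $Q^\pm(f,f)$ and $Q(f,f)$ exist, and these functions are continuous. 1. At every $(x,v)$ with $\bar v\ne0$ the integrals below converge absolutely, the fluxes in braces are differentiable, and $$\langle Q^+(f,f)\rangle=\mathrm{div}_{\omega_cx,v}\Big\{\omega_c^2\int_{\mathbb R^2}\int_{\mathbb R^3}\sigma\chi\,f(\bar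 x',x_3,v')\,A^+\nabla_{\omega_cx,v}f(x,v)\,dv'd\bar x'\Big\},$$ $$\langle Q^-(f,f)\rangle=\mathrm{div}_{\omega_cx,v}\Big\{\omega_c^2\int_{\mathbb R^2}\int_{\mathbb R^3}\sigma\chi\,f(x,v)\,A^-\nabla_{\omega_cx',v'}f(\bar x',x_3,v')\,dv'd\bar x'\Big\},$$ $$\begin{aligned}\omega_c^{-2}\langle Q(f,f)\rangle(x,v)&=\mathrm{div}_{\omega_cx,v}\Big\{\int_{\mathbb R^2}\int_{\mathbb R^3}\sum_{i=1}^4f(\bar x',x_3,v')\,\xi^i(\bar x,v,\bar x',v')\otimes\xi^i(\bar x,v,\bar x',v')\,\nabla_{\omega_cx,v}f(x,v)\,dv'd\bar x'\Big\}\\&\quad-\mathrm{div}_{\omega_cx,v}\Big\{\int_{\mathbb R^2}\int_{\mathbb R^3}\sum_{i=1}^4f(x,v)\,\xi^i(\bar x,v,\bar x',v')\otimes\varepsilon_i\xi^i(\bar x',v',\bar x,v)\,\nabla_{\omega_cx',v'}f(\bar x',x_3,v')\,dv'd\bar x'\Big\}.\end{aligned}$$ 2. Let $x_3\in\mathbb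 R$ be such that $f(\cdot,x_3,\cdot)$ and the derivatives of $f$ of order at most $2$ at height $x_3$ decay in $(\bar x,v)$ faster than any power. Then the following integrals converge absolutely and $$\int_{\mathbb R^2}\int_{\mathbb R^3}\langle Q(f,f)\rangle\,dv\,d\bar x=0,\quad\int_{\mathbb R^2}\int_{\mathbb R^3}v\,\langle Q(f,f)\rangle\,dv\,d\bar x=0,\quad\int_{\mathbb R^2}\int_{\mathbb R^3}\tfrac{|v|^2}2\langle Q(f,f)\rangle\,dv\,d\bar x=0.$$ If moreover $f>0$ at height $x_3$ and $|\ln f(\bar x,x_3,v)|$ grows at most polynomially in $(\bar x,v)$, then $\ln f\,\langle Q(f,f)\rangle$ is integrable in $(\bar x,v)$ and $$\int_{\mathbb R^2}\int_{\mathbb R^3}\ln f\,\langle Q(f,f)\rangle\,dv\,d\bar x\le0.$$ -/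

import Mathlib

open MeasureTheory Set

noncomputable section

namespace FPL

/-- The plane of perpendicular coordinates `(x₁, x₂)`, with the Euclidean norm. -/
abbrev R2 := EuclideanSpace ℝ (Fin 2)

/-- Position or velocity space, with the Euclidean norm. -/
abbrev R3 := EuclideanSpace ℝ (Fin 3)

/-- Phase space: pairs `(x, v)`.  Also used for vectors `(ξ_x, ξ_v)` of `ℝ⁶`. -/
abbrev Phase := R3 × R3

/-- The perpendicular part `(v₁, v₂)` of `v = (v₁, v₂, v₃)`. -/
def bar (v : R3) : R2 := !₂[v 0, v 1]

/-- The vector `(p₁, p₂, t)`. -/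
def lift (p : R2) (t : ℝ) : R3 := !₂[p 0, p 1, t]

/-- `⊥(p₁, p₂) = (p₂, -p₁)`. -/
def perp (p : R2) : R2 := !₂[p 1, -p 0]

/-- The rotation of angle `α` in the plane. -/
def rot (α : ℝ) (p : R2) : R2 :=
  !₂[Real.cos α * p 0 - Real.sin α * p 1, Real.sin α * p 0 + Real.cos α * p 1]

/-- The third basis vector of `ℝ³`. -/
def e3 : R3 := EuclideanSpace.single 2 1

/-! ### Transport operator and gyroaverage -/

/-- `𝒯 f = v̄ · ∇_x̄ f + ω ⊥v̄ · ∇_v̄ f`. -/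
def transport (ω : ℝ) (f : Phase → ℝ) (p : Phase) : ℝ :=
  fderiv ℝ f p (lift (bar p.2) 0, ω • lift (perp (bar p.2)) 0)

/-- The characteristic flow `s ↦ (X, V)(s; x, v)` of `𝒯`. -/
def gyroFlow (ω s : ℝ) (p : Phase) : Phase :=
  (lift (bar p.1 + ω⁻¹ • perp (bar p.2) - ω⁻¹ • perp (rot (-(ω * s)) (bar p.2))) (p.1 2),
    lift (rot (-(ω * s)) (bar p.2)) (p.2 2))

/-- The average along the flow of `𝒯`, over one period `T = 2π / ω`. -/
def gyroAverage (ω : ℝ) (u : Phase → ℝ) (p : Phase) : ℝ :=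
  (2 * Real.pi / ω)⁻¹ * ∫ s in (0 : ℝ)..(2 * Real.pi / ω), u (gyroFlow ω s p)

/-! ### The Fokker-Planck-Landau kernel -/

/-- The gradient in `v` of a function on phase space. -/
def gradV (f : Phase → ℝ) (p : Phase) : R3 := gradient (fun v => f (p.1, v)) p.2

/-- The gradient in `x` of a function on phase space. -/
def gradX (f : Phase → ℝ) (p : Phase) : R3 := gradient (fun x => f (x, p.2)) p.1

/-- `S(w) y = y - (w · y) w / |w|²`: the orthogonal projection on the plane of normal `w`. -/
def S (w y : R3) : R3 := y - (inner ℝ w y / ‖w‖ ^ 2) • w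

/-- `div_v` of a field `F : ℝ³ × ℝ³ → ℝ³`. -/
def divV (F : Phase → R3) (p : Phase) : ℝ :=
  ∑ i : Fin 3, (fderiv ℝ (fun v => F (p.1, v)) p.2 (EuclideanSpace.single i 1)) i

/-- `σ(|v - v'|) S(v - v') f(x, v') ∇_v f(x, v)`. -/
def gainKernel (σ : ℝ → ℝ) (f : Phase → ℝ) (p : Phase) (v' : R3) : R3 :=
  σ ‖p.2 - v'‖ • S (p.2 - v') (f (p.1, v') • gradV f p)

/-- `σ(|v - v'|) S(v - v') f(x, v) ∇_{v'} f(x, v')`. -/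
def lossKernel (σ : ℝ → ℝ) (f : Phase → ℝ) (p : Phase) (v' : R3) : R3 :=
  σ ‖p.2 - v'‖ • S (p.2 - v') (f p • gradV f (p.1, v'))

/-- `σ(|v - v'|) S(v - v') [f(x, v') ∇_v f(x, v) - f(x, v) ∇_{v'} f(x, v')]`. -/
def fplKernel (σ : ℝ → ℝ) (f : Phase → ℝ) (p : Phase) (v' : R3) : R3 :=
  σ ‖p.2 - v'‖ • S (p.2 - v') (f (p.1, v') • gradV f p - f p • gradV f (p.1, v'))

/-- The velocity flux of the kernel `K`. -/
def velFlux (K : Phase → R3 → R3) (p : Phase) : R3 := ∫ v', K p v'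

/-- The gain part of the Fokker-Planck-Landau kernel. -/
def Qgain (σ : ℝ → ℝ) (f : Phase → ℝ) : Phase → ℝ := divV (velFlux (gainKernel σ f))

/-- The loss part of the Fokker-Planck-Landau kernel. -/
def Qloss (σ : ℝ → ℝ) (f : Phase → ℝ) : Phase → ℝ := divV (velFlux (lossKernel σ f))

/-- The Fokker-Planck-Landau kernel `Q(f, f)`. -/
def Q (σ : ℝ → ℝ) (f : Phase → ℝ) : Phase → ℝ := divV (velFlux (fplKernel σ f))

/-! ### Calculus in the variables `(ω x, v)` -/

/-- `∇_{ωx, v} f = (ω⁻¹ ∇_x f, ∇_v f)`. -/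
def gradOmega (ω : ℝ) (f : Phase → ℝ) (p : Phase) : Phase := (ω⁻¹ • gradX f p, gradV f p)

/-- `div_{ωx, v} F = ω⁻¹ div_x F_x + div_v F_v`. -/
def divOmega (ω : ℝ) (F : Phase → Phase) (p : Phase) : ℝ :=
  ω⁻¹ * (∑ i : Fin 3, (fderiv ℝ F p (EuclideanSpace.single i 1, 0)).1 i)
    + ∑ i : Fin 3, (fderiv ℝ F p (0, EuclideanSpace.single i 1)).2 i

/-- The Euclidean inner product of `ℝ⁶`. -/
def dot (a b : Phase) : ℝ := inner ℝ a.1 b.1 + inner ℝ a.2 b.2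

/-- The matrix `a ⊗ b` applied to `y`: `(a ⊗ b) y = (b · y) a`. -/
def tens (a b y : Phase) : Phase := dot b y • a

/-! ### The explicit coefficients

A pair `q = (x̄, v) : R2 × R3` holds the perpendicular position and the velocity; `q'` stands for
`(x̄', v')`. -/

/-- `(x̄, v)` for a phase point `(x, v)`. -/
def red (p : Phase) : R2 × R3 := (bar p.1, p.2)

/-- `(x̄, x₃, v)`. -/
def pt (q : R2 × R3) (x3 : ℝ) : Phase := (lift q.1 x3, q.2)

/-- `r = |v̄|`. -/
def rad (q : R2 × R3) : ℝ := ‖bar q.2‖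

/-- `z = (ω x̄ + ⊥v̄) - (ω x̄' + ⊥v̄')`. -/
def zvec (ω : ℝ) (q q' : R2 × R3) : R2 :=
  (ω • q.1 + perp (bar q.2)) - (ω • q'.1 + perp (bar q'.2))

/-- `v₃ - v₃'`. -/
def dv3 (q q' : R2 × R3) : ℝ := q.2 2 - q'.2 2

/-- `√(|z|² + (v₃ - v₃')²)`. -/
def relSpeed (ω : ℝ) (q q' : R2 × R3) : ℝ :=
  Real.sqrt (‖zvec ω q q'‖ ^ 2 + dv3 q q' ^ 2)

open Classical in
/-- `χ(r, r', z)`. -/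
def chi (r r' : ℝ) (z : R2) : ℝ :=
  if |r - r'| < ‖z‖ ∧ ‖z‖ < r + r' then
    1 / (Real.pi ^ 2 * Real.sqrt (‖z‖ ^ 2 - (r - r') ^ 2) * Real.sqrt ((r + r') ^ 2 - ‖z‖ ^ 2))
  else 0

/-- The angle `φ ∈ (0, π)` with `|z|² = r² + r'² - 2 r r' cos φ`, for `|r - r'| < |z| < r + r'`. -/
def angle (r r' : ℝ) (z : R2) : ℝ := Real.arccos ((r ^ 2 + r' ^ 2 - ‖z‖ ^ 2) / (2 * r * r'))

/-- `φ` at a pair of points. -/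
def phi (ω : ℝ) (q q' : R2 × R3) : ℝ := angle (rad q) (rad q') (zvec ω q q')

/-- `σ(√(|z|² + (v₃ - v₃')²)) χ(r, r', z)`. -/
def sigmaChi (ω : ℝ) (σ : ℝ → ℝ) (q q' : R2 × R3) : ℝ :=
  σ (relSpeed ω q q') * chi (rad q) (rad q') (zvec ω q q')

/-- `((v̄, 0) / |v̄|, (⊥v̄, 0) / |v̄|)`. -/
def dirA (q : R2 × R3) : Phase :=
  ((rad q)⁻¹ • lift (bar q.2) 0, (rad q)⁻¹ • lift (perp (bar q.2)) 0)

/-- `((⊥v̄, 0) / |v̄|, -(v̄, 0) / |v̄|)`. -/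
def dirB (q : R2 × R3) : Phase :=
  ((rad q)⁻¹ • lift (perp (bar q.2)) 0, -((rad q)⁻¹ • lift (bar q.2) 0))

/-- `((⊥z, 0) / |z|, 0)`. -/
def dirZ (ω : ℝ) (q q' : R2 × R3) : Phase :=
  (‖zvec ω q q'‖⁻¹ • lift (perp (zvec ω q q')) 0, 0)

/-- `((v₃ - v₃') (z, 0) / |z|, -|z| e₃) / √(|z|² + (v₃ - v₃')²)`. -/
def dirW (ω : ℝ) (q q' : R2 × R3) : Phase :=
  (relSpeed ω q q')⁻¹ •
    ((dv3 q q' * ‖zvec ω q q'‖⁻¹) • lift (zvec ω q q') 0, -(‖zvec ω q q'‖ • e3))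

/-- The matrix `A⁺`, applied to `y ∈ ℝ⁶`. -/
def Aplus (ω : ℝ) (q q' : R2 × R3) (y : Phase) : Phase :=
  let r := rad q
  let r' := rad q'
  let φ := phi ω q q'
  let l := ‖zvec ω q q'‖
  let d := dv3 q q'
  let ρ := relSpeed ω q q'
  let b2 := ((r - r' * Real.cos φ) / l) • dirA q + dirZ ω q q'
  let b4 := ((r' * Real.cos φ - r) * d / (l * ρ)) • dirB q + dirW ω q q'
  (r' ^ 2 * Real.sin φ ^ 2 * d ^ 2 / (l ^ 2 * (l ^ 2 + d ^ 2))) • tens (dirA q) (dirA q) y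
    + tens b2 b2 y
    + (r' ^ 2 * Real.sin φ ^ 2 / l ^ 2) • tens (dirB q) (dirB q) y
    + tens b4 b4 y

/-- The matrix `A⁻`, applied to `y ∈ ℝ⁶`. -/
def Aminus (ω : ℝ) (q q' : R2 × R3) (y : Phase) : Phase :=
  let r := rad q
  let r' := rad q'
  let φ := phi ω q q'
  let l := ‖zvec ω q q'‖
  let d := dv3 q q'
  let ρ := relSpeed ω q q'
  let b2 := ((r - r' * Real.cos φ) / l) • dirA q + dirZ ω q q'
  let c2 := ((r * Real.cos φ - r') / l) • dirA q' + dirZ ω q q'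
  let b4 := ((r' * Real.cos φ - r) * d / (l * ρ)) • dirB q + dirW ω q q'
  let c4 := ((r' - r * Real.cos φ) * d / (l * ρ)) • dirB q' + dirW ω q q'
  (r * r' * Real.sin φ ^ 2 * d ^ 2 / (l ^ 2 * (l ^ 2 + d ^ 2))) • tens (dirA q) (dirA q') y
    + tens b2 c2 y
    + (r * r' * Real.sin φ ^ 2 / l ^ 2) • tens (dirB q) (dirB q') y
    + tens b4 c4 y

/-- The fields `ξ¹, ξ², ξ³, ξ⁴` (indexed from `0`), at `(x̄, v, x̄', v')`. -/
def xi (ω : ℝ) (σ : ℝ → ℝ) (i : Fin 4) (q q' : R2 × R3) : Phase :=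
  let r := rad q
  let r' := rad q'
  let φ := phi ω q q'
  let l := ‖zvec ω q q'‖
  let d := dv3 q q'
  let ρ := relSpeed ω q q'
  Real.sqrt (sigmaChi ω σ q q') •
    (![(r' * Real.sin φ * d / (l * ρ)) • dirA q,
      ((r - r' * Real.cos φ) / l) • dirA q + dirZ ω q q',
      (r' * Real.sin φ / l) • dirB q,
      ((r' * Real.cos φ - r) * d / (l * ρ)) • dirB q + dirW ω q q'] : Fin 4 → Phase) i

/-- The signs `(-1, -1, 1, 1)`. -/
def eps : Fin 4 → ℝ := ![-1, -1, 1, 1]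

/-! ### The integrands of the averaged fluxes -/

/-- `σ f(x̄', x₃, v') χ A⁺ ∇_{ωx, v} f(x, v)`. -/
def gainA (ω : ℝ) (σ : ℝ → ℝ) (f : Phase → ℝ) (p : Phase) (q' : R2 × R3) : Phase :=
  (sigmaChi ω σ (red p) q' * f (pt q' (p.1 2))) • Aplus ω (red p) q' (gradOmega ω f p)

/-- `σ f(x, v) χ A⁻ ∇_{ωx', v'} f(x̄', x₃, v')`. -/
def lossA (ω : ℝ) (σ : ℝ → ℝ) (f : Phase → ℝ) (p : Phase) (q' : R2 × R3) : Phase :=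
  (sigmaChi ω σ (red p) q' * f p) • Aminus ω (red p) q' (gradOmega ω f (pt q' (p.1 2)))

/-- `∑ᵢ f(x̄', x₃, v') ξⁱ(x̄, v, x̄', v') ⊗ ξⁱ(x̄, v, x̄', v') ∇_{ωx, v} f(x, v)`. -/
def gainXi (ω : ℝ) (σ : ℝ → ℝ) (f : Phase → ℝ) (p : Phase) (q' : R2 × R3) : Phase :=
  ∑ i : Fin 4, f (pt q' (p.1 2)) •
    tens (xi ω σ i (red p) q') (xi ω σ i (red p) q') (gradOmega ω f p)

/-- `∑ᵢ f(x, v) ξⁱ(x̄, v, x̄', v') ⊗ εᵢ ξⁱ(x̄', v', x̄, v) ∇_{ωx', v'} f(x̄', x₃, v')`. -/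
def lossXi (ω : ℝ) (σ : ℝ → ℝ) (f : Phase → ℝ) (p : Phase) (q' : R2 × R3) : Phase :=
  ∑ i : Fin 4, f p •
    tens (xi ω σ i (red p) q') (eps i • xi ω σ i q' (red p)) (gradOmega ω f (pt q' (p.1 2)))

/-- The flux `∫ K(x, v; x̄', v') dx̄' dv'`. -/
def phaseFlux (K : Phase → R2 × R3 → Phase) (p : Phase) : Phase := ∫ q', K p q'

/-! ### Regularity classes -/

/-- `f` and its derivatives of order at most two decay in `v` faster than any power, locally
uniformly in `x`. -/
def RapidDecayV (f : Phase → ℝ) : Prop :=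
  ∀ (k j : ℕ), j ≤ 2 → ∀ R : ℝ, ∃ C : ℝ, ∀ x v : R3, ‖x‖ ≤ R →
    (1 + ‖v‖) ^ k * ‖iteratedFDeriv ℝ j f (x, v)‖ ≤ C

/-- At the height `x₃`, `f` and its derivatives of order at most two decay in `(x̄, v)` faster than
any power. -/
def RapidDecayAt (f : Phase → ℝ) (x3 : ℝ) : Prop :=
  ∀ (k j : ℕ), j ≤ 2 → ∃ C : ℝ, ∀ q : R2 × R3,
    (1 + ‖q.1‖ + ‖q.2‖) ^ k * ‖iteratedFDeriv ℝ j f (pt q x3)‖ ≤ C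

/-- At the height `x₃`, `f` is positive and `ln f` grows at most polynomially in `(x̄, v)`. -/
def LogTempered (f : Phase → ℝ) (x3 : ℝ) : Prop :=
  (∀ q : R2 × R3, 0 < f (pt q x3)) ∧
    ∃ (k : ℕ) (C : ℝ), ∀ q : R2 × R3, |Real.log (f (pt q x3))| ≤ C * (1 + ‖q.1‖ + ‖q.2‖) ^ k

end FPL

end

noncomputable section

namespace FPL

/-! ### Linear coordinates -/

/-! The flow of `𝒯` acts by linear maps `flow ω t` indexed by an angle, so the gyroaverage is a mean
over a circle, and `f`, being constant on orbits, may be evaluated anywhere on an orbit. The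
dilation `dilL` intertwines `flow ω` with `flow 1`. Conjugating a velocity divergence by the flow
and using the cyclicity of the trace, the average of `div_v F` is `div_{ωx,v}` of the circle mean of
`flowL 1 (-t) (0, F (flow ω t p))` (`divOmega_avgFlux`). It remains to compute this averaged flux
for the Landau kernels.

That flux is an integral over an angle `t` and a velocity `w`. Writing `w = R_s v'` with a second
free angle `s` costs nothing, since rotations preserve Lebesgue measure
(`measurePreserving_paramVel`). Flowing `(X(t), R_s v')` back by the angle `s` leads to a point
`(x̄', x₃, v')` with `z = ⊥U`, where `U = R_t v̄ - R_s v̄'`. For independent uniform rotations `z`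
has density `χ` (`lintegral_perp_rotT_sub`: law of cosines and polar coordinates), so `(x̄', v')`
carries the density `ω² χ` (`map_paramPt`).

The map from angles to `z` is two-to-one: the triangle of the two rotated vectors and its mirror
image in the line of `U` give the same `z`. Since `S` is a sum of two squares of unit vectors
(`S_lift`), the pulled-back kernel is a sum of tensor products of combinations of `a, b, c, e`, in
which a single coefficient `⟨⊥U, R_t v̄⟩ / |U|` changes sign under the mirror. Averaging over the
two preimages kills the odd cross terms and leaves `A⁺` and `A⁻` (`pullKernel_gain_symm`,
`pullKernel_loss_symm`, `transfer_paramPt`).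

For the conservation laws, the flow preserves `dx̄ dv`, so the average moves onto the test function
(`integral_gyroAverage_smul`): `1`, `|v|²/2` and `ln f` are invariant, and `v` is only rotated. The
local weak form `integral_Q_mul_symm` pairs `∇ψ(v) - ∇ψ(v')` with an antisymmetric kernel; it
vanishes for the collision invariants and has a sign for `ln f`. For `ln f` the integrability rests
on the decay of `|∇_v f|² / f`, which follows from positivity and a bound on second derivatives
(`sq_norm_gradV_le`).

Regularity is obtained from the convolution structure in `v`: all derivatives fall on `f`, so `σ`
needs only measurability and moderate growth. -/

@[simp] lemma bar_zero_apply (v : R3) : bar v 0 = v 0 := rfl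
@[simp] lemma bar_one_apply (v : R3) : bar v 1 = v 1 := rfl
@[simp] lemma lift_zero_apply (p : R2) (t : ℝ) : lift p t 0 = p 0 := rfl
@[simp] lemma lift_one_apply (p : R2) (t : ℝ) : lift p t 1 = p 1 := rfl
@[simp] lemma lift_two_apply (p : R2) (t : ℝ) : lift p t 2 = t := rfl
@[simp] lemma perp_zero_apply (p : R2) : perp p 0 = p 1 := rfl
@[simp] lemma perp_one_apply (p : R2) : perp p 1 = -p 0 := rfl

lemma R2.ext {p q : R2} (h0 : p 0 = q 0) (h1 : p 1 = q 1) : p = q := by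
  ext i; fin_cases i <;> assumption

lemma R3.ext {p q : R3} (h0 : p 0 = q 0) (h1 : p 1 = q 1) (h2 : p 2 = q 2) : p = q := by
  ext i; fin_cases i <;> assumption

@[simp] lemma bar_lift (p : R2) (t : ℝ) : bar (lift p t) = p := R2.ext rfl rfl
@[simp] lemma lift_bar (v : R3) : lift (bar v) (v 2) = v := R3.ext rfl rfl rfl

lemma norm_sq_R2 (p : R2) : ‖p‖ ^ 2 = p 0 ^ 2 + p 1 ^ 2 := by
  simp [EuclideanSpace.norm_sq_eq, Fin.sum_univ_two]

lemma norm_sq_R3 (p : R3) : ‖p‖ ^ 2 = p 0 ^ 2 + p 1 ^ 2 + p 2 ^ 2 := by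
  simp [EuclideanSpace.norm_sq_eq, Fin.sum_univ_three]

lemma inner_R2 (p q : R2) : inner ℝ p q = p 0 * q 0 + p 1 * q 1 := by
  simp [PiLp.inner_apply, Fin.sum_univ_two, mul_comm]

lemma inner_R3 (p q : R3) : inner ℝ p q = p 0 * q 0 + p 1 * q 1 + p 2 * q 2 := by
  simp [PiLp.inner_apply, Fin.sum_univ_three, mul_comm]

lemma norm_sq_lift (p : R2) (t : ℝ) : ‖lift p t‖ ^ 2 = ‖p‖ ^ 2 + t ^ 2 := by
  rw [norm_sq_R3, norm_sq_R2]; simp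

@[simp] lemma norm_perp (p : R2) : ‖perp p‖ = ‖p‖ := by
  rw [← sq_eq_sq₀ (norm_nonneg _) (norm_nonneg _), norm_sq_R2, norm_sq_R2]
  simp only [perp_zero_apply, perp_one_apply]; ring

lemma norm_bar_le (v : R3) : ‖bar v‖ ≤ ‖v‖ := by
  rw [← sq_le_sq₀ (norm_nonneg _) (norm_nonneg _), norm_sq_R2, norm_sq_R3]
  simp only [bar_zero_apply, bar_one_apply]; nlinarith [sq_nonneg (v 2)]

lemma abs_coord_le_R3 (v : R3) (i : Fin 3) : |v i| ≤ ‖v‖ := by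
  simpa using PiLp.norm_apply_le v i

/-- `bar` as a continuous linear map. -/
def barL : R3 →L[ℝ] R2 := LinearMap.toContinuousLinearMap
  { toFun := bar
    map_add' := fun x y => R2.ext (by simp) (by simp)
    map_smul' := fun c x => R2.ext (by simp) (by simp) }

/-- `perp` as a continuous linear map. -/
def perpL : R2 →L[ℝ] R2 := LinearMap.toContinuousLinearMap
  { toFun := perp
    map_add' := fun x y => R2.ext (by simp) (by simp; ring)
    map_smul' := fun c x => R2.ext (by simp) (by simp) }

/-- `lift` as a continuous linear map. -/
def liftL : R2 × ℝ →L[ℝ] R3 := LinearMap.toContinuousLinearMap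
  { toFun := fun q => lift q.1 q.2
    map_add' := fun x y => R3.ext (by simp) (by simp) (by simp)
    map_smul' := fun c x => R3.ext (by simp) (by simp) (by simp) }

@[fun_prop] lemma continuous_bar : Continuous bar := barL.continuous
@[fun_prop] lemma continuous_perp : Continuous perp := perpL.continuous
lemma continuous_lift : Continuous fun q : R2 × ℝ => lift q.1 q.2 := liftL.continuous

@[fun_prop] lemma Continuous.lift' {X : Type*} [TopologicalSpace X] {a : X → R2} {b : X → ℝ}
    (ha : Continuous a) (hb : Continuous b) : Continuous fun x => lift (a x) (b x) :=
  continuous_lift.comp (ha.prodMk hb)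

@[fun_prop] lemma continuous_coord_R3 (i : Fin 3) : Continuous fun v : R3 => v i :=
  (EuclideanSpace.proj i : R3 →L[ℝ] ℝ).continuous

@[fun_prop] lemma continuous_coord_R2 (i : Fin 2) : Continuous fun v : R2 => v i :=
  (EuclideanSpace.proj i : R2 →L[ℝ] ℝ).continuous

@[fun_prop] lemma measurable_bar : Measurable bar := continuous_bar.measurable
@[fun_prop] lemma measurable_perp : Measurable perp := continuous_perp.measurable

@[fun_prop] lemma Measurable.lift' {X : Type*} [MeasurableSpace X] {a : X → R2} {b : X → ℝ}
    (ha : Measurable a) (hb : Measurable b) : Measurable fun x => lift (a x) (b x) :=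
  continuous_lift.measurable.comp (ha.prodMk hb)

lemma bar_sub (v w : R3) : bar (v - w) = bar v - bar w := barL.map_sub v w
lemma bar_smul (c : ℝ) (v : R3) : bar (c • v) = c • bar v := barL.map_smul c v
@[simp] lemma perp_perp (v : R2) : perp (perp v) = -v := R2.ext (by simp) (by simp)

/-! ### The circle of gyration angles -/

instance fact_two_pi_pos : Fact ((0 : ℝ) < 2 * Real.pi) := ⟨Real.two_pi_pos⟩

/-- The circle of gyration angles. -/
abbrev Torus := AddCircle (2 * Real.pi)

/-- The uniform probability on the circle of gyration angles. -/
abbrev haarT : Measure Torus := AddCircle.haarAddCircle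

/-- The point `exp (i t)` of the unit circle. -/
def expT (t : Torus) : ℂ := (AddCircle.toCircle t : ℂ)

/-- The cosine of an angle. -/
def cosT (t : Torus) : ℝ := (expT t).re

/-- The sine of an angle. -/
def sinT (t : Torus) : ℝ := (expT t).im

@[fun_prop] lemma continuous_expT : Continuous expT :=
  continuous_subtype_val.comp AddCircle.continuous_toCircle

@[fun_prop] lemma continuous_cosT : Continuous cosT := Complex.continuous_re.comp continuous_expT
@[fun_prop] lemma continuous_sinT : Continuous sinT := Complex.continuous_im.comp continuous_expT

lemma expT_add (s t : Torus) : expT (s + t) = expT s * expT t := by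
  simp [expT, AddCircle.toCircle_add]

lemma expT_neg (t : Torus) : expT (-t) = (starRingEnd ℂ) (expT t) := by
  simp only [expT, AddCircle.toCircle_neg, Circle.coe_inv_eq_conj]

@[simp] lemma expT_zero : expT 0 = 1 := by simp [expT]

@[simp] lemma norm_expT (t : Torus) : ‖expT t‖ = 1 := Circle.norm_coe _

lemma expT_coe (x : ℝ) : expT (x : Torus) = Complex.exp (x * Complex.I) := by
  rw [expT, AddCircle.toCircle_apply_mk, div_self Real.two_pi_pos.ne', one_mul, Circle.coe_exp]

@[simp] lemma cosT_coe (x : ℝ) : cosT (x : Torus) = Real.cos x := by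
  rw [cosT, expT_coe, Complex.exp_ofReal_mul_I_re]

@[simp] lemma sinT_coe (x : ℝ) : sinT (x : Torus) = Real.sin x := by
  rw [sinT, expT_coe, Complex.exp_ofReal_mul_I_im]

lemma cosT_sq_add_sinT_sq (t : Torus) : cosT t ^ 2 + sinT t ^ 2 = 1 := by
  have h := Complex.sq_norm (expT t)
  rw [norm_expT, Complex.normSq_apply] at h
  rw [cosT, sinT]; linarith

lemma cosT_add (s t : Torus) : cosT (s + t) = cosT s * cosT t - sinT s * sinT t := by
  simp [cosT, sinT, expT_add]

lemma sinT_add (s t : Torus) : sinT (s + t) = sinT s * cosT t + cosT s * sinT t := by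
  simp only [cosT, sinT, expT_add, Complex.mul_im]; ring

@[simp] lemma cosT_neg (t : Torus) : cosT (-t) = cosT t := by simp [cosT, expT_neg]
@[simp] lemma sinT_neg (t : Torus) : sinT (-t) = -sinT t := by simp [sinT, expT_neg]
@[simp] lemma cosT_zero : cosT 0 = 1 := by simp [cosT]
@[simp] lemma sinT_zero : sinT 0 = 0 := by simp [sinT]

/-- The rotation of the plane. -/
def rotT (t : Torus) (p : R2) : R2 := cosT t • p - sinT t • perp p

@[simp] lemma rotT_zero_apply (t : Torus) (p : R2) :
    rotT t p 0 = cosT t * p 0 - sinT t * p 1 := by simp [rotT]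

@[simp] lemma rotT_one_apply (t : Torus) (p : R2) :
    rotT t p 1 = sinT t * p 0 + cosT t * p 1 := by simp [rotT]; ring

lemma rot_eq_rotT (α : ℝ) (p : R2) : rot α p = rotT (α : Torus) p :=
  R2.ext (by simp [rot]) (by simp [rot])

lemma rotT_add (s t : Torus) (p : R2) : rotT (s + t) p = rotT s (rotT t p) :=
  R2.ext (by simp [cosT_add, sinT_add]; ring) (by simp [cosT_add, sinT_add]; ring)

@[simp] lemma rotT_zero (p : R2) : rotT 0 p = p := R2.ext (by simp) (by simp)

lemma rotT_perp (t : Torus) (p : R2) : rotT t (perp p) = perp (rotT t p) :=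
  R2.ext (by simp; ring) (by simp; ring)

lemma rotT_map_smul (t : Torus) (c : ℝ) (p : R2) : rotT t (c • p) = c • rotT t p :=
  R2.ext (by simp; ring) (by simp; ring)

@[simp] lemma rotT_neg_rotT (t : Torus) (p : R2) : rotT (-t) (rotT t p) = p := by
  rw [← rotT_add]; simp

@[simp] lemma norm_rotT (t : Torus) (p : R2) : ‖rotT t p‖ = ‖p‖ := by
  rw [← sq_eq_sq₀ (norm_nonneg _) (norm_nonneg _), norm_sq_R2, norm_sq_R2]
  simp only [rotT_zero_apply, rotT_one_apply]
  linear_combination (p 0 ^ 2 + p 1 ^ 2) * cosT_sq_add_sinT_sq t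

@[fun_prop] lemma Continuous.rotT' {X : Type*} [TopologicalSpace X] {a : X → Torus} {b : X → R2}
    (ha : Continuous a) (hb : Continuous b) : Continuous fun x => rotT (a x) (b x) := by
  unfold rotT; fun_prop

lemma inner_rotT_left (t : Torus) (p q : R2) :
    inner ℝ (rotT (-t) p) q = inner ℝ p (rotT t q) := by
  rw [inner_R2, inner_R2]; simp; ring

/-! ### The gyration flow -/

/-- The velocity rotation of `ℝ³` about the third axis. -/
def rot3 (t : Torus) (v : R3) : R3 := lift (rotT t (bar v)) (v 2)

lemma norm_rot3 (t : Torus) (v : R3) : ‖rot3 t v‖ = ‖v‖ := by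
  rw [← sq_eq_sq₀ (norm_nonneg _) (norm_nonneg _), rot3, norm_sq_lift, norm_rotT,
    norm_sq_R3, norm_sq_R2]
  simp

@[simp] lemma rot3_neg_rot3 (t : Torus) (v : R3) : rot3 (-t) (rot3 t v) = v := by
  simp [rot3]

@[simp] lemma rot3_rot3_neg (t : Torus) (v : R3) : rot3 t (rot3 (-t) v) = v := by
  simpa using rot3_neg_rot3 (-t) v

@[simp] lemma bar_rot3 (t : Torus) (v : R3) : bar (rot3 t v) = rotT t (bar v) := by simp [rot3]

@[fun_prop] lemma Continuous.rot3' {X : Type*} [TopologicalSpace X] {a : X → Torus} {b : X → R3}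
    (ha : Continuous a) (hb : Continuous b) : Continuous fun x => rot3 (a x) (b x) := by
  unfold rot3; fun_prop

/-- The rotation about the third axis as a linear isometry. -/
def rot3Equiv (t : Torus) : R3 ≃ₗᵢ[ℝ] R3 where
  toFun := rot3 t
  invFun := rot3 (-t)
  left_inv := rot3_neg_rot3 t
  right_inv := rot3_rot3_neg t
  map_add' := fun x y => R3.ext (by simp [rot3]; ring) (by simp [rot3]; ring) (by simp [rot3])
  map_smul' := fun c x => R3.ext (by simp [rot3]; ring) (by simp [rot3]; ring) (by simp [rot3])
  norm_map' := norm_rot3 t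

lemma measurePreserving_rot3 (t : Torus) : MeasurePreserving (rot3 t) :=
  (rot3Equiv t).measurePreserving

/-- The flow of the transport operator, indexed by the angle of rotation of the velocity. -/
def flow (ω : ℝ) (t : Torus) (p : Phase) : Phase :=
  (lift (bar p.1 + ω⁻¹ • perp (bar p.2) - ω⁻¹ • perp (rotT t (bar p.2))) (p.1 2), rot3 t p.2)

lemma gyroFlow_eq_flow (ω s : ℝ) (p : Phase) :
    gyroFlow ω s p = flow ω ((-(ω * s) : ℝ) : Torus) p := by
  rw [gyroFlow, flow, rot3, rot_eq_rotT]

lemma Phase.ext {p q : Phase} (h0 : p.1 0 = q.1 0) (h1 : p.1 1 = q.1 1) (h2 : p.1 2 = q.1 2)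
    (h3 : p.2 0 = q.2 0) (h4 : p.2 1 = q.2 1) (h5 : p.2 2 = q.2 2) : p = q :=
  Prod.ext (R3.ext h0 h1 h2) (R3.ext h3 h4 h5)

lemma flow_add (ω : ℝ) (s t : Torus) (p : Phase) : flow ω (s + t) p = flow ω s (flow ω t p) := by
  -- The excluded simp lemma would cancel a common factor and leave a disjunction that `ring` cannot
  -- close.
  refine Phase.ext ?_ ?_ ?_ ?_ ?_ ?_ <;> simp [flow, rot3, cosT_add, sinT_add, -mul_eq_mul_left_iff] <;> ring

@[simp] lemma flow_zero (ω : ℝ) (p : Phase) : flow ω 0 p = p := by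
  refine Phase.ext ?_ ?_ ?_ ?_ ?_ ?_ <;> simp [flow, rot3]

@[simp] lemma flow_neg_flow (ω : ℝ) (t : Torus) (p : Phase) : flow ω (-t) (flow ω t p) = p := by
  rw [← flow_add]; simp

@[simp] lemma flow_flow_neg (ω : ℝ) (t : Torus) (p : Phase) : flow ω t (flow ω (-t) p) = p := by
  rw [← flow_add]; simp

@[fun_prop] lemma Continuous.flow' {X : Type*} [TopologicalSpace X] {ω : ℝ} {a : X → Torus}
    {b : X → Phase} (ha : Continuous a) (hb : Continuous b) :
    Continuous fun x => flow ω (a x) (b x) := by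
  unfold flow; fun_prop

/-- The part of `flow` that does not depend on the angle. -/
def flowConst (ω : ℝ) : Phase →L[ℝ] Phase := LinearMap.toContinuousLinearMap
  { toFun := fun p => (lift (bar p.1 + ω⁻¹ • perp (bar p.2)) (p.1 2), lift 0 (p.2 2))
    map_add' := fun x y => by refine Phase.ext ?_ ?_ ?_ ?_ ?_ ?_ <;> simp <;> ring
    map_smul' := fun c x => by refine Phase.ext ?_ ?_ ?_ ?_ ?_ ?_ <;> simp <;> ring }

/-- The coefficient of the cosine in `flow`. -/
def flowCos (ω : ℝ) : Phase →L[ℝ] Phase := LinearMap.toContinuousLinearMap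
  { toFun := fun p => (lift (-(ω⁻¹ • perp (bar p.2))) 0, lift (bar p.2) 0)
    map_add' := fun x y => by refine Phase.ext ?_ ?_ ?_ ?_ ?_ ?_ <;> simp <;> ring
    map_smul' := fun c x => by refine Phase.ext ?_ ?_ ?_ ?_ ?_ ?_ <;> simp <;> ring }

/-- The coefficient of the sine in `flow`. -/
def flowSin (ω : ℝ) : Phase →L[ℝ] Phase := LinearMap.toContinuousLinearMap
  { toFun := fun p => (lift (-(ω⁻¹ • bar p.2)) 0, lift (-perp (bar p.2)) 0)
    map_add' := fun x y => by refine Phase.ext ?_ ?_ ?_ ?_ ?_ ?_ <;> simp <;> ring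
    map_smul' := fun c x => by refine Phase.ext ?_ ?_ ?_ ?_ ?_ ?_ <;> simp <;> ring }

/-- The flow as a continuous linear map. -/
def flowL (ω : ℝ) (t : Torus) : Phase →L[ℝ] Phase :=
  flowConst ω + cosT t • flowCos ω + sinT t • flowSin ω

lemma flowL_apply (ω : ℝ) (t : Torus) (p : Phase) : flowL ω t p = flow ω t p := by
  refine Phase.ext ?_ ?_ ?_ ?_ ?_ ?_ <;>
    simp [flowL, flowConst, flowCos, flowSin, flow, rot3] <;> ring

@[fun_prop] lemma continuous_flowL (ω : ℝ) : Continuous (flowL ω) := by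
  unfold flowL; fun_prop

/-- The dilation `(ξ, η) ↦ (ω⁻¹ ξ, η)`. -/
def dilL (ω : ℝ) : Phase →L[ℝ] Phase :=
  (ω⁻¹ • ContinuousLinearMap.fst ℝ R3 R3).prod (ContinuousLinearMap.snd ℝ R3 R3)

@[simp] lemma dilL_apply (ω : ℝ) (y : Phase) : dilL ω y = (ω⁻¹ • y.1, y.2) := rfl

/-- The flow contains `ω` only through the gyroradius `ω⁻¹ |v̄|`, so rescaling positions by `ω`
normalises it to `1`. This is why the vectors of the averaged matrices do not involve the flow of
`ω` itself. -/
lemma flow_dilL (ω : ℝ) (t : Torus) (y : Phase) :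
    flow ω t (dilL ω y) = dilL ω (flow 1 t y) := by
  refine Phase.ext ?_ ?_ ?_ ?_ ?_ ?_ <;> simp [flow, rot3] <;> ring

/-! ### Invariance along the flow -/

/-- The angle is `-ω` times the time, so the derivative along the circle is `-ω⁻¹ 𝒯 f = 0`. -/
lemma flow_invariant {ω : ℝ} (hω : ω ≠ 0) {f : Phase → ℝ} (hf : Differentiable ℝ f)
    (hT : ∀ p, transport ω f p = 0) (t : Torus) (p : Phase) : f (flow ω t p) = f p := by
  have hder : ∀ s : ℝ, HasDerivAt (fun s : ℝ => f (flow ω (s : Torus) p)) 0 s := by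
    intro s
    have h1 : HasDerivAt (fun s : ℝ => flow ω (s : Torus) p)
        ((-Real.sin s) • flowCos ω p + Real.cos s • flowSin ω p) s := by
      have : (fun s : ℝ => flow ω (s : Torus) p) =
          fun s : ℝ => flowConst ω p + Real.cos s • flowCos ω p + Real.sin s • flowSin ω p := by
        funext s
        rw [← flowL_apply]; simp [flowL]
      rw [this]
      exact ((((Real.hasDerivAt_cos s).smul_const (flowCos ω p)).const_add
        (flowConst ω p))).add ((Real.hasDerivAt_sin s).smul_const (flowSin ω p))
    have h2 := (hf (flow ω (s : Torus) p)).hasFDerivAt.comp_hasDerivAt s h1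
    have h3 := hT (flow ω (s : Torus) p)
    rw [transport] at h3
    have h4 : ((-Real.sin s) • flowCos ω p + Real.cos s • flowSin ω p) = (-ω⁻¹) •
        (lift (bar (flow ω (s : Torus) p).2) 0,
          ω • lift (perp (bar (flow ω (s : Torus) p).2)) 0) := by
      refine Phase.ext ?_ ?_ ?_ ?_ ?_ ?_ <;>
        simp [flowCos, flowSin, flow, rot3] <;> field_simp <;> ring
    rw [h4, map_smul, h3, smul_zero] at h2
    exact h2
  induction t using QuotientAddGroup.induction_on with
  | H s =>
    have := is_const_of_deriv_eq_zero (fun s => (hder s).differentiableAt)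
      (fun s => (hder s).deriv) s 0
    simpa using this

/-- The gyroaverage as an average over the circle. -/
lemma gyroAverage_eq_integral {ω : ℝ} (hω : ω ≠ 0) (u : Phase → ℝ) (p : Phase) :
    gyroAverage ω u p = ∫ t, u (flow ω t p) ∂haarT := by
  have hpi : (2 * Real.pi) ≠ 0 := Real.two_pi_pos.ne'
  rw [AddCircle.integral_haarAddCircle, gyroAverage]
  -- Based at `-2π` because `s ↦ -ω s` carries the period onto the interval between `0` and `-2π`,
  -- whatever the sign of `ω`.
  have h1 := AddCircle.intervalIntegral_preimage (2 * Real.pi) (-(2 * Real.pi))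
    (fun t => u (flow ω t p))
  rw [← h1, neg_add_cancel]
  have h2 := intervalIntegral.integral_comp_mul_left (a := 0) (b := 2 * Real.pi / ω)
    (fun x : ℝ => u (flow ω (x : Torus) p)) (c := -ω) (neg_ne_zero.2 hω)
  have h3 : (fun s => u (gyroFlow ω s p)) =
      fun x : ℝ => u (flow ω ((-ω * x : ℝ) : Torus) p) := by
    funext s; rw [gyroFlow_eq_flow, neg_mul]
  rw [h3, h2, mul_zero, intervalIntegral.integral_symm]
  have h4 : -ω * (2 * Real.pi / ω) = -(2 * Real.pi) := by field_simp
  rw [h4]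
  simp only [smul_eq_mul]
  field_simp

/-! ### Divergences -/

/-- The trace of an endomorphism of `ℝ³ × ℝ³`. -/
def trP (A : Phase →L[ℝ] Phase) : ℝ :=
  (∑ i : Fin 3, (A (EuclideanSpace.single i 1, 0)).1 i)
    + ∑ i : Fin 3, (A (0, EuclideanSpace.single i 1)).2 i

/-- The coordinate-free trace is cyclic, which lets the flow cancel against its inverse inside a
divergence. -/
lemma trP_eq_trace (A : Phase →L[ℝ] Phase) : trP A = LinearMap.trace ℝ Phase A := by
  have b := (EuclideanSpace.basisFun (Fin 3) ℝ).toBasis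
  rw [LinearMap.trace_eq_matrix_trace ℝ
    ((EuclideanSpace.basisFun (Fin 3) ℝ).toBasis.prod (EuclideanSpace.basisFun (Fin 3) ℝ).toBasis)]
  simp [trP, Matrix.trace, LinearMap.toMatrix_apply]

lemma trP_comm (A B : Phase →L[ℝ] Phase) : trP (A.comp B) = trP (B.comp A) := by
  rw [trP_eq_trace, trP_eq_trace]
  exact LinearMap.trace_mul_comm ℝ (A : Phase →ₗ[ℝ] Phase) (B : Phase →ₗ[ℝ] Phase)

lemma divOmega_eq_trP (ω : ℝ) (F : Phase → Phase) (p : Phase) :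
    divOmega ω F p = trP ((dilL ω).comp (fderiv ℝ F p)) := by
  simp [divOmega, trP, Finset.mul_sum]

lemma fderiv_slice {E : Type*} [NormedAddCommGroup E] [NormedSpace ℝ E] {F : Phase → E}
    (p : Phase) (hF : DifferentiableAt ℝ F p) :
    HasFDerivAt (fun v => F (p.1, v)) ((fderiv ℝ F p).comp (ContinuousLinearMap.inr ℝ R3 R3))
      p.2 :=
  HasFDerivAt.comp (g := F) p.2 hF.hasFDerivAt (hasFDerivAt_prodMk_right p.1 p.2)

lemma divV_eq_trP {F : Phase → R3} {p : Phase} (hF : DifferentiableAt ℝ F p) :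
    divV F p = trP ((ContinuousLinearMap.inr ℝ R3 R3).comp (fderiv ℝ F p)) := by
  simp [divV, trP, (fderiv_slice p hF).fderiv]

/-- The pull-back by the flow of the velocity field `F`. -/
def pullBack (ω : ℝ) (F : Phase → R3) (t : Torus) (p : Phase) : Phase :=
  flowL 1 (-t) (0, F (flow ω t p))

/-- The derivative of `pullBack`. -/
def pullBackDeriv (ω : ℝ) (F : Phase → R3) (t : Torus) (p : Phase) : Phase →L[ℝ] Phase :=
  (flowL 1 (-t)).comp ((ContinuousLinearMap.inr ℝ R3 R3).comp
    ((fderiv ℝ F (flow ω t p)).comp (flowL ω t)))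

lemma hasFDerivAt_pullBack {ω : ℝ} {F : Phase → R3} (hF : Differentiable ℝ F) (t : Torus)
    (p : Phase) : HasFDerivAt (pullBack ω F t) (pullBackDeriv ω F t p) p := by
  have h1 : HasFDerivAt (flow ω t) (flowL ω t) p := by
    have : flow ω t = flowL ω t := by funext q; rw [flowL_apply]
    rw [this]; exact (flowL ω t).hasFDerivAt
  exact (flowL 1 (-t)).hasFDerivAt.comp p
    ((ContinuousLinearMap.inr ℝ R3 R3).hasFDerivAt.comp p
      ((hF (flow ω t p)).hasFDerivAt.comp p h1))

/-- Moving `dilL ω` through `flowL 1 (-t)` produces `flowL ω (-t)`, which the cyclicity of the trace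
brings next to `flowL ω t`. Both disappear, and the dilation is the identity on velocities. -/
lemma trP_pullBackDeriv {ω : ℝ} {F : Phase → R3} (hF : Differentiable ℝ F) (t : Torus)
    (p : Phase) : trP ((dilL ω).comp (pullBackDeriv ω F t p)) = divV F (flow ω t p) := by
  have h1 : (dilL ω).comp (pullBackDeriv ω F t p) = (flowL ω (-t)).comp
      ((dilL ω).comp ((ContinuousLinearMap.inr ℝ R3 R3).comp
        ((fderiv ℝ F (flow ω t p)).comp (flowL ω t)))) := by
    refine ContinuousLinearMap.ext fun y => ?_
    simp only [pullBackDeriv, ContinuousLinearMap.comp_apply, flowL_apply, flow_dilL]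
  rw [h1, trP_comm, divV_eq_trP (hF _)]
  congr 1
  refine ContinuousLinearMap.ext fun y => ?_
  simp [flowL_apply]

/-! ### Gradients -/

lemma inner_gradV {f : Phase → ℝ} (hf : Differentiable ℝ f) (p : Phase) (y : R3) :
    inner ℝ (gradV f p) y = fderiv ℝ f p (0, y) := by
  rw [gradV, gradient, InnerProductSpace.toDual_symm_apply, (fderiv_slice p (hf p)).fderiv]
  simp

lemma inner_gradX {f : Phase → ℝ} (hf : Differentiable ℝ f) (p : Phase) (y : R3) :
    inner ℝ (gradX f p) y = fderiv ℝ f p (y, 0) := by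
  have h : HasFDerivAt (fun x => f (x, p.2))
      ((fderiv ℝ f p).comp (ContinuousLinearMap.inl ℝ R3 R3)) p.1 :=
    HasFDerivAt.comp (g := f) p.1 (hf p).hasFDerivAt (hasFDerivAt_prodMk_left p.1 p.2)
  rw [gradX, gradient, InnerProductSpace.toDual_symm_apply, h.fderiv]
  simp

lemma dot_gradOmega (ω : ℝ) {f : Phase → ℝ} (hf : Differentiable ℝ f) (p y : Phase) :
    dot y (gradOmega ω f p) = fderiv ℝ f p (dilL ω y) := by
  rw [dot, gradOmega]
  simp only [inner_smul_right]
  rw [real_inner_comm, real_inner_comm _ y.2, inner_gradX hf, inner_gradV hf]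
  have : dilL ω y = ω⁻¹ • (y.1, (0 : R3)) + (0, y.2) := by ext <;> simp
  rw [this, map_add, map_smul, smul_eq_mul]

/-- Differentiate `f = f ∘ flow ω (-t)` at the flowed point; the dilation in `gradOmega` turns the
flow of `ω` into that of `1`. Gradients along an orbit are thus all expressed by the gradient at one
point of it. -/
lemma inner_gradV_flow {ω : ℝ} (hω : ω ≠ 0) {f : Phase → ℝ} (hf : Differentiable ℝ f)
    (hT : ∀ p, transport ω f p = 0) (t : Torus) (p : Phase) (η : R3) :
    inner ℝ (gradV f (flow ω t p)) η = dot (flowL 1 (-t) (0, η)) (gradOmega ω f p) := by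
  rw [inner_gradV hf, dot_gradOmega ω hf, flowL_apply, ← flow_dilL]
  have h1 : f = fun q => f (flowL ω (-t) q) := by
    funext q; rw [flowL_apply, flow_invariant hω hf hT]
  have h2 : HasFDerivAt (fun q => f (flowL ω (-t) q))
      ((fderiv ℝ f (flowL ω (-t) (flow ω t p))).comp (flowL ω (-t))) (flow ω t p) :=
    (hf _).hasFDerivAt.comp _ (flowL ω (-t)).hasFDerivAt
  rw [← h1] at h2
  rw [h2.fderiv, flowL_apply]
  simp [flowL_apply]

/-! ### Convolution in velocity with a kernel of moderate growth -/

/-- The kernel `k` on `ℝ³` is integrable against `(1 + |w|)⁻ᴺ`. -/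
def ModerateKernel (N : ℕ) (k : R3 → ℝ) : Prop :=
  Measurable k ∧ Integrable fun w : R3 => |k w| / (1 + ‖w‖) ^ N

/-- `G` is continuous and decays rapidly in `v`, locally uniformly in `x`. -/
def DecayV {E : Type*} [NormedAddCommGroup E] (G : Phase → E) : Prop :=
  Continuous G ∧ ∀ (n : ℕ) (R : ℝ), ∃ C : ℝ, ∀ x v : R3, ‖x‖ ≤ R →
    (1 + ‖v‖) ^ n * ‖G (x, v)‖ ≤ C

/-- `∫ k(w) G(x, v - w) dw`. -/
def velConv {E : Type*} [NormedAddCommGroup E] [NormedSpace ℝ E] (k : R3 → ℝ) (G : Phase → E)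
    (p : Phase) : E := ∫ w, k w • G (p.1, p.2 - w)

/-- Peetre's inequality: it allows a weight in `w` to be paid for by weights in `v` and `v - w`. -/
lemma one_add_norm_le_mul_sub {E : Type*} [NormedAddCommGroup E] (v w : E) :
    1 + ‖w‖ ≤ (1 + ‖v‖) * (1 + ‖v - w‖) := by
  have h : ‖w‖ ≤ ‖v‖ + ‖v - w‖ := by
    calc ‖w‖ = ‖v - (v - w)‖ := by rw [sub_sub_cancel]
      _ ≤ _ := norm_sub_le _ _
  nlinarith [mul_nonneg (norm_nonneg v) (norm_nonneg (v - w))]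

section

variable {E : Type*} [NormedAddCommGroup E] [NormedSpace ℝ E]

/-- Decay of `a` in `v - w` compensates the moderate growth of the kernel in `w`, at the price of a
power of `1 + |v|`. -/
lemma norm_smul_le_of_weight {N : ℕ} {c C : ℝ} {a : E} {v w : R3}
    (h : (1 + ‖v - w‖) ^ N * ‖a‖ ≤ C) :
    ‖c • a‖ ≤ C * (1 + ‖v‖) ^ N * (|c| / (1 + ‖w‖) ^ N) := by
  rw [norm_smul, Real.norm_eq_abs, ← mul_div_assoc, le_div_iff₀ (by positivity)]
  have h1 : (1 + ‖w‖) ^ N ≤ (1 + ‖v‖) ^ N * (1 + ‖v - w‖) ^ N := by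
    rw [← mul_pow]
    exact pow_le_pow_left₀ (by positivity) (one_add_norm_le_mul_sub v w) N
  calc |c| * ‖a‖ * (1 + ‖w‖) ^ N
      ≤ |c| * ‖a‖ * ((1 + ‖v‖) ^ N * (1 + ‖v - w‖) ^ N) := by gcongr
    _ = |c| * (1 + ‖v‖) ^ N * ((1 + ‖v - w‖) ^ N * ‖a‖) := by ring
    _ ≤ |c| * (1 + ‖v‖) ^ N * C := by gcongr
    _ = C * (1 + ‖v‖) ^ N * |c| := by ring

variable {N : ℕ} {k : R3 → ℝ} {G : Phase → E}

lemma aestronglyMeasurable_velConv (hk : Measurable k) (hG : Continuous G) (p : Phase) :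
    AEStronglyMeasurable (fun w => k w • G (p.1, p.2 - w)) volume := by
  refine hk.aestronglyMeasurable.smul (Continuous.aestronglyMeasurable ?_)
  fun_prop

/-- One dominating function valid on a whole ball of `p`: the domination behind both continuity and
differentiation of the convolution. -/
lemma velConv_local_bound (hG : DecayV G) (N : ℕ) (p₀ : Phase) :
    ∃ C : ℝ, 0 ≤ C ∧ ∀ p ∈ Metric.ball p₀ 1, ∀ (c : ℝ) (w : R3),
      ‖c • G (p.1, p.2 - w)‖ ≤ C * (|c| / (1 + ‖w‖) ^ N) := by
  obtain ⟨C, hC⟩ := hG.2 N (‖p₀.1‖ + 1)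
  have hC0 : 0 ≤ C := le_trans (by positivity) (hC p₀.1 0 (by linarith))
  refine ⟨C * (1 + (‖p₀.2‖ + 1)) ^ N, by positivity, fun p hp c w => ?_⟩
  rw [Metric.mem_ball, dist_eq_norm, Prod.norm_def, max_lt_iff] at hp
  have h1 : ‖p.1‖ ≤ ‖p₀.1‖ + 1 := by
    have := norm_le_norm_add_norm_sub p₀.1 p.1
    rw [norm_sub_rev] at this
    have h := hp.1
    simp only [Prod.fst_sub] at h
    linarith
  have h2 : ‖p.2‖ ≤ ‖p₀.2‖ + 1 := by
    have := norm_le_norm_add_norm_sub p₀.2 p.2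
    rw [norm_sub_rev] at this
    have h := hp.2
    simp only [Prod.snd_sub] at h
    linarith
  refine (norm_smul_le_of_weight (hC _ _ h1)).trans ?_
  gcongr

lemma ModerateKernel.integrable (hk : ModerateKernel N k) (hG : DecayV G) (p : Phase) :
    Integrable fun w => k w • G (p.1, p.2 - w) := by
  obtain ⟨C, -, hC⟩ := velConv_local_bound hG N p
  exact (hk.2.const_mul C).mono' (aestronglyMeasurable_velConv hk.1 hG.1 p)
    (Filter.Eventually.of_forall fun w => hC p (Metric.mem_ball_self one_pos) _ w)

lemma ModerateKernel.continuous_velConv (hk : ModerateKernel N k) (hG : DecayV G) :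
    Continuous (velConv k G) := by
  rw [continuous_iff_continuousAt]
  intro p₀
  obtain ⟨C, -, hC⟩ := velConv_local_bound hG N p₀
  refine continuousAt_of_dominated (bound := fun w => C * (|k w| / (1 + ‖w‖) ^ N)) ?_ ?_ ?_ ?_
  · exact Filter.Eventually.of_forall fun p => aestronglyMeasurable_velConv hk.1 hG.1 p
  · filter_upwards [Metric.ball_mem_nhds p₀ one_pos] with p hp
    exact Filter.Eventually.of_forall fun w => hC p hp _ w
  · exact hk.2.const_mul C
  · refine Filter.Eventually.of_forall fun w => Continuous.continuousAt ?_
    have := hG.1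
    fun_prop

/-- For fixed `w` the point `p` enters through a translation, whose derivative is the identity; the
derivative falls on `G` and the kernel is only measurable. -/
lemma ModerateKernel.hasFDerivAt_velConv (hk : ModerateKernel N k) (hG : DecayV G)
    (hd : Differentiable ℝ G) (hG' : DecayV (fderiv ℝ G)) (p₀ : Phase) :
    HasFDerivAt (velConv k G) (velConv k (fderiv ℝ G) p₀) p₀ := by
  obtain ⟨C, -, hC⟩ := velConv_local_bound hG' N p₀
  refine hasFDerivAt_integral_of_dominated_of_fderiv_le
    (F' := fun p w => k w • fderiv ℝ G (p.1, p.2 - w))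
    (bound := fun w => C * (|k w| / (1 + ‖w‖) ^ N)) (Metric.ball_mem_nhds p₀ one_pos) ?_ ?_ ?_ ?_
    ?_ ?_
  · exact Filter.Eventually.of_forall fun p => aestronglyMeasurable_velConv hk.1 hG.1 p
  · exact hk.integrable hG p₀
  · exact aestronglyMeasurable_velConv hk.1 hG'.1 p₀
  · exact Filter.Eventually.of_forall fun w p hp => hC p hp _ w
  · exact hk.2.const_mul C
  · refine Filter.Eventually.of_forall fun w p _ => ?_
    have h1 : HasFDerivAt (fun p : Phase => ((p.1, p.2 - w) : Phase))
        (ContinuousLinearMap.id ℝ Phase) p := by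
      have : (fun p : Phase => ((p.1, p.2 - w) : Phase)) = fun p => p - (0, w) := by
        funext p; ext <;> simp
      rw [this]
      exact (hasFDerivAt_id p).sub_const _
    exact (HasFDerivAt.comp (g := G) p (hd _).hasFDerivAt h1).const_smul (k w)

lemma ModerateKernel.contDiff_velConv (hk : ModerateKernel N k) (hG : DecayV G)
    (hd : Differentiable ℝ G) (hG' : DecayV (fderiv ℝ G)) : ContDiff ℝ 1 (velConv k G) := by
  rw [contDiff_one_iff_fderiv]
  refine ⟨fun p => (hk.hasFDerivAt_velConv hG hd hG' p).differentiableAt, ?_⟩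
  have : fderiv ℝ (velConv k G) = velConv k (fderiv ℝ G) := by
    funext p; exact (hk.hasFDerivAt_velConv hG hd hG' p).fderiv
  rw [this]
  exact hk.continuous_velConv hG'

lemma ModerateKernel.norm_velConv_le (hk : ModerateKernel N k) {C : ℝ} {p : Phase}
    (h : ∀ v : R3, (1 + ‖v‖) ^ N * ‖G (p.1, v)‖ ≤ C) :
    ‖velConv k G p‖ ≤ (C * ∫ w, |k w| / (1 + ‖w‖) ^ N) * (1 + ‖p.2‖) ^ N := by
  refine (norm_integral_le_of_norm_le (hk.2.const_mul (C * (1 + ‖p.2‖) ^ N))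
    (Filter.Eventually.of_forall fun w => norm_smul_le_of_weight (h _))).trans_eq ?_
  rw [integral_const_mul]; ring

end

/-! ### The entries of the Landau matrix -/

/-- The entry `(i, j)` of `σ(|w|) S(w)`. -/
def landau (σ : ℝ → ℝ) (i j : Fin 3) (w : R3) : ℝ :=
  σ ‖w‖ * ((if i = j then 1 else 0) - w i * w j / ‖w‖ ^ 2)

lemma S_apply (w y : R3) (i : Fin 3) :
    S w y i = ∑ j, ((if i = j then 1 else 0) - w i * w j / ‖w‖ ^ 2) * y j := by
  simp only [S, PiLp.sub_apply, PiLp.smul_apply, smul_eq_mul, sub_mul, Finset.sum_sub_distrib,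
    PiLp.inner_apply, RCLike.inner_apply, conj_trivial]
  simp only [ite_mul, one_mul, zero_mul, Finset.sum_ite_eq, Finset.mem_univ, if_true,
    Finset.sum_div, Finset.sum_mul]
  congr 1
  exact Finset.sum_congr rfl fun j _ => by ring

lemma smul_S_apply (σ : ℝ → ℝ) (w y : R3) (i : Fin 3) :
    (σ ‖w‖ • S w y) i = ∑ j, landau σ i j w * y j := by
  simp only [PiLp.smul_apply, smul_eq_mul, S_apply, Finset.mul_sum, landau, mul_assoc]

lemma abs_landau_le (σ : ℝ → ℝ) (i j : Fin 3) (w : R3) : |landau σ i j w| ≤ 2 * |σ ‖w‖| := by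
  rw [landau, abs_mul, mul_comm]
  gcongr
  have h1 : |w i * w j / ‖w‖ ^ 2| ≤ 1 := by
    rw [abs_div, abs_mul, abs_of_nonneg (sq_nonneg ‖w‖)]
    refine div_le_one_of_le₀ ?_ (sq_nonneg _)
    rw [sq]
    exact mul_le_mul (abs_coord_le_R3 w i) (abs_coord_le_R3 w j) (abs_nonneg _) (norm_nonneg _)
  have h2 : |(if i = j then (1 : ℝ) else 0)| ≤ 1 := by split_ifs <;> simp
  refine (abs_sub_le _ 0 _).trans ?_
  rw [sub_zero, zero_sub, abs_neg]
  linarith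

@[fun_prop] lemma measurable_landau {σ : ℝ → ℝ} (hσ : Measurable σ) (i j : Fin 3) :
    Measurable (landau σ i j) := by
  unfold landau
  have h : ∀ i : Fin 3, Measurable fun w : R3 => w i := fun i => (continuous_coord_R3 i).measurable
  have h1 := h i
  have h2 := h j
  fun_prop

/-- The weight `σ(|w|) (1 + |w|)⁻ᴺ` is integrable on `ℝ³`. -/
def ModerateCross (N : ℕ) (σ : ℝ → ℝ) : Prop :=
  Measurable σ ∧ Integrable fun w : R3 => |σ ‖w‖| / (1 + ‖w‖) ^ N

/-- Polar coordinates in `ℝ³`: the factor `ρ²` is the Jacobian, and passing to norms replaces `σ` by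
`|σ|`. -/
lemma moderateCross_of_integrableOn {σ : ℝ → ℝ} (hσm : Measurable σ) {N : ℕ}
    (h : IntegrableOn (fun ρ : ℝ => σ ρ * ρ ^ 2 / (1 + ρ) ^ N) (Ioi 0)) : ModerateCross N σ := by
  refine ⟨hσm, ?_⟩
  refine (integrable_fun_norm_addHaar (E := R3) volume
    (f := fun y : ℝ => |σ y| / (1 + y) ^ N)).2 ?_
  refine IntegrableOn.congr_fun (Integrable.norm h) (fun y hy => ?_) measurableSet_Ioi
  have hy' : 0 < y := hy
  simp only [finrank_euclideanSpace, Fintype.card_fin, smul_eq_mul, norm_div, norm_mul,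
    Real.norm_eq_abs]
  rw [abs_of_pos (show 0 < (1 + y) ^ N by positivity), abs_of_pos (show 0 < y ^ 2 by positivity)]
  norm_num
  ring

lemma ModerateCross.landau {N : ℕ} {σ : ℝ → ℝ} (h : ModerateCross N σ) (i j : Fin 3) :
    ModerateKernel N (landau σ i j) := by
  have hm := measurable_landau h.1 i j
  refine ⟨hm, (h.2.const_mul 2).mono' ?_ (Filter.Eventually.of_forall fun w => ?_)⟩
  · exact (Measurable.aestronglyMeasurable (by fun_prop))
  · rw [Real.norm_eq_abs, abs_div, abs_abs, abs_of_pos (show 0 < (1 + ‖w‖) ^ N by positivity),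
      ← mul_div_assoc]
    gcongr
    exact abs_landau_le σ i j w

/-! ### The velocity fluxes -/

/-- The derivative `∂f / ∂vⱼ`. -/
def dV (f : Phase → ℝ) (j : Fin 3) (p : Phase) : ℝ := fderiv ℝ f p (0, EuclideanSpace.single j 1)

lemma gradV_apply {f : Phase → ℝ} (hf : Differentiable ℝ f) (p : Phase) (j : Fin 3) :
    gradV f p j = dV f j p := by
  rw [dV, ← inner_gradV hf, EuclideanSpace.inner_single_right]
  simp

/-- `f` is of class `C²`, and its derivatives of order at most two decay rapidly in `v`. -/
structure Regular (f : Phase → ℝ) : Prop where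
  contDiff : ContDiff ℝ 2 f
  decay : DecayV f
  decay_fderiv : DecayV (fderiv ℝ f)
  decay_fderiv2 : DecayV (fderiv ℝ (fderiv ℝ f))

lemma norm_iteratedFDeriv_two (f : Phase → ℝ) (p : Phase) :
    ‖iteratedFDeriv ℝ 2 f p‖ = ‖fderiv ℝ (fderiv ℝ f) p‖ := by
  rw [← norm_iteratedFDeriv_fderiv, norm_iteratedFDeriv_one]

lemma contDiff_fderiv {f : Phase → ℝ} (hf : ContDiff ℝ 2 f) : ContDiff ℝ 1 (fderiv ℝ f) :=
  hf.fderiv_right (by norm_num)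

lemma regular_of_rapidDecayV {f : Phase → ℝ} (hf : ContDiff ℝ 2 f) (h : RapidDecayV f) :
    Regular f := by
  have hc := contDiff_fderiv hf
  refine ⟨hf, ⟨hf.continuous, fun n R => ?_⟩, ⟨hc.continuous, fun n R => ?_⟩,
    ⟨hc.continuous_fderiv (by norm_num), fun n R => ?_⟩⟩
  · simpa using h n 0 (by norm_num) R
  · simpa [norm_iteratedFDeriv_one] using h n 1 (by norm_num) R
  · simpa [norm_iteratedFDeriv_two] using h n 2 (by norm_num) R

lemma DecayV.clm {E F : Type*} [NormedAddCommGroup E] [NormedSpace ℝ E] [NormedAddCommGroup F]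
    [NormedSpace ℝ F] {G : Phase → E} (hG : DecayV G) (L : E →L[ℝ] F) :
    DecayV fun p => L (G p) := by
  refine ⟨L.continuous.comp hG.1, fun n R => ?_⟩
  obtain ⟨C, hC⟩ := hG.2 n R
  refine ⟨‖L‖ * C, fun x v hx => ?_⟩
  calc (1 + ‖v‖) ^ n * ‖L (G (x, v))‖ ≤ (1 + ‖v‖) ^ n * (‖L‖ * ‖G (x, v)‖) := by
        gcongr; exact L.le_opNorm _
    _ = ‖L‖ * ((1 + ‖v‖) ^ n * ‖G (x, v)‖) := by ring
    _ ≤ _ := by gcongr; exact hC x v hx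

namespace Regular

variable {f : Phase → ℝ} (hf : Regular f)
include hf

lemma differentiable : Differentiable ℝ f := hf.contDiff.differentiable (by norm_num)

lemma differentiable_fderiv : Differentiable ℝ (fderiv ℝ f) :=
  (contDiff_fderiv hf.contDiff).differentiable (by norm_num)

lemma decay_dV (j : Fin 3) : DecayV (dV f j) :=
  hf.decay_fderiv.clm (ContinuousLinearMap.apply ℝ ℝ ((0, EuclideanSpace.single j 1) : Phase))

lemma hasFDerivAt_dV (j : Fin 3) (p : Phase) : HasFDerivAt (dV f j)
    ((ContinuousLinearMap.apply ℝ ℝ ((0, EuclideanSpace.single j 1) : Phase)).comp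
      (fderiv ℝ (fderiv ℝ f) p)) p :=
  (ContinuousLinearMap.apply ℝ ℝ ((0, EuclideanSpace.single j 1) : Phase)).hasFDerivAt.comp p
    (hf.differentiable_fderiv p).hasFDerivAt

lemma contDiff_dV (j : Fin 3) : ContDiff ℝ 1 (dV f j) :=
  (ContinuousLinearMap.apply ℝ ℝ ((0, EuclideanSpace.single j 1) : Phase)).contDiff.comp
    (contDiff_fderiv hf.contDiff)

lemma fderiv_dV (j : Fin 3) : fderiv ℝ (dV f j) = fun p =>
    (ContinuousLinearMap.apply ℝ ℝ ((0, EuclideanSpace.single j 1) : Phase)).comp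
      (fderiv ℝ (fderiv ℝ f) p) := by
  funext p; exact (hf.hasFDerivAt_dV j p).fderiv

lemma decay_fderiv_dV (j : Fin 3) : DecayV (fderiv ℝ (dV f j)) := by
  rw [hf.fderiv_dV j]
  exact hf.decay_fderiv2.clm (ContinuousLinearMap.compL ℝ Phase (Phase →L[ℝ] ℝ) ℝ
    (ContinuousLinearMap.apply ℝ ℝ ((0, EuclideanSpace.single j 1) : Phase)))

end Regular

section

variable {N : ℕ} {σ : ℝ → ℝ} {f : Phase → ℝ}

lemma gainKernel_apply (hf : Differentiable ℝ f) (p : Phase) (v' : R3) (i : Fin 3) :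
    gainKernel σ f p v' i = ∑ j, landau σ i j (p.2 - v') * f (p.1, v') * dV f j p := by
  rw [gainKernel, smul_S_apply]
  simp [gradV_apply hf, mul_assoc]

lemma lossKernel_apply (hf : Differentiable ℝ f) (p : Phase) (v' : R3) (i : Fin 3) :
    lossKernel σ f p v' i = ∑ j, landau σ i j (p.2 - v') * dV f j (p.1, v') * f p := by
  rw [lossKernel, smul_S_apply]
  refine Finset.sum_congr rfl fun j _ => ?_
  simp [gradV_apply hf]; ring

lemma S_sub (w y y' : R3) : S w (y - y') = S w y - S w y' := by
  simp only [S, inner_sub_right, sub_div, sub_smul]; abel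

lemma S_smul (w : R3) (c : ℝ) (y : R3) : S w (c • y) = c • S w y := by
  simp only [S, inner_smul_right, smul_sub, smul_smul, mul_div_assoc]

lemma fplKernel_eq (p : Phase) (v' : R3) :
    fplKernel σ f p v' = gainKernel σ f p v' - lossKernel σ f p v' := by
  rw [fplKernel, gainKernel, lossKernel, S_sub, smul_sub]

lemma ModerateKernel.integrable_sub {k : R3 → ℝ} (hk : ModerateKernel N k) {g : Phase → ℝ}
    (hg : DecayV g) (p : Phase) : Integrable fun v' => k (p.2 - v') * g (p.1, v') := by
  have := (hk.integrable hg p).comp_sub_left p.2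
  simpa using this

lemma velConv_eq_integral_sub (k : R3 → ℝ) (g : Phase → ℝ) (p : Phase) :
    velConv k g p = ∫ v', k (p.2 - v') * g (p.1, v') := by
  rw [velConv, ← integral_sub_left_eq_self _ volume p.2]
  simp

variable (hσ : ModerateCross N σ) (hf : Regular f)
include hσ hf

lemma integrable_gainKernel (p : Phase) : Integrable (gainKernel σ f p) := by
  refine Integrable.of_eval_piLp fun i => ?_
  simp only [gainKernel_apply hf.differentiable]
  exact integrable_finsetSum _ fun j _ =>
    ((hσ.landau i j).integrable_sub hf.decay p).mul_const _

lemma integrable_lossKernel (p : Phase) : Integrable (lossKernel σ f p) := by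
  refine Integrable.of_eval_piLp fun i => ?_
  simp only [lossKernel_apply hf.differentiable]
  exact integrable_finsetSum _ fun j _ =>
    ((hσ.landau i j).integrable_sub (hf.decay_dV j) p).mul_const _

lemma integrable_fplKernel (p : Phase) : Integrable (fplKernel σ f p) := by
  have := (integrable_gainKernel hσ hf p).sub (integrable_lossKernel hσ hf p)
  exact this.congr (Filter.Eventually.of_forall fun v' => (fplKernel_eq p v').symm)

lemma velFlux_gainKernel_apply (p : Phase) (i : Fin 3) :
    velFlux (gainKernel σ f) p i = ∑ j, velConv (landau σ i j) f p * dV f j p := by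
  rw [velFlux, eval_integral_piLp fun i => (integrable_gainKernel hσ hf p).eval_piLp i]
  simp only [gainKernel_apply hf.differentiable]
  rw [integral_finsetSum _ fun j _ =>
    ((hσ.landau i j).integrable_sub hf.decay p).mul_const _]
  refine Finset.sum_congr rfl fun j _ => ?_
  rw [integral_mul_const, velConv_eq_integral_sub]

lemma velFlux_lossKernel_apply (p : Phase) (i : Fin 3) :
    velFlux (lossKernel σ f) p i = ∑ j, velConv (landau σ i j) (dV f j) p * f p := by
  rw [velFlux, eval_integral_piLp fun i => (integrable_lossKernel hσ hf p).eval_piLp i]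
  simp only [lossKernel_apply hf.differentiable]
  rw [integral_finsetSum _ fun j _ =>
    ((hσ.landau i j).integrable_sub (hf.decay_dV j) p).mul_const _]
  refine Finset.sum_congr rfl fun j _ => ?_
  rw [integral_mul_const, velConv_eq_integral_sub]

lemma velFlux_fplKernel (p : Phase) :
    velFlux (fplKernel σ f) p = velFlux (gainKernel σ f) p - velFlux (lossKernel σ f) p := by
  simp only [velFlux, fplKernel_eq]
  exact integral_sub (integrable_gainKernel hσ hf p) (integrable_lossKernel hσ hf p)

lemma contDiff_velFlux_gainKernel : ContDiff ℝ 1 (velFlux (gainKernel σ f)) := by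
  rw [contDiff_euclidean]
  intro i
  simp only [velFlux_gainKernel_apply hσ hf]
  exact ContDiff.sum fun j _ => ((hσ.landau i j).contDiff_velConv hf.decay hf.differentiable
    hf.decay_fderiv).mul (hf.contDiff_dV j)

/-- Here the convolved function is already a first derivative of `f`, so it is the second
derivatives of `f` that have to be continuous and to decay. -/
lemma contDiff_velFlux_lossKernel : ContDiff ℝ 1 (velFlux (lossKernel σ f)) := by
  rw [contDiff_euclidean]
  intro i
  simp only [velFlux_lossKernel_apply hσ hf]
  exact ContDiff.sum fun j _ => ((hσ.landau i j).contDiff_velConv (hf.decay_dV j)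
    ((hf.contDiff_dV j).differentiable (by norm_num)) (hf.decay_fderiv_dV j)).mul
      (hf.contDiff.of_le (by norm_num))

lemma contDiff_velFlux_fplKernel : ContDiff ℝ 1 (velFlux (fplKernel σ f)) := by
  have h : velFlux (fplKernel σ f) =
      fun p => velFlux (gainKernel σ f) p - velFlux (lossKernel σ f) p := by
    funext p; exact velFlux_fplKernel hσ hf p
  rw [h]
  exact (contDiff_velFlux_gainKernel hσ hf).sub (contDiff_velFlux_lossKernel hσ hf)

end

lemma continuous_trP : Continuous trP := by
  unfold trP; fun_prop

lemma continuous_divV {F : Phase → R3} (hF : ContDiff ℝ 1 F) : Continuous (divV F) := by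
  have h : divV F = fun p => trP ((ContinuousLinearMap.inr ℝ R3 R3).comp (fderiv ℝ F p)) := by
    funext p; exact divV_eq_trP (hF.differentiable (by norm_num) p)
  rw [h]
  have := hF.continuous_fderiv (by norm_num)
  exact continuous_trP.comp (by fun_prop)

lemma differentiable_slice {F : Phase → R3} (hF : ContDiff ℝ 1 F) (x : R3) :
    Differentiable ℝ fun v => F (x, v) := fun v =>
  (fderiv_slice (x, v) (hF.differentiable (by norm_num) _)).differentiableAt

/-! ### The law of the difference of two uniformly rotated vectors -/

lemma lintegral_haarT (h : Torus → ENNReal) :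
    ∫⁻ t, h t ∂haarT =
      ENNReal.ofReal (2 * Real.pi)⁻¹ * ∫⁻ x in Ioc (-Real.pi) Real.pi, h (x : Torus) := by
  have h1 := AddCircle.lintegral_preimage (2 * Real.pi) (-Real.pi) h
  rw [show -Real.pi + 2 * Real.pi = Real.pi by ring] at h1
  rw [h1, AddCircle.volume_eq_smul_haarAddCircle, lintegral_smul_measure, smul_eq_mul, ← mul_assoc,
    ← ENNReal.ofReal_mul (by positivity), inv_mul_cancel₀ Real.two_pi_pos.ne', ENNReal.ofReal_one,
    one_mul]

lemma lintegral_R2 (h : R2 → ENNReal) : ∫⁻ z, h z = ∫⁻ p : ℝ × ℝ, h !₂[p.1, p.2] := by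
  have h1 := (EuclideanSpace.volume_preserving_symm_measurableEquiv_toLp (Fin 2)).symm
  have h2 := (volume_preserving_finTwoArrow ℝ).symm
  rw [← h1.lintegral_comp_emb (MeasurableEquiv.measurableEmbedding _),
    ← h2.lintegral_comp_emb (MeasurableEquiv.measurableEmbedding _)]
  rfl

/-- `χ` as a function of `|z|`. -/
def chiRad (r r' l : ℝ) : ℝ :=
  if |r - r'| < l ∧ l < r + r' then
    1 / (Real.pi ^ 2 * Real.sqrt (l ^ 2 - (r - r') ^ 2) * Real.sqrt ((r + r') ^ 2 - l ^ 2))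
  else 0

lemma chi_eq_chiRad (r r' : ℝ) (z : R2) : chi r r' z = chiRad r r' ‖z‖ := by
  rw [chi, chiRad]

lemma measurable_chiRad {X : Type*} [MeasurableSpace X] {a b c : X → ℝ} (ha : Measurable a)
    (hb : Measurable b) (hc : Measurable c) : Measurable fun x => chiRad (a x) (b x) (c x) := by
  unfold chiRad
  refine Measurable.ite ?_ (by fun_prop) measurable_const
  have h1 : Measurable fun x => |a x - b x| := by fun_prop
  exact (measurableSet_lt h1 hc).inter (measurableSet_lt hc (ha.add hb))

/-- The length of `r - r' exp (i x)`. -/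
def chord (r r' x : ℝ) : ℝ := Real.sqrt (r ^ 2 + r' ^ 2 - 2 * r * r' * Real.cos x)

/-! ### Change of variables from the angle to the length of the chord. -/

section

variable {r r' : ℝ} (hr : 0 < r) (hr' : 0 < r')
include hr hr'

lemma chord_sq (x : ℝ) : chord r r' x ^ 2 = r ^ 2 + r' ^ 2 - 2 * r * r' * Real.cos x := by
  refine Real.sq_sqrt ?_
  nlinarith [Real.cos_le_one x, mul_pos hr hr', sq_nonneg (r - r')]

lemma chord_bounds {x : ℝ} (hx : x ∈ Ioo 0 Real.pi) :
    |r - r'| < chord r r' x ∧ chord r r' x < r + r' := by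
  have hs := chord_sq hr hr' x
  have h0 : 0 ≤ chord r r' x := Real.sqrt_nonneg _
  have hsin := Real.sin_pos_of_mem_Ioo hx
  have hc1 : Real.cos x < 1 := by nlinarith [Real.sin_sq_add_cos_sq x, Real.cos_le_one x]
  have hc2 : -1 < Real.cos x := by nlinarith [Real.sin_sq_add_cos_sq x, Real.neg_one_le_cos x]
  have hp := mul_pos hr hr'
  constructor
  · refine abs_lt_of_sq_lt_sq ?_ h0
    nlinarith
  · nlinarith

/-- The law of cosines is solved for the angle; the strict triangle inequalities say that the
resulting cosine lies strictly between `-1` and `1`. -/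
lemma image_chord : chord r r' '' Ioo 0 Real.pi = Ioo |r - r'| (r + r') := by
  refine Subset.antisymm ?_ ?_
  · rintro _ ⟨x, hx, rfl⟩
    exact chord_bounds hr hr' hx
  · rintro l ⟨h1, h2⟩
    have hp := mul_pos hr hr'
    have hl : 0 ≤ l := (abs_nonneg _).trans h1.le
    have h1' : (r - r') ^ 2 < l ^ 2 := by
      rw [← sq_abs (r - r')]; exact pow_lt_pow_left₀ h1 (abs_nonneg _) (by norm_num)
    have h2' : l ^ 2 < (r + r') ^ 2 := pow_lt_pow_left₀ h2 hl (by norm_num)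
    set c := (r ^ 2 + r' ^ 2 - l ^ 2) / (2 * r * r') with hc
    have hc1 : c < 1 := by rw [hc, div_lt_one (by positivity)]; nlinarith
    have hc2 : -1 < c := by rw [hc, lt_div_iff₀ (by positivity)]; nlinarith
    refine ⟨Real.arccos c, ⟨Real.arccos_pos.2 hc1, ?_⟩, ?_⟩
    · refine lt_of_le_of_ne (Real.arccos_le_pi c) fun h => ?_
      rw [Real.arccos_eq_pi] at h
      linarith
    · rw [chord, Real.cos_arccos hc2.le hc1.le, hc]
      rw [show r ^ 2 + r' ^ 2 - 2 * r * r' * ((r ^ 2 + r' ^ 2 - l ^ 2) / (2 * r * r')) = l ^ 2 by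
        field_simp; ring]
      exact Real.sqrt_sq hl

lemma hasDerivAt_chord {x : ℝ} (hx : x ∈ Ioo 0 Real.pi) :
    HasDerivAt (chord r r') (r * r' * Real.sin x / chord r r' x) x := by
  have hb := (chord_bounds hr hr' hx).1
  have hpos : 0 < chord r r' x := (abs_nonneg _).trans_lt hb
  have h0 : r ^ 2 + r' ^ 2 - 2 * r * r' * Real.cos x ≠ 0 := by
    rw [← chord_sq hr hr' x]; positivity
  have h1 := (((Real.hasDerivAt_cos x).const_mul (2 * r * r')).const_sub
    (r ^ 2 + r' ^ 2)).sqrt h0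
  have h2 : r * r' * Real.sin x / chord r r' x = -(2 * r * r' * -Real.sin x) /
      (2 * Real.sqrt (r ^ 2 + r' ^ 2 - 2 * r * r' * Real.cos x)) := by
    rw [show Real.sqrt (r ^ 2 + r' ^ 2 - 2 * r * r' * Real.cos x) = chord r r' x from rfl]
    field_simp
  rw [h2]
  exact h1

lemma injOn_chord : InjOn (chord r r') (Ioo 0 Real.pi) := by
  intro x hx y hy h
  have h1 := chord_sq hr hr' x
  rw [h, chord_sq hr hr' y] at h1
  have hp := mul_pos hr hr'
  have h2 : Real.cos x = Real.cos y := by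
    have : r * r' * (Real.cos x - Real.cos y) = 0 := by linarith
    rcases mul_eq_zero.1 this with h | h
    · exact absurd h hp.ne'
    · linarith
  exact Real.injOn_cos ⟨hx.1.le, hx.2.le⟩ ⟨hy.1.le, hy.2.le⟩ h2

/-- Heron's factorisation: with `l` the chord, `(l² - (r - r')²) ((r + r')² - l²) = (2 r r' sin
x)²`, so the two square roots in `χ` cancel the Jacobian `r r' sin x / l` up to a constant. -/
lemma deriv_chord_mul_chiRad {x : ℝ} (hx : x ∈ Ioo 0 Real.pi) :
    |r * r' * Real.sin x / chord r r' x| * (chord r r' x * chiRad r r' (chord r r' x)) =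
      (2 * Real.pi ^ 2)⁻¹ := by
  have hb := chord_bounds hr hr' hx
  have hpos : 0 < chord r r' x := (abs_nonneg _).trans_lt hb.1
  have hsin := Real.sin_pos_of_mem_Ioo hx
  rw [chiRad, if_pos hb, abs_of_pos (by positivity), chord_sq hr hr', mul_assoc (Real.pi ^ 2),
    ← Real.sqrt_mul (by nlinarith [Real.cos_le_one x, mul_pos hr hr'])]
  rw [show (r ^ 2 + r' ^ 2 - 2 * r * r' * Real.cos x - (r - r') ^ 2) *
      ((r + r') ^ 2 - (r ^ 2 + r' ^ 2 - 2 * r * r' * Real.cos x)) =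
      (2 * r * r' * Real.sin x) ^ 2 by
    have := Real.sin_sq x
    rw [mul_pow, this]; ring]
  rw [Real.sqrt_sq (by positivity)]
  field_simp

/-- Substituting `l = chord r r' x` turns `l χ(l) dl` into the constant density `dx / (2π²)`. -/
lemma lintegral_chord {A : ℝ → ENNReal} :
    ∫⁻ l in Ioi 0, ENNReal.ofReal (l * chiRad r r' l) * A l =
      ENNReal.ofReal (2 * Real.pi ^ 2)⁻¹ * ∫⁻ x in Ioo 0 Real.pi, A (chord r r' x) := by
  have h1 : ∫⁻ l in Ioi 0, ENNReal.ofReal (l * chiRad r r' l) * A l =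
      ∫⁻ l in Ioo |r - r'| (r + r'), ENNReal.ofReal (l * chiRad r r' l) * A l := by
    rw [← lintegral_indicator measurableSet_Ioi, ← lintegral_indicator measurableSet_Ioo]
    refine lintegral_congr fun l => ?_
    by_cases hl : l ∈ Ioo |r - r'| (r + r')
    · rw [indicator_of_mem hl, indicator_of_mem (show l ∈ Ioi 0 from
        (abs_nonneg _).trans_lt hl.1)]
    · have : chiRad r r' l = 0 := by
        rw [chiRad, if_neg]
        exact fun h => hl ⟨h.1, h.2⟩
      rw [indicator_of_notMem hl]
      simp [indicator, this]
  rw [h1, ← image_chord hr hr', lintegral_image_eq_lintegral_abs_deriv_mul measurableSet_Ioo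
    (fun x hx => (hasDerivAt_chord hr hr' hx).hasDerivWithinAt) (injOn_chord hr hr'),
    ← lintegral_const_mul' _ _ ENNReal.ofReal_ne_top]
  refine setLIntegral_congr_fun measurableSet_Ioo fun x hx => ?_
  rw [← mul_assoc, ← ENNReal.ofReal_mul (abs_nonneg _), deriv_chord_mul_chiRad hr hr' hx]

end

/-- The first basis vector of the plane. -/
def e0 : R2 := !₂[1, 0]

@[simp] lemma e0_zero : e0 0 = 1 := rfl
@[simp] lemma e0_one : e0 1 = 0 := rfl

lemma exists_rotT (p : R2) : ∃ s : Torus, p = rotT s (‖p‖ • e0) := by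
  refine ⟨(Complex.arg ⟨p 0, p 1⟩ : ℝ), ?_⟩
  have hn : ‖p‖ = ‖(⟨p 0, p 1⟩ : ℂ)‖ := by
    rw [← sq_eq_sq₀ (norm_nonneg _) (norm_nonneg _), norm_sq_R2, Complex.sq_norm,
      Complex.normSq_mk]; ring
  rw [hn]
  refine R2.ext ?_ ?_
  · have := Complex.norm_mul_cos_arg ⟨p 0, p 1⟩
    simp; linarith
  · have := Complex.norm_mul_sin_arg ⟨p 0, p 1⟩
    simp; linarith

/-- The average of `g` over the circle of radius `l`. -/
def circAvg (g : R2 → ENNReal) (l : ℝ) : ENNReal := ∫⁻ t, g (rotT t (l • e0)) ∂haarT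

/-- By invariance of the Haar measure the polar angle of `p` is absorbed in `t`, and only its length
remains. -/
lemma lintegral_rotT (g : R2 → ENNReal) (p : R2) :
    ∫⁻ t, g (rotT t p) ∂haarT = circAvg g ‖p‖ := by
  obtain ⟨s, hs⟩ := exists_rotT p
  have : ∀ t, rotT t p = rotT (t + s) (‖p‖ • e0) := fun t => by rw [rotT_add, ← hs]
  simp_rw [this]
  exact lintegral_add_right_eq_self (fun t => g (rotT t (‖p‖ • e0))) s

/-- Law of cosines; `c` is the polar angle of `a` minus that of `b`, so that `s` becomes the angle
between the two vectors. -/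
lemma norm_sq_sub_rotT (a b : R2) :
    ∃ c : Torus, ∀ s : Torus, ‖a - rotT (s + c) b‖ ^ 2 =
      ‖a‖ ^ 2 + ‖b‖ ^ 2 - 2 * ‖a‖ * ‖b‖ * cosT s := by
  obtain ⟨ca, hca⟩ := exists_rotT a
  obtain ⟨cb, hcb⟩ := exists_rotT b
  refine ⟨ca - cb, fun s => ?_⟩
  have h1 : a - rotT (s + (ca - cb)) b = rotT ca (‖a‖ • e0 - rotT s (‖b‖ • e0)) := by
    have h2 : rotT (s + (ca - cb)) b = rotT ca (rotT s (‖b‖ • e0)) := by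
      conv_lhs => rw [hcb]
      rw [← rotT_add, ← rotT_add]
      congr 1
      abel
    rw [h2]
    conv_lhs => rw [hca]
    refine R2.ext ?_ ?_ <;> simp <;> ring
  rw [h1, norm_rotT, norm_sq_R2]
  simp only [PiLp.sub_apply, PiLp.smul_apply, rotT_zero_apply, rotT_one_apply, smul_eq_mul,
    e0_zero, e0_one]
  linear_combination ‖b‖ ^ 2 * cosT_sq_add_sinT_sq s

lemma lintegral_haarT_even {h : ℝ → ENNReal} (heven : ∀ x, h (-x) = h x) :
    ∫⁻ x in Ioc (-Real.pi) Real.pi, h x = 2 * ∫⁻ x in Ioo 0 Real.pi, h x := by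
  have hpi := Real.pi_pos
  rw [← Ioc_union_Ioc_eq_Ioc (show -Real.pi ≤ 0 by linarith) hpi.le,
    lintegral_union measurableSet_Ioc (Ioc_disjoint_Ioc_of_le le_rfl), two_mul]
  have h1 : ∫⁻ x in Ioc 0 Real.pi, h x = ∫⁻ x in Ioo 0 Real.pi, h x :=
    setLIntegral_congr Ioo_ae_eq_Ioc.symm
  have h2 : ∫⁻ x in Ioc (-Real.pi) 0, h x = ∫⁻ x in Ioo 0 Real.pi, h x := by
    rw [setLIntegral_congr (Ioo_ae_eq_Ioc (a := -Real.pi) (b := (0 : ℝ))).symm]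
    have h3 := (Measure.measurePreserving_neg (volume : Measure ℝ)).setLIntegral_comp_preimage_emb
      (MeasurableEquiv.neg ℝ).measurableEmbedding h (Ioo (-Real.pi) 0)
    rw [← h3]
    simp [heven]
  rw [h1, h2]

/-- The vector `⊥(R a - R' b)`, for independent uniform rotations `R` and `R'`, has the density
`χ(|a|, |b|, ·)`. -/
theorem lintegral_perp_rotT_sub {a b : R2} (ha : a ≠ 0) (hb : b ≠ 0) {g : R2 → ENNReal}
    (hg : Measurable g) :
    ∫⁻ t, ∫⁻ s, g (perp (rotT t a - rotT s b)) ∂haarT ∂haarT =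
      ∫⁻ z, ENNReal.ofReal (chi ‖a‖ ‖b‖ z) * g z := by
  have hr : 0 < ‖a‖ := norm_pos_iff.2 ha
  have hr' : 0 < ‖b‖ := norm_pos_iff.2 hb
  obtain ⟨c, hc⟩ := norm_sq_sub_rotT a b
  have hL : ∫⁻ t, ∫⁻ s, g (perp (rotT t a - rotT s b)) ∂haarT ∂haarT =
      ENNReal.ofReal Real.pi⁻¹ * ∫⁻ x in Ioo 0 Real.pi, circAvg g (chord ‖a‖ ‖b‖ x) := by
    -- Shifting `s` by `c + t` factors `R_t` out of the difference. The mean over `t` is then a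
    -- circle mean of `g`, and the radius depends on `s` alone.
    have h1 : ∀ t, ∫⁻ s, g (perp (rotT t a - rotT s b)) ∂haarT =
        ∫⁻ s, g (rotT t (perp (a - rotT (s + c) b))) ∂haarT := fun t => by
      rw [← lintegral_add_right_eq_self (fun s => g (perp (rotT t a - rotT s b))) (c + t)]
      refine lintegral_congr fun s => ?_
      congr 1
      rw [show s + (c + t) = t + (s + c) by abel, rotT_add t (s + c)]
      refine R2.ext ?_ ?_ <;> simp <;> ring
    simp_rw [h1]
    rw [lintegral_lintegral_swap]
    · simp_rw [lintegral_rotT, norm_perp]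
      rw [lintegral_haarT]
      have h2 : ∀ x : ℝ, ‖a - rotT ((x : Torus) + c) b‖ = chord ‖a‖ ‖b‖ x := fun x => by
        have := hc x
        rw [cosT_coe] at this
        rw [chord, ← this, Real.sqrt_sq (norm_nonneg _)]
      simp_rw [h2]
      rw [lintegral_haarT_even (fun x => by simp [chord]), ← mul_assoc]
      congr 1
      rw [show (2 : ENNReal) = ENNReal.ofReal 2 by simp, ← ENNReal.ofReal_mul (by positivity)]
      congr 1
      field_simp
    · refine Measurable.aemeasurable (hg.comp (Continuous.measurable ?_))
      fun_prop
  -- The density is radial, so in polar coordinates only the circle mean of `g` enters here too.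
  have hR : ∫⁻ z, ENNReal.ofReal (chi ‖a‖ ‖b‖ z) * g z =
      ∫⁻ l in Ioi 0, ENNReal.ofReal (l * chiRad ‖a‖ ‖b‖ l) *
        (ENNReal.ofReal (2 * Real.pi) * circAvg g l) := by
    rw [lintegral_R2, ← lintegral_comp_polarCoord_symm]
    have hm : Measurable fun p : ℝ × ℝ => g !₂[p.1 * Real.cos p.2, p.1 * Real.sin p.2] := by
      refine hg.comp (Continuous.measurable ?_)
      refine (PiLp.continuous_toLp 2 _).comp (continuous_pi fun i => ?_)
      fin_cases i <;> simp <;> fun_prop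
    have hm2 : Measurable fun p : ℝ × ℝ => ENNReal.ofReal (p.1 * chiRad ‖a‖ ‖b‖ p.1) *
        g !₂[p.1 * Real.cos p.2, p.1 * Real.sin p.2] := by
      have := measurable_chiRad (X := ℝ × ℝ) (measurable_const (a := ‖a‖))
        (measurable_const (a := ‖b‖)) measurable_fst
      fun_prop
    have h1 : ∫⁻ p in polarCoord.target, ENNReal.ofReal p.1 •
        (ENNReal.ofReal (chi ‖a‖ ‖b‖ !₂[(polarCoord.symm p).1, (polarCoord.symm p).2]) *
          g !₂[(polarCoord.symm p).1, (polarCoord.symm p).2]) =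
        ∫⁻ p in Ioi 0 ×ˢ Ioo (-Real.pi) Real.pi, ENNReal.ofReal (p.1 * chiRad ‖a‖ ‖b‖ p.1) *
          g !₂[p.1 * Real.cos p.2, p.1 * Real.sin p.2] := by
      refine setLIntegral_congr_fun (measurableSet_Ioi.prod measurableSet_Ioo) fun p hp => ?_
      have hp0 : 0 < p.1 := hp.1
      simp only [polarCoord_symm_apply, smul_eq_mul]
      rw [← mul_assoc, ← ENNReal.ofReal_mul hp0.le, chi_eq_chiRad]
      congr 4
      rw [← sq_eq_sq₀ (norm_nonneg _) hp0.le, norm_sq_R2]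
      simp only [Matrix.cons_val_zero, Matrix.cons_val_one]
      linear_combination p.1 ^ 2 * Real.cos_sq_add_sin_sq p.2
    rw [h1, Measure.volume_eq_prod, ← Measure.prod_restrict, lintegral_prod _ hm2.aemeasurable]
    refine setLIntegral_congr_fun measurableSet_Ioi fun l hl => ?_
    simp only
    rw [lintegral_const_mul _ (by exact hm.comp (measurable_const.prodMk measurable_id))]
    congr 1
    rw [circAvg, lintegral_haarT, ← mul_assoc, ← ENNReal.ofReal_mul (by positivity),
      mul_inv_cancel₀ Real.two_pi_pos.ne', ENNReal.ofReal_one, one_mul,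
      setLIntegral_congr Ioo_ae_eq_Ioc]
    refine lintegral_congr fun x => ?_
    congr 1
    refine R2.ext ?_ ?_ <;> simp <;> ring
  -- The two constants agree: `π⁻¹ = (2π) (2π²)⁻¹`.
  rw [hL, hR, lintegral_chord hr hr', lintegral_const_mul' _ _ ENNReal.ofReal_ne_top, ← mul_assoc,
    ← ENNReal.ofReal_mul (by positivity)]
  congr 2
  field_simp

/-! ### Parametrization of `(x̄', v')` by two rotations -/

/-- A velocity and two rotations. -/
abbrev Param := R3 × (Torus × Torus)

/-- The reference measure on `Param`. -/
abbrev paramMeasure : Measure Param := (volume : Measure R3).prod (haarT.prod haarT)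

/-- The point `(x̄', v')` whose guiding centre differs from that of `q` by `⊥(R_t v̄ - R_s v̄')`. -/
def paramPt (ω : ℝ) (q : R2 × R3) (a : Param) : R2 × R3 :=
  (ω⁻¹ • ((ω • q.1 + perp (bar q.2) - perp (bar a.1)) -
    perp (rotT a.2.1 (bar q.2) - rotT a.2.2 (bar a.1))), a.1)

lemma continuous_paramPt (ω : ℝ) (q : R2 × R3) : Continuous (paramPt ω q) := by
  unfold paramPt; fun_prop

lemma zvec_paramPt {ω : ℝ} (hω : ω ≠ 0) (q : R2 × R3) (a : Param) :
    zvec ω q (paramPt ω q a) = perp (rotT a.2.1 (bar q.2) - rotT a.2.2 (bar a.1)) := by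
  simp only [zvec, paramPt, smul_smul, mul_inv_cancel₀ hω, one_smul]
  abel

/-- The exceptional set is the kernel of `bar`, a proper subspace. -/
lemma ae_bar_ne_zero : ∀ᵐ v : R3, bar v ≠ 0 := by
  have h : volume ((LinearMap.ker (barL : R3 →ₗ[ℝ] R2) : Submodule ℝ R3) : Set R3) = 0 := by
    refine Measure.addHaar_submodule _ _ fun h => ?_
    have h1 : (EuclideanSpace.single 0 1 : R3) ∈ LinearMap.ker (barL : R3 →ₗ[ℝ] R2) := by
      rw [h]; trivial
    have h2 : bar (EuclideanSpace.single 0 1 : R3) = 0 := h1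
    have h3 := congrArg (fun p : R2 => p 0) h2
    simp at h3
  refine (measure_eq_zero_iff_ae_notMem.1 h).mono fun v hv hb => hv ?_
  exact hb

lemma lintegral_affine_R2 {ω : ℝ} (hω : ω ≠ 0) (c : R2) (h : R2 → ENNReal) (hh : Measurable h) :
    ∫⁻ z, h z = ENNReal.ofReal (ω ^ 2) * ∫⁻ x, h (c - ω • x) := by
  have h1 : ∫⁻ x, h (c - ω • x) = ∫⁻ y, h (c - y) ∂(Measure.map (ω • ·) (volume : Measure R2)) := by
    rw [lintegral_map (by fun_prop) (by fun_prop)]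
  rw [h1, Measure.map_addHaar_smul _ hω, lintegral_smul_measure, smul_eq_mul, ← mul_assoc,
    ← ENNReal.ofReal_mul (sq_nonneg ω), lintegral_sub_left_eq_self h c, finrank_euclideanSpace,
    Fintype.card_fin, abs_of_pos (by positivity), mul_inv_cancel₀ (by positivity),
    ENNReal.ofReal_one, one_mul]

@[fun_prop] lemma continuous_rad : Continuous rad := by unfold rad; fun_prop

@[fun_prop] lemma Continuous.zvec' {X : Type*} [TopologicalSpace X] {ω : ℝ} {a b : X → R2 × R3}
    (ha : Continuous a) (hb : Continuous b) : Continuous fun x => zvec ω (a x) (b x) := by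
  unfold zvec; fun_prop

lemma measurable_chi (ω : ℝ) (q : R2 × R3) :
    Measurable fun q' : R2 × R3 => chi (rad q) (rad q') (zvec ω q q') := by
  simp_rw [chi_eq_chiRad]
  exact measurable_chiRad (by fun_prop) (Continuous.measurable (by fun_prop))
    (Continuous.measurable (by fun_prop))

lemma chi_nonneg (r r' : ℝ) (z : R2) : 0 ≤ chi r r' z := by
  unfold chi; split_ifs <;> positivity

/-- For fixed `v'` the position `x̄'` is an affine function of `z` with Jacobian `ω²`, and `z` has
density `χ` under the two uniform rotations. The velocities with `v̄' = 0` form a null set. -/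
theorem map_paramPt {ω : ℝ} (hω : ω ≠ 0) {q : R2 × R3} (hq : bar q.2 ≠ 0) :
    Measure.map (paramPt ω q) paramMeasure = (volume : Measure (R2 × R3)).withDensity
      fun q' => ENNReal.ofReal (ω ^ 2 * chi (rad q) (rad q') (zvec ω q q')) := by
  have hχ := measurable_chi ω q
  refine Measure.ext_of_lintegral _ fun g hg => ?_
  have hgp : Measurable fun a => g (paramPt ω q a) := hg.comp (continuous_paramPt ω q).measurable
  rw [lintegral_map hg (continuous_paramPt ω q).measurable,
    lintegral_prod (fun a => g (paramPt ω q a)) hgp.aemeasurable,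
    lintegral_withDensity_eq_lintegral_mul _ (by fun_prop) hg, Measure.volume_eq_prod,
    lintegral_prod_symm _ (by fun_prop)]
  refine lintegral_congr_ae (ae_bar_ne_zero.mono fun v' hv' => ?_)
  set c := ω • q.1 + perp (bar q.2) - perp (bar v') with hc
  have hgm : Measurable fun z : R2 => g (ω⁻¹ • (c - z), v') := by fun_prop
  have h1 : ∫⁻ y : Torus × Torus, g (paramPt ω q (v', y)) ∂(haarT.prod haarT) =
      ∫⁻ z, ENNReal.ofReal (chi ‖bar q.2‖ ‖bar v'‖ z) * g (ω⁻¹ • (c - z), v') := by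
    rw [← lintegral_perp_rotT_sub hq hv' hgm,
      lintegral_prod (fun y => g (paramPt ω q (v', y))) (hgp.comp measurable_prodMk_left).aemeasurable]
    rfl
  have hm : Measurable fun z : R2 =>
      ENNReal.ofReal (chi ‖bar q.2‖ ‖bar v'‖ z) * g (ω⁻¹ • (c - z), v') := by
    have : Measurable fun z : R2 => chi ‖bar q.2‖ ‖bar v'‖ z := by
      simp_rw [chi_eq_chiRad]
      exact measurable_chiRad (by fun_prop) (by fun_prop) (by fun_prop)
    fun_prop
  simp only
  rw [h1, lintegral_affine_R2 hω c _ hm, ← lintegral_const_mul' _ _ ENNReal.ofReal_ne_top]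
  refine lintegral_congr fun x => ?_
  have h2 : c - ω • x = zvec ω q (x, v') := by rw [hc, zvec]; abel
  have h3 : ω⁻¹ • (c - (c - ω • x)) = x := by
    rw [sub_sub_cancel, smul_smul, inv_mul_cancel₀ hω, one_smul]
  simp only [Pi.mul_apply]
  rw [h3, h2, ← mul_assoc, ← ENNReal.ofReal_mul (sq_nonneg ω)]
  rfl

/-- The rotation angle of `v̄` and the rotated velocity. -/
def paramVel (a : Param) : Torus × R3 := (a.2.1, rot3 a.2.2 a.1)

lemma continuous_paramVel : Continuous paramVel := by unfold paramVel; fun_prop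

/-- For fixed angles, rotating `v'` preserves Lebesgue measure, and the angle `s` that is then
superfluous carries total mass one. This is what introduces the second rotation for free. -/
lemma measurePreserving_paramVel :
    MeasurePreserving paramVel paramMeasure (haarT.prod volume) := by
  refine ⟨continuous_paramVel.measurable, ?_⟩
  refine Measure.ext_of_lintegral _ fun g hg => ?_
  have hm : Measurable fun a : Param => g (paramVel a) := hg.comp continuous_paramVel.measurable
  rw [lintegral_map hg continuous_paramVel.measurable, lintegral_prod_symm _ hm.aemeasurable]
  have h1 : ∀ y : Torus × Torus, ∫⁻ v', g (paramVel (v', y)) = ∫⁻ v', g (y.1, v') := fun y =>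
    (measurePreserving_rot3 y.2).lintegral_comp (f := fun v' => g (y.1, v'))
      (hg.comp measurable_prodMk_left)
  simp_rw [h1]
  have hm2 : Measurable fun t : Torus => ∫⁻ v', g (t, v') := hg.lintegral_prod_right'
  rw [lintegral_prod _ hg.aemeasurable,
    lintegral_prod (fun y : Torus × Torus => ∫⁻ v', g (y.1, v'))
      (hm2.comp measurable_fst).aemeasurable]
  simp

/-! ### The reflection that preserves the difference of the rotated vectors -/

/-- The angle of a vector of the plane. -/
def angT (p : R2) : Torus := ((Complex.arg ((p 0 : ℂ) + p 1 * Complex.I) : ℝ) : Torus)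

lemma measurable_angT : Measurable angT := by
  refine AddCircle.measurable_mk'.comp (Complex.measurable_arg.comp (Continuous.measurable ?_))
  fun_prop

lemma norm_eq_norm_complex (p : R2) : ‖p‖ = ‖(p 0 : ℂ) + p 1 * Complex.I‖ := by
  rw [← sq_eq_sq₀ (norm_nonneg _) (norm_nonneg _), norm_sq_R2, Complex.sq_norm,
    Complex.normSq_add_mul_I]

lemma norm_mul_cosT_angT (p : R2) : ‖p‖ * cosT (angT p) = p 0 := by
  rw [angT, cosT_coe, norm_eq_norm_complex, Complex.norm_mul_cos_arg]; simp

lemma norm_mul_sinT_angT (p : R2) : ‖p‖ * sinT (angT p) = p 1 := by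
  rw [angT, sinT_coe, norm_eq_norm_complex, Complex.norm_mul_sin_arg]; simp

lemma rotT_angT (p : R2) : rotT (angT p) (‖p‖ • e0) = p := by
  refine R2.ext ?_ ?_
  · have := norm_mul_cosT_angT p
    simp; linarith
  · have := norm_mul_sinT_angT p
    simp; linarith

/-- The measure preserving map `(t, s) ↦ (t + 2 κ(ψ), s + 2 κ(ψ) - 2 ψ)`, with `ψ = s - t + c`. -/
def shear (κ : Torus → Torus) (c : Torus) (y : Torus × Torus) : Torus × Torus :=
  (y.1 + (κ (y.2 - y.1 + c) + κ (y.2 - y.1 + c)),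
    -(y.2 - y.1 + c) + (y.1 + (κ (y.2 - y.1 + c) + κ (y.2 - y.1 + c))) - c)

/-- In the variables `(t, ψ)` the map is `ψ ↦ -ψ` followed by a translation of `t` depending on `ψ`
only. It is therefore a composition of skew products with translations or inversion in the fibres,
and measurability of `κ` suffices. -/
lemma measurePreserving_shear {κ : Torus → Torus} (hκ : Measurable κ) (c : Torus) :
    MeasurePreserving (shear κ c) (haarT.prod haarT) (haarT.prod haarT) := by
  have h1 : MeasurePreserving (fun y : Torus × Torus => (y.1, y.2 - y.1 + c))
      (haarT.prod haarT) (haarT.prod haarT) := by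
    refine (MeasurePreserving.id haarT).skew_product (g := fun t s => s - t + c) (by fun_prop)
      (Filter.Eventually.of_forall fun t => ?_)
    have := (measurePreserving_add_right haarT (-t + c)).map_eq
    rw [← this]
    congr 1
    funext s
    abel
  have h2 : MeasurePreserving (fun y : Torus × Torus => (-y.1, y.2 + (κ y.1 + κ y.1)))
      (haarT.prod haarT) (haarT.prod haarT) := by
    refine (Measure.measurePreserving_neg haarT).skew_product (g := fun ψ t => t + (κ ψ + κ ψ))
      (by fun_prop) (Filter.Eventually.of_forall fun ψ => ?_)
    exact (measurePreserving_add_right haarT _).map_eq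
  have h3 : MeasurePreserving (fun y : Torus × Torus => (y.1, y.2 + y.1 - c))
      (haarT.prod haarT) (haarT.prod haarT) := by
    refine (MeasurePreserving.id haarT).skew_product (g := fun t s => s + t - c) (by fun_prop)
      (Filter.Eventually.of_forall fun t => ?_)
    have := (measurePreserving_add_right haarT (t - c)).map_eq
    rw [← this]
    congr 1
    funext s
    abel
  exact h3.comp (Measure.measurePreserving_swap.comp (h2.comp
    (Measure.measurePreserving_swap.comp h1)))

/-- The angle of `r - r' exp (i ψ)`. -/
def chordAngle (r r' : ℝ) (ψ : Torus) : Torus := angT (r • e0 - r' • rotT ψ e0)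

/-- The reflection of the pair of rotated velocities which preserves their difference. -/
def reflect (q : R2 × R3) (a : Param) : Param :=
  (a.1, shear (chordAngle ‖bar q.2‖ ‖bar a.1‖) (angT (bar a.1) - angT (bar q.2)) a.2)

lemma measurePreserving_reflect (q : R2 × R3) :
    MeasurePreserving (reflect q) paramMeasure paramMeasure := by
  have hang := measurable_angT
  have hκ : Measurable fun x : ℝ × Torus => chordAngle ‖bar q.2‖ x.1 x.2 := by
    unfold chordAngle
    refine hang.comp (Continuous.measurable ?_)
    fun_prop
  refine (MeasurePreserving.id volume).skew_product
    (g := fun v' y => shear (chordAngle ‖bar q.2‖ ‖bar v'‖) (angT (bar v') - angT (bar q.2)) y)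
    ?_ (Filter.Eventually.of_forall fun v' => ?_)
  · have hψ : Measurable fun a : Param =>
        a.2.2 - a.2.1 + (angT (bar a.1) - angT (bar q.2)) := by fun_prop
    have hκ' : Measurable fun a : Param => chordAngle ‖bar q.2‖ ‖bar a.1‖
        (a.2.2 - a.2.1 + (angT (bar a.1) - angT (bar q.2))) := by
      have hn : Measurable fun a : Param => ‖bar a.1‖ := by fun_prop
      have := hκ.comp (hn.prodMk hψ)
      exact this
    have h1 : Measurable fun a : Param => a.2.1 := by fun_prop
    have h2 : Measurable fun a : Param => angT (bar a.1) - angT (bar q.2) := by fun_prop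
    have h3 := h1.add (hκ'.add hκ')
    exact h3.prodMk ((hψ.neg.add h3).sub h2)
  · exact (measurePreserving_shear (hκ.comp measurable_prodMk_left) _).map_eq

section

variable (q : R2 × R3) (a : Param)

lemma rotT_reflect_aux (p : R2) (t : Torus) :
    rotT t p = rotT (t + angT p) (‖p‖ • e0) := by
  rw [rotT_add, rotT_angT]

/-- In complex notation `r - r' e^{-iψ}` is the conjugate of `D = r - r' e^{iψ} = |D| e^{iκ}`, and
multiplying the conjugate by `e^{2iκ}` gives back `D`. The case `D = 0` needs no exception. -/
lemma double_chordAngle (r r' : ℝ) (ψ : Torus) :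
    rotT (chordAngle r r' ψ + chordAngle r r' ψ) (r • e0 - r' • rotT (-ψ) e0) =
      r • e0 - r' • rotT ψ e0 := by
  set D := r • e0 - r' • rotT ψ e0 with hD
  have h0 := norm_mul_cosT_angT D
  have h1 := norm_mul_sinT_angT D
  have h2 := cosT_sq_add_sinT_sq (angT D)
  have hD0 : D 0 = r - r' * cosT ψ := by simp [hD]
  have hD1 : D 1 = -(r' * sinT ψ) := by simp [hD]
  have hk : chordAngle r r' ψ = angT D := rfl
  rw [hk]
  refine R2.ext ?_ ?_
  · simp only [rotT_zero_apply, PiLp.sub_apply, PiLp.smul_apply, smul_eq_mul, e0_zero, e0_one,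
      rotT_one_apply, cosT_neg, sinT_neg, cosT_add, sinT_add, mul_one, mul_zero, sub_zero, add_zero]
    rw [show r - r' * cosT ψ = ‖D‖ * cosT (angT D) by rw [h0, hD0],
      show 0 - r' * -sinT ψ = -(‖D‖ * sinT (angT D)) by rw [h1, hD1]; ring, ← h0]
    linear_combination (‖D‖ * cosT (angT D)) * h2
  · simp only [rotT_zero_apply, PiLp.sub_apply, PiLp.smul_apply, smul_eq_mul, e0_zero, e0_one,
      rotT_one_apply, cosT_neg, sinT_neg, cosT_add, sinT_add, mul_one, mul_zero, sub_zero, add_zero]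
    rw [show r - r' * cosT ψ = ‖D‖ * cosT (angT D) by rw [h0, hD0],
      show 0 - r' * -sinT ψ = -(‖D‖ * sinT (angT D)) by rw [h1, hD1]; ring, ← h1]
    linear_combination (‖D‖ * sinT (angT D)) * h2

/-- Reversing the angle `ψ` between the two vectors conjugates their difference, and turning the
pair by `2κ` undoes the conjugation by `double_chordAngle`. -/
lemma reflect_sub :
    rotT (reflect q a).2.1 (bar q.2) - rotT (reflect q a).2.2 (bar (reflect q a).1) =
      rotT a.2.1 (bar q.2) - rotT a.2.2 (bar a.1) := by
  obtain ⟨v', t, s⟩ := a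
  set r := ‖bar q.2‖ with hr
  set r' := ‖bar v'‖ with hr'
  set θ := angT (bar q.2) with hθ
  set θ' := angT (bar v') with hθ'
  set ψ := s - t + (θ' - θ) with hψ
  have hd := double_chordAngle r r' ψ
  set κ := chordAngle r r' ψ with hκ
  have h1 : (reflect q (v', t, s)).2 = (t + (κ + κ), -ψ + (t + (κ + κ)) - (θ' - θ)) := rfl
  have h2 : (reflect q (v', t, s)).1 = v' := rfl
  rw [h1, h2]
  simp only
  rw [rotT_reflect_aux (bar q.2), rotT_reflect_aux (bar v'), rotT_reflect_aux (bar q.2) t,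
    rotT_reflect_aux (bar v') s, ← hr, ← hr', ← hθ, ← hθ']
  have e1 : t + (κ + κ) + θ = (t + θ) + (κ + κ) := by abel
  have e2 : -ψ + (t + (κ + κ)) - (θ' - θ) + θ' = (t + θ) + ((κ + κ) + -ψ) := by abel
  have e3 : s + θ' = (t + θ) + ψ := by rw [hψ]; abel
  have hsub : ∀ (t : Torus) (p p' : R2), rotT t (p - p') = rotT t p - rotT t p' := fun t p p' =>
    R2.ext (by simp; ring) (by simp; ring)
  rw [e1, e2, e3, rotT_add (t + θ) (κ + κ), rotT_add (t + θ) (κ + κ + -ψ), rotT_add (t + θ) ψ,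
    rotT_add (κ + κ), ← hsub, ← hsub, ← hsub]
  simp only [rotT_map_smul] at hd ⊢
  rw [hsub, rotT_map_smul, rotT_map_smul] at hd
  rw [hsub, rotT_map_smul, rotT_map_smul, hd]

/-- The new triangle is the mirror image of the old one in the line of `U`, so components orthogonal
to `U` change sign. -/
lemma reflect_inner :
    inner ℝ (perp (rotT a.2.1 (bar q.2) - rotT a.2.2 (bar a.1)))
      (rotT (reflect q a).2.1 (bar q.2)) =
    -inner ℝ (perp (rotT a.2.1 (bar q.2) - rotT a.2.2 (bar a.1))) (rotT a.2.1 (bar q.2)) := by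
  obtain ⟨v', t, s⟩ := a
  set r := ‖bar q.2‖ with hr
  set r' := ‖bar v'‖ with hr'
  set θ := angT (bar q.2) with hθ
  set θ' := angT (bar v') with hθ'
  set ψ := s - t + (θ' - θ) with hψ
  have hd := double_chordAngle r r' ψ
  set κ := chordAngle r r' ψ with hκ
  have h1 : (reflect q (v', t, s)).2 = (t + (κ + κ), -ψ + (t + (κ + κ)) - (θ' - θ)) := rfl
  rw [h1]
  simp only
  rw [rotT_reflect_aux (bar q.2) (t + (κ + κ)), rotT_reflect_aux (bar q.2) t,
    rotT_reflect_aux (bar v') s, ← hr, ← hr', ← hθ, ← hθ']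
  have e1 : t + (κ + κ) + θ = (t + θ) + (κ + κ) := by abel
  have e3 : s + θ' = (t + θ) + ψ := by rw [hψ]; abel
  have hsub : ∀ (t : Torus) (p p' : R2), rotT t (p - p') = rotT t p - rotT t p' := fun t p p' =>
    R2.ext (by simp; ring) (by simp; ring)
  have hinner : ∀ (t : Torus) (p p' : R2), inner ℝ (perp (rotT t p)) (rotT t p') =
      inner ℝ (perp p) p' := fun t p p' => by
    rw [← rotT_perp, ← inner_rotT_left, rotT_neg_rotT]
  rw [e1, e3, rotT_add (t + θ) (κ + κ), rotT_add (t + θ) ψ, ← hsub, hinner, hinner]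
  have h3 : r • e0 - rotT ψ (r' • e0) =
      rotT (κ + κ) (r • e0 - r' • rotT (-ψ) e0) := by rw [hd, rotT_map_smul]
  rw [h3, hinner, ← h3, inner_R2, inner_R2]
  simp [-mul_eq_mul_right_iff, -neg_inj]
  ring

lemma reflect_fst : (reflect q a).1 = a.1 := rfl

/-- The parametrized point sees the two angles only through the difference of the rotated vectors,
so both mirror images lie over the same `(x̄', v')`. -/
lemma paramPt_reflect (ω : ℝ) : paramPt ω q (reflect q a) = paramPt ω q a := by
  rw [paramPt, reflect_sub, reflect_fst, paramPt]

end

/-! ### The averaged matrices -/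

lemma dot_sub_left (a b y : Phase) : dot (a - b) y = dot a y - dot b y := by
  simp only [dot, Prod.fst_sub, Prod.snd_sub, inner_sub_left]; ring

lemma dot_smul_left (c : ℝ) (a y : Phase) : dot (c • a) y = c * dot a y := by
  simp only [dot, Prod.smul_fst, Prod.smul_snd, inner_smul_left, conj_trivial]; ring

/-- A parity argument: changing all four signs leaves the products of two coefficients unchanged and
cancels the terms linear in them. -/
lemma tens_pair (B C a a' b b' B₂ C₂ y : Phase) (α α' β β' : ℝ) :
    (tens (B - α • b) (C - α' • b') y + tens (B₂ - β • a) (C₂ - β' • a') y) +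
      (tens (B - (-α) • b) (C - (-α') • b') y + tens (B₂ - (-β) • a) (C₂ - (-β') • a') y) =
    (2 : ℝ) • ((β * β') • tens a a' y + tens B C y + (α * α') • tens b b' y + tens B₂ C₂ y) := by
  simp only [tens, dot_sub_left, dot_smul_left]
  module

/-- The gyration frame at `q` spans the image of a velocity vector under the flow. -/
lemma flowL_neg_inr {q : R2 × R3} (hq : bar q.2 ≠ 0) (t : Torus) (η : R3) :
    flowL 1 (-t) (0, η) = (lift (perp (bar η)) 0, η 2 • e3) +
      (inner ℝ (bar η) (perp (rotT t (bar q.2))) / rad q) • dirA q -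
      (inner ℝ (bar η) (rotT t (bar q.2)) / rad q) • dirB q := by
  have hr : rad q ≠ 0 := norm_ne_zero_iff.2 hq
  have hr2 : rad q ^ 2 = q.2 0 ^ 2 + q.2 1 ^ 2 := by rw [rad, norm_sq_R2]; simp
  -- Expansion of a plane vector in the orthogonal pair `v̄, ⊥v̄`, both of squared length `r²`; each
  -- coordinate below is an instance.
  have key : ∀ x y z : ℝ, ∀ m n : ℝ, z * rad q ^ 2 = x * m - y * n →
      z = x / rad q * ((rad q)⁻¹ * m) - y / rad q * ((rad q)⁻¹ * n) := by
    intro x y z m n h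
    field_simp
    linarith
  rw [flowL_apply]
  refine Phase.ext ?_ ?_ ?_ ?_ ?_ ?_
  · have := key (inner ℝ (bar η) (perp (rotT t (bar q.2))))
      (inner ℝ (bar η) (rotT t (bar q.2))) (-(rotT (-t) (bar η) 1)) (q.2 0) (q.2 1)
      (by rw [hr2, inner_R2, inner_R2]; simp; ring)
    simp [flow, dirA, dirB] at this ⊢
    linarith
  · have := key (inner ℝ (bar η) (perp (rotT t (bar q.2))))
      (inner ℝ (bar η) (rotT t (bar q.2))) (rotT (-t) (bar η) 0) (q.2 1) (-q.2 0)
      (by rw [hr2, inner_R2, inner_R2]; simp; ring)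
    simp [flow, dirA, dirB] at this ⊢
    linarith
  · simp [flow, dirA, dirB]
  · have := key (inner ℝ (bar η) (perp (rotT t (bar q.2))))
      (inner ℝ (bar η) (rotT t (bar q.2))) (rotT (-t) (bar η) 0) (q.2 1) (-q.2 0)
      (by rw [hr2, inner_R2, inner_R2]; simp; ring)
    simp [flow, dirA, dirB, rot3, e3] at this ⊢
    linarith
  · have := key (inner ℝ (bar η) (perp (rotT t (bar q.2))))
      (inner ℝ (bar η) (rotT t (bar q.2))) (rotT (-t) (bar η) 1) (-q.2 0) (-q.2 1)
      (by rw [hr2, inner_R2, inner_R2]; simp; ring)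
    simp [flow, dirA, dirB, rot3, e3] at this ⊢
    linarith
  · simp [flow, dirA, dirB, rot3, e3]

/-- The horizontal unit vector orthogonal to `(U, d)`. -/
def frame1 (U : R2) : R3 := ‖U‖⁻¹ • lift (perp U) 0

/-- The unit vector orthogonal to `(U, d)` and to `frame1 U`. -/
def frame2 (U : R2) (d : ℝ) : R3 :=
  (Real.sqrt (‖U‖ ^ 2 + d ^ 2))⁻¹ • lift ((d * ‖U‖⁻¹) • U) (-‖U‖)

/-- The two frame vectors form an orthonormal basis of the plane orthogonal to `(U, d)`. The first
is horizontal, which keeps the pull-backs by the gyration explicit. -/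
lemma S_lift {U : R2} (hU : U ≠ 0) (d : ℝ) (y : R3) :
    S (lift U d) y = inner ℝ y (frame1 U) • frame1 U + inner ℝ y (frame2 U d) • frame2 U d := by
  have hl : ‖U‖ ≠ 0 := norm_ne_zero_iff.2 hU
  have hl2 : ‖U‖ ^ 2 = U 0 ^ 2 + U 1 ^ 2 := norm_sq_R2 U
  set l := ‖U‖ with hldef
  have hρ0 : 0 < l ^ 2 + d ^ 2 := by positivity
  set ρ := Real.sqrt (l ^ 2 + d ^ 2) with hρ
  have hρ2 : ρ ^ 2 = l ^ 2 + d ^ 2 := Real.sq_sqrt hρ0.le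
  have hρne : ρ ≠ 0 := (Real.sqrt_pos.2 hρ0).ne'
  have hn : ‖lift U d‖ ^ 2 = ρ ^ 2 := by rw [norm_sq_lift, hρ2]
  have hi2 : inner ℝ y (frame2 U d) = (d * (y 0 * U 0 + y 1 * U 1) - l ^ 2 * y 2) / (l * ρ) := by
    rw [inner_R3]; simp [frame2, ← hldef, ← hρ]; field_simp; ring
  have hi1 : inner ℝ y (frame1 U) = (y 0 * U 1 - y 1 * U 0) / l := by
    rw [inner_R3]; simp [frame1, ← hldef]; field_simp; ring
  have hd2 : d ^ 2 = ρ ^ 2 - (U 0 ^ 2 + U 1 ^ 2) := by rw [hρ2, hl2]; ring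
  rw [hi1, hi2, S, hn, inner_R3]
  refine R3.ext ?_ ?_ ?_
  · simp only [PiLp.sub_apply, PiLp.smul_apply, PiLp.add_apply, lift_zero_apply, lift_one_apply,
      lift_two_apply, smul_eq_mul, frame1, frame2, perp_zero_apply, ← hldef, ← hρ]
    field_simp
    rw [hl2]
    linear_combination (y 0 * U 0 ^ 2 + y 1 * U 0 * U 1) * (hρ2 + hl2)
  · simp only [PiLp.sub_apply, PiLp.smul_apply, PiLp.add_apply, lift_zero_apply, lift_one_apply,
      lift_two_apply, smul_eq_mul, frame1, frame2, perp_one_apply, ← hldef, ← hρ]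
    field_simp
    rw [hl2]
    linear_combination (y 0 * U 0 * U 1 + y 1 * U 1 ^ 2) * (hρ2 + hl2)
  · simp only [PiLp.sub_apply, PiLp.smul_apply, PiLp.add_apply, lift_zero_apply, lift_one_apply,
      lift_two_apply, smul_eq_mul, frame1, frame2, ← hldef, ← hρ]
    field_simp
    rw [hl2]
    linear_combination (y 2 * (U 0 ^ 2 + U 1 ^ 2)) * (hρ2 + hl2)

lemma inner_perp_perp (U V : R2) : inner ℝ (perp U) (perp V) = inner ℝ U V := by
  rw [inner_R2, inner_R2]; simp; ring

lemma inner_perp_right (U V : R2) : inner ℝ U (perp V) = -inner ℝ (perp U) V := by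
  rw [inner_R2, inner_R2]; simp

lemma bar_frame1 (U : R2) : bar (frame1 U) = ‖U‖⁻¹ • perp U := by
  rw [frame1, bar_smul, bar_lift]

lemma bar_frame2 (U : R2) (d : ℝ) :
    bar (frame2 U d) = ((Real.sqrt (‖U‖ ^ 2 + d ^ 2))⁻¹ * (d * ‖U‖⁻¹)) • U := by
  rw [frame2, bar_smul, bar_lift, smul_smul]

lemma flowL_frame1 {q : R2 × R3} (hq : bar q.2 ≠ 0) (t : Torus) (U : R2) :
    flowL 1 (-t) (0, frame1 U) =
      ((inner ℝ U (rotT t (bar q.2)) / (‖U‖ * rad q)) • dirA q +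
        (‖U‖⁻¹ • lift (perp (perp U)) 0, 0)) -
      (inner ℝ (perp U) (rotT t (bar q.2)) / (‖U‖ * rad q)) • dirB q := by
  rw [flowL_neg_inr hq, bar_frame1, inner_smul_left, inner_smul_left, inner_perp_perp]
  have h1 : lift (perp (‖U‖⁻¹ • perp U)) 0 = ‖U‖⁻¹ • lift (perp (perp U)) 0 :=
    R3.ext (by simp) (by simp) (by simp)
  have h2 : frame1 U 2 = 0 := by simp [frame1]
  rw [h1, h2, zero_smul]
  simp only [conj_trivial]
  rw [show ‖U‖⁻¹ * inner ℝ U (rotT t (bar q.2)) / rad q =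
      inner ℝ U (rotT t (bar q.2)) / (‖U‖ * rad q) by rw [div_mul_eq_div_div]; ring,
    show ‖U‖⁻¹ * inner ℝ (perp U) (rotT t (bar q.2)) / rad q =
      inner ℝ (perp U) (rotT t (bar q.2)) / (‖U‖ * rad q) by rw [div_mul_eq_div_div]; ring]
  abel

lemma flowL_frame2 {q : R2 × R3} (hq : bar q.2 ≠ 0) (t : Torus) (U : R2) (d : ℝ) :
    flowL 1 (-t) (0, frame2 U d) =
      ((-(inner ℝ U (rotT t (bar q.2)) * d /
          (‖U‖ * rad q * Real.sqrt (‖U‖ ^ 2 + d ^ 2)))) • dirB q +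
        (Real.sqrt (‖U‖ ^ 2 + d ^ 2))⁻¹ •
          ((d * ‖U‖⁻¹) • lift (perp U) 0, -(‖U‖ • e3))) -
      (inner ℝ (perp U) (rotT t (bar q.2)) * d /
        (‖U‖ * rad q * Real.sqrt (‖U‖ ^ 2 + d ^ 2))) • dirA q := by
  rw [flowL_neg_inr hq, bar_frame2, inner_smul_left, inner_smul_left, inner_perp_right]
  set ρ := Real.sqrt (‖U‖ ^ 2 + d ^ 2)
  have h1 : (lift (perp ((ρ⁻¹ * (d * ‖U‖⁻¹)) • U)) 0, (frame2 U d) 2 • e3) =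
      ρ⁻¹ • (((d * ‖U‖⁻¹) • lift (perp U) 0, -(‖U‖ • e3)) : Phase) := by
    refine Phase.ext ?_ ?_ ?_ ?_ ?_ ?_ <;> simp [frame2, e3, ρ] <;> ring
  rw [h1]
  simp only [conj_trivial]
  rw [show ρ⁻¹ * (d * ‖U‖⁻¹) * inner ℝ U (rotT t (bar q.2)) / rad q =
      inner ℝ U (rotT t (bar q.2)) * d / (‖U‖ * rad q * ρ) by
        rw [div_mul_eq_div_div, div_mul_eq_div_div]; ring,
    show ρ⁻¹ * (d * ‖U‖⁻¹) * -inner ℝ (perp U) (rotT t (bar q.2)) / rad q =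
      -(inner ℝ (perp U) (rotT t (bar q.2)) * d / (‖U‖ * rad q * ρ)) by
        rw [div_mul_eq_div_div, div_mul_eq_div_div]; ring, neg_smul, neg_smul]
  abel

/-! ### Evaluation of the kernels at the parametrized points -/

section

variable {ω : ℝ} (hω : ω ≠ 0)
include hω

/-- This identity is what dictates the formula for `paramPt`: flowed by `s`, the point reaches the
position `X(t)` with velocity `R_s v'`, so that `f` there equals `f` at the parametrized point. -/
lemma flow_paramPt (p : Phase) (a : Param) :
    flow ω a.2.2 (pt (paramPt ω (red p) a) (p.1 2)) =
      ((flow ω a.2.1 p).1, rot3 a.2.2 a.1) := by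
  refine Phase.ext ?_ ?_ ?_ rfl rfl rfl
  · simp [flow, pt, paramPt, red]; field_simp; ring
  · simp [flow, pt, paramPt, red]; field_simp; ring
  · simp [flow, pt]

omit hω in
lemma flow_snd_sub (p : Phase) (a : Param) :
    (flow ω a.2.1 p).2 - rot3 a.2.2 a.1 =
      lift (rotT a.2.1 (bar p.2) - rotT a.2.2 (bar a.1)) (p.2 2 - a.1 2) := by
  refine R3.ext ?_ ?_ ?_ <;> simp [flow, rot3]

lemma relSpeed_paramPt (q : R2 × R3) (a : Param) :
    relSpeed ω q (paramPt ω q a) =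
      Real.sqrt (‖rotT a.2.1 (bar q.2) - rotT a.2.2 (bar a.1)‖ ^ 2 + (q.2 2 - a.1 2) ^ 2) := by
  rw [relSpeed, zvec_paramPt hω, norm_perp]; rfl

omit hω in
lemma norm_lift (U : R2) (d : ℝ) : ‖lift U d‖ = Real.sqrt (‖U‖ ^ 2 + d ^ 2) := by
  rw [← norm_sq_lift, Real.sqrt_sq (norm_nonneg _)]

omit hω in
lemma abs_inner_rotT_le (a b : R2) (t s : Torus) :
    |inner ℝ (rotT t a) (rotT s b)| ≤ ‖a‖ * ‖b‖ := by
  simpa using abs_real_inner_le_norm (rotT t a) (rotT s b)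

/-- Since `|z| = |R_t v̄ - R_s v̄'|`, `φ` is the angle between the rotated vectors; Cauchy–Schwarz
keeps the argument of `arccos` in `[-1, 1]`, where the cosine inverts it. -/
lemma rad_mul_cos_phi {q : R2 × R3} (hq : bar q.2 ≠ 0) {a : Param} (ha : bar a.1 ≠ 0) :
    rad q * ‖bar a.1‖ * Real.cos (phi ω q (paramPt ω q a)) =
      inner ℝ (rotT a.2.1 (bar q.2)) (rotT a.2.2 (bar a.1)) := by
  have hr : 0 < ‖bar q.2‖ := norm_pos_iff.2 hq
  have hr' : 0 < ‖bar a.1‖ := norm_pos_iff.2 ha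
  have h1 := norm_sub_sq_real (rotT a.2.1 (bar q.2)) (rotT a.2.2 (bar a.1))
  rw [norm_rotT, norm_rotT] at h1
  have h2 := abs_le.1 (abs_inner_rotT_le (bar q.2) (bar a.1) a.2.1 a.2.2)
  have hrad : rad (paramPt ω q a) = ‖bar a.1‖ := rfl
  rw [phi, angle, zvec_paramPt hω, norm_perp, hrad, h1, rad]
  set I := inner ℝ (rotT a.2.1 (bar q.2)) (rotT a.2.2 (bar a.1)) with hI
  have h3 : (‖bar q.2‖ ^ 2 + ‖bar a.1‖ ^ 2 - (‖bar q.2‖ ^ 2 - 2 * I + ‖bar a.1‖ ^ 2)) /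
      (2 * ‖bar q.2‖ * ‖bar a.1‖) = I / (‖bar q.2‖ * ‖bar a.1‖) := by
    field_simp; ring
  rw [h3, Real.cos_arccos]
  · field_simp
  · rw [le_div_iff₀ (by positivity)]; linarith
  · rw [div_le_one (by positivity)]; linarith

omit hω in
-- Lagrange's identity, since `⟨⊥(V - W), V⟩` is up to sign the determinant of `V` and `W`.
lemma inner_perp_sq (V W : R2) :
    inner ℝ (perp (V - W)) V ^ 2 = ‖V‖ ^ 2 * ‖W‖ ^ 2 - inner ℝ V W ^ 2 := by
  rw [norm_sq_R2, norm_sq_R2, inner_R2, inner_R2]; simp; ring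

lemma rad_mul_sin_phi_sq {q : R2 × R3} (hq : bar q.2 ≠ 0) {a : Param} (ha : bar a.1 ≠ 0) :
    rad q ^ 2 * ‖bar a.1‖ ^ 2 * Real.sin (phi ω q (paramPt ω q a)) ^ 2 =
      inner ℝ (perp (rotT a.2.1 (bar q.2) - rotT a.2.2 (bar a.1))) (rotT a.2.1 (bar q.2)) ^ 2 := by
  rw [inner_perp_sq, norm_rotT, norm_rotT, ← rad_mul_cos_phi hω hq ha, Real.sin_sq, rad]
  ring

end

/-- The pull-back by the flow of the velocity kernel `K`. -/
def pullKernel (ω : ℝ) (K : Phase → R3 → R3) (p : Phase) (y : Torus × R3) : Phase :=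
  flowL 1 (-y.1) (0, K (flow ω y.1 p) y.2)

lemma flowL_inr_S {U : R2} (hU : U ≠ 0) (d : ℝ) (y : R3) (t : Torus) (c : ℝ) :
    flowL 1 (-t) (0, c • S (lift U d) y) =
      c • (inner ℝ y (frame1 U) • flowL 1 (-t) (0, frame1 U) +
        inner ℝ y (frame2 U d) • flowL 1 (-t) (0, frame2 U d)) := by
  rw [S_lift hU, ← map_smul, ← map_smul, ← map_add, ← map_smul]
  congr 1
  ext <;> simp

/-! ### Pulled-back kernels in the gyration frames, and their parity under the reflection. -/

section

variable {ω : ℝ} (hω : ω ≠ 0) {σ : ℝ → ℝ} {f : Phase → ℝ} (hf : Differentiable ℝ f)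
  (hT : ∀ p, transport ω f p = 0) {p : Phase} (hp : bar p.2 ≠ 0) {a : Param} (ha : bar a.1 ≠ 0)
  (hU : rotT a.2.1 (bar p.2) - rotT a.2.2 (bar a.1) ≠ 0)

include hω in
lemma coef_ratio (hp : bar p.2 ≠ 0) (ha : bar a.1 ≠ 0) :
    inner ℝ (rotT a.2.1 (bar p.2) - rotT a.2.2 (bar a.1)) (rotT a.2.1 (bar p.2)) / rad (red p) =
      rad (red p) - ‖bar a.1‖ * Real.cos (phi ω (red p) (paramPt ω (red p) a)) := by
  have hr : rad (red p) ≠ 0 := norm_ne_zero_iff.2 hp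
  have h := rad_mul_cos_phi hω (q := red p) hp ha
  rw [inner_sub_left, real_inner_self_eq_norm_sq, norm_rotT,
    real_inner_comm, show bar p.2 = bar (red p).2 from rfl, ← h, div_eq_iff hr, rad]
  ring

include hω in
lemma coef_ratio' (hp : bar p.2 ≠ 0) (ha : bar a.1 ≠ 0) :
    inner ℝ (rotT a.2.1 (bar p.2) - rotT a.2.2 (bar a.1)) (rotT a.2.2 (bar a.1)) / ‖bar a.1‖ =
      rad (red p) * Real.cos (phi ω (red p) (paramPt ω (red p) a)) - ‖bar a.1‖ := by
  have hr : ‖bar a.1‖ ≠ 0 := norm_ne_zero_iff.2 ha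
  have h := rad_mul_cos_phi hω (q := red p) hp ha
  rw [inner_sub_left, real_inner_self_eq_norm_sq, norm_rotT,
    show bar p.2 = bar (red p).2 from rfl, ← h, div_eq_iff hr, rad]
  ring

omit hp ha in
-- Because of this the gain and the loss side share the coefficient `crossCoef`, whence the
-- symmetric factor `r r' sin² φ` in `A⁻`.
lemma inner_perp_self_sub (V W : R2) : inner ℝ (perp (V - W)) W = inner ℝ (perp (V - W)) V := by
  rw [inner_R2, inner_R2]; simp; ring

/-- The coefficient `⟨⊥U, R_t v̄⟩ / |U|`. -/
def crossCoef (p : Phase) (a : Param) : ℝ :=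
  inner ℝ (perp (rotT a.2.1 (bar p.2) - rotT a.2.2 (bar a.1))) (rotT a.2.1 (bar p.2)) /
    ‖rotT a.2.1 (bar p.2) - rotT a.2.2 (bar a.1)‖

/-- The vector `(r - r' cos φ) / |z| a + c`. -/
def gainVec2 (ω : ℝ) (q q' : R2 × R3) : Phase :=
  ((rad q - rad q' * Real.cos (phi ω q q')) / ‖zvec ω q q'‖) • dirA q + dirZ ω q q'

/-- The vector `(r' cos φ - r) d / (|z| ρ) b + e`. -/
def gainVec4 (ω : ℝ) (q q' : R2 × R3) : Phase :=
  ((rad q' * Real.cos (phi ω q q') - rad q) * dv3 q q' / (‖zvec ω q q'‖ * relSpeed ω q q')) •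
    dirB q + dirW ω q q'

/-- The vector `(r cos φ - r') / |z| a' + c`. -/
def lossVec2 (ω : ℝ) (q q' : R2 × R3) : Phase :=
  ((rad q * Real.cos (phi ω q q') - rad q') / ‖zvec ω q q'‖) • dirA q' + dirZ ω q q'

/-- The vector `(r' - r cos φ) d / (|z| ρ) b' + e`. -/
def lossVec4 (ω : ℝ) (q q' : R2 × R3) : Phase :=
  ((rad q' - rad q * Real.cos (phi ω q q')) * dv3 q q' / (‖zvec ω q q'‖ * relSpeed ω q q')) •
    dirB q' + dirW ω q q'

include hω hp ha in
-- The part outside `crossCoef` depends only on the pair `(q, q')`; `crossCoef` alone distinguishes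
-- the two preimages of that pair. The same splitting holds in the three lemmas that follow.
lemma flowL_frame1_gain :
    flowL 1 (-a.2.1) (0, frame1 (rotT a.2.1 (bar p.2) - rotT a.2.2 (bar a.1))) =
      gainVec2 ω (red p) (paramPt ω (red p) a) -
        (crossCoef p a / rad (red p)) • dirB (red p) := by
  rw [flowL_frame1 (q := red p) hp, gainVec2, dirZ, zvec_paramPt hω, norm_perp]
  have h := coef_ratio hω hp ha
  rw [show rad (paramPt ω (red p) a) = ‖bar a.1‖ from rfl, ← h, crossCoef,
    show bar (red p).2 = bar p.2 from rfl, div_div, div_div, mul_comm (rad (red p))]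

include hω hp ha in
lemma flowL_frame2_gain :
    flowL 1 (-a.2.1) (0, frame2 (rotT a.2.1 (bar p.2) - rotT a.2.2 (bar a.1)) (p.2 2 - a.1 2)) =
      gainVec4 ω (red p) (paramPt ω (red p) a) -
        (crossCoef p a / rad (red p) * ((p.2 2 - a.1 2) /
          relSpeed ω (red p) (paramPt ω (red p) a))) • dirA (red p) := by
  rw [flowL_frame2 (q := red p) hp, gainVec4, dirW, relSpeed_paramPt hω, zvec_paramPt hω,
    norm_perp]
  have h := coef_ratio hω hp ha
  have h' : ‖bar a.1‖ * Real.cos (phi ω (red p) (paramPt ω (red p) a)) - rad (red p) =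
      -(inner ℝ (rotT a.2.1 (bar p.2) - rotT a.2.2 (bar a.1)) (rotT a.2.1 (bar p.2)) /
        rad (red p)) := by rw [h]; ring
  rw [show rad (paramPt ω (red p) a) = ‖bar a.1‖ from rfl, h', crossCoef,
    show bar (red p).2 = bar p.2 from rfl, show (red p).2 = p.2 from rfl,
    show dv3 (red p) (paramPt ω (red p) a) = p.2 2 - a.1 2 from rfl]
  congr 3
  · rw [← div_div, ← div_div, ← div_div]; ring
  · rw [← div_div, ← div_div]; ring

include hω hp ha in
lemma flowL_frame1_loss :
    flowL 1 (-a.2.2) (0, frame1 (rotT a.2.1 (bar p.2) - rotT a.2.2 (bar a.1))) =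
      lossVec2 ω (red p) (paramPt ω (red p) a) -
        (crossCoef p a / ‖bar a.1‖) • dirB (paramPt ω (red p) a) := by
  rw [flowL_frame1 (q := paramPt ω (red p) a) ha, lossVec2, dirZ, zvec_paramPt hω, norm_perp]
  have h := coef_ratio' hω hp ha
  rw [show rad (paramPt ω (red p) a) = ‖bar a.1‖ from rfl, ← h, crossCoef,
    show bar (red p).2 = bar p.2 from rfl, show (paramPt ω (red p) a).2 = a.1 from rfl,
    inner_perp_self_sub, div_div, div_div, mul_comm ‖bar a.1‖]

include hω hp ha in
lemma flowL_frame2_loss :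
    flowL 1 (-a.2.2) (0, frame2 (rotT a.2.1 (bar p.2) - rotT a.2.2 (bar a.1)) (p.2 2 - a.1 2)) =
      lossVec4 ω (red p) (paramPt ω (red p) a) -
        (crossCoef p a / ‖bar a.1‖ * ((p.2 2 - a.1 2) /
          relSpeed ω (red p) (paramPt ω (red p) a))) • dirA (paramPt ω (red p) a) := by
  rw [flowL_frame2 (q := paramPt ω (red p) a) ha, lossVec4, dirW, relSpeed_paramPt hω,
    zvec_paramPt hω, norm_perp]
  have h := coef_ratio' hω hp ha
  have h' : ‖bar a.1‖ - rad (red p) * Real.cos (phi ω (red p) (paramPt ω (red p) a)) =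
      -(inner ℝ (rotT a.2.1 (bar p.2) - rotT a.2.2 (bar a.1)) (rotT a.2.2 (bar a.1)) /
        ‖bar a.1‖) := by rw [h]; ring
  rw [show rad (paramPt ω (red p) a) = ‖bar a.1‖ from rfl, h', crossCoef,
    show bar (red p).2 = bar p.2 from rfl, show (paramPt ω (red p) a).2 = a.1 from rfl,
    show (red p).2 = p.2 from rfl, inner_perp_self_sub,
    show dv3 (red p) (paramPt ω (red p) a) = p.2 2 - a.1 2 from rfl]
  congr 3
  · rw [← div_div, ← div_div, ← div_div]; ring
  · rw [← div_div, ← div_div]; ring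

include hω hf hT hp ha hU in
-- `S_lift` gives two rank-one terms. The flow carries each frame vector to the left slot, while
-- invariance of `f` moves the gradient to `p` and contracts it with the same pulled-back vector.
lemma pullKernel_gain :
    pullKernel ω (gainKernel σ f) p (paramVel a) =
      (σ (relSpeed ω (red p) (paramPt ω (red p) a)) * f (pt (paramPt ω (red p) a) (p.1 2))) •
        (tens (gainVec2 ω (red p) (paramPt ω (red p) a) -
            (crossCoef p a / rad (red p)) • dirB (red p))
          (gainVec2 ω (red p) (paramPt ω (red p) a) -
            (crossCoef p a / rad (red p)) • dirB (red p)) (gradOmega ω f p) +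
        tens (gainVec4 ω (red p) (paramPt ω (red p) a) -
          (crossCoef p a / rad (red p) * ((p.2 2 - a.1 2) /
            relSpeed ω (red p) (paramPt ω (red p) a))) • dirA (red p))
          (gainVec4 ω (red p) (paramPt ω (red p) a) -
          (crossCoef p a / rad (red p) * ((p.2 2 - a.1 2) /
            relSpeed ω (red p) (paramPt ω (red p) a))) • dirA (red p)) (gradOmega ω f p)) := by
  rw [← flowL_frame1_gain hω hp ha, ← flowL_frame2_gain hω hp ha, tens, tens,
    ← inner_gradV_flow hω hf hT, ← inner_gradV_flow hω hf hT, pullKernel, paramVel]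
  simp only [gainKernel]
  rw [flow_snd_sub, S_smul, smul_smul, flowL_inr_S hU, norm_lift,
    ← flow_invariant hω hf hT a.2.2 (pt (paramPt ω (red p) a) (p.1 2)), flow_paramPt hω,
    relSpeed_paramPt hω]
  rfl

include hω hf hT hp ha hU in
-- Unlike in the gain, the gradient sits at the second point and is pulled back by `s` instead of
-- `t`, so the right slots of the tensors carry the frame at `(x̄', v')`.
lemma pullKernel_loss :
    pullKernel ω (lossKernel σ f) p (paramVel a) =
      (σ (relSpeed ω (red p) (paramPt ω (red p) a)) * f p) •
        (tens (gainVec2 ω (red p) (paramPt ω (red p) a) -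
            (crossCoef p a / rad (red p)) • dirB (red p))
          (lossVec2 ω (red p) (paramPt ω (red p) a) -
            (crossCoef p a / ‖bar a.1‖) • dirB (paramPt ω (red p) a))
          (gradOmega ω f (pt (paramPt ω (red p) a) (p.1 2))) +
        tens (gainVec4 ω (red p) (paramPt ω (red p) a) -
          (crossCoef p a / rad (red p) * ((p.2 2 - a.1 2) /
            relSpeed ω (red p) (paramPt ω (red p) a))) • dirA (red p))
          (lossVec4 ω (red p) (paramPt ω (red p) a) -
          (crossCoef p a / ‖bar a.1‖ * ((p.2 2 - a.1 2) /
            relSpeed ω (red p) (paramPt ω (red p) a))) • dirA (paramPt ω (red p) a))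
          (gradOmega ω f (pt (paramPt ω (red p) a) (p.1 2)))) := by
  rw [← flowL_frame1_gain hω hp ha, ← flowL_frame2_gain hω hp ha, ← flowL_frame1_loss hω hp ha,
    ← flowL_frame2_loss hω hp ha, tens, tens,
    ← inner_gradV_flow hω hf hT, ← inner_gradV_flow hω hf hT, pullKernel, paramVel,
    flow_paramPt hω]
  simp only [lossKernel]
  rw [flow_snd_sub, S_smul, smul_smul, flowL_inr_S hU, norm_lift,
    flow_invariant hω hf hT a.2.1 p, relSpeed_paramPt hω]
  rfl

omit hp ha in
lemma crossCoef_reflect : crossCoef p (reflect (red p) a) = -crossCoef p a := by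
  have h1 := reflect_sub (red p) a
  have h2 := reflect_inner (red p) a
  simp only [show (red p).2 = p.2 from rfl] at h1 h2
  rw [crossCoef, crossCoef, h1, h2, neg_div]

include hω hp ha in
-- The sign ambiguity of `sin φ` is lost on squaring, so the even terms are functions of `(q, q')`.
lemma crossCoef_sq : (crossCoef p a) ^ 2 = rad (red p) ^ 2 * ‖bar a.1‖ ^ 2 *
    Real.sin (phi ω (red p) (paramPt ω (red p) a)) ^ 2 /
      ‖zvec ω (red p) (paramPt ω (red p) a)‖ ^ 2 := by
  rw [crossCoef, div_pow, zvec_paramPt hω, norm_perp, rad_mul_sin_phi_sq hω hp ha]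
  rfl

lemma relSpeed_sq (q q' : R2 × R3) : relSpeed ω q q' ^ 2 = ‖zvec ω q q'‖ ^ 2 + dv3 q q' ^ 2 :=
  Real.sq_sqrt (by positivity)

include hω hf hT hp ha hU in
-- The reflection flips `crossCoef` and nothing else, so `tens_pair` removes the cross terms and
-- `crossCoef_sq` evaluates the rest.
lemma pullKernel_gain_symm :
    pullKernel ω (gainKernel σ f) p (paramVel a) +
      pullKernel ω (gainKernel σ f) p (paramVel (reflect (red p) a)) =
    (2 : ℝ) • ((σ (relSpeed ω (red p) (paramPt ω (red p) a)) *
      f (pt (paramPt ω (red p) a) (p.1 2))) •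
        Aplus ω (red p) (paramPt ω (red p) a) (gradOmega ω f p)) := by
  have hU' : rotT (reflect (red p) a).2.1 (bar p.2) -
      rotT (reflect (red p) a).2.2 (bar (reflect (red p) a).1) ≠ 0 := by
    have := reflect_sub (red p) a
    simp only [show (red p).2 = p.2 from rfl] at this
    rwa [this]
  rw [pullKernel_gain hω hf hT hp ha hU,
    pullKernel_gain hω hf hT hp (a := reflect (red p) a) ha hU', crossCoef_reflect,
    paramPt_reflect, reflect_fst, ← smul_add, neg_div, neg_mul, tens_pair, smul_comm]
  congr 2
  have hr : rad (red p) ≠ 0 := norm_ne_zero_iff.2 hp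
  have hc := crossCoef_sq hω hp ha
  have hρ := relSpeed_sq (ω := ω) (red p) (paramPt ω (red p) a)
  have h1 : crossCoef p a / rad (red p) * (crossCoef p a / rad (red p)) =
      ‖bar a.1‖ ^ 2 * Real.sin (phi ω (red p) (paramPt ω (red p) a)) ^ 2 /
        ‖zvec ω (red p) (paramPt ω (red p) a)‖ ^ 2 := by
    rw [div_mul_div_comm, ← sq, hc]; field_simp
  have h2 : crossCoef p a / rad (red p) * ((p.2 2 - a.1 2) /
        relSpeed ω (red p) (paramPt ω (red p) a)) *
      (crossCoef p a / rad (red p) * ((p.2 2 - a.1 2) /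
        relSpeed ω (red p) (paramPt ω (red p) a))) =
      ‖bar a.1‖ ^ 2 * Real.sin (phi ω (red p) (paramPt ω (red p) a)) ^ 2 *
        (p.2 2 - a.1 2) ^ 2 / (‖zvec ω (red p) (paramPt ω (red p) a)‖ ^ 2 *
          (‖zvec ω (red p) (paramPt ω (red p) a)‖ ^ 2 + (p.2 2 - a.1 2) ^ 2)) := by
    rw [show dv3 (red p) (paramPt ω (red p) a) = p.2 2 - a.1 2 from rfl] at hρ
    rw [mul_mul_mul_comm, h1, div_mul_div_comm, ← sq, ← sq, hρ, div_mul_div_comm]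
  rw [h1, h2]
  rfl

include hω hf hT hp ha hU in
lemma pullKernel_loss_symm :
    pullKernel ω (lossKernel σ f) p (paramVel a) +
      pullKernel ω (lossKernel σ f) p (paramVel (reflect (red p) a)) =
    (2 : ℝ) • ((σ (relSpeed ω (red p) (paramPt ω (red p) a)) * f p) •
        Aminus ω (red p) (paramPt ω (red p) a)
          (gradOmega ω f (pt (paramPt ω (red p) a) (p.1 2)))) := by
  have hU' : rotT (reflect (red p) a).2.1 (bar p.2) -
      rotT (reflect (red p) a).2.2 (bar (reflect (red p) a).1) ≠ 0 := by
    have := reflect_sub (red p) a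
    simp only [show (red p).2 = p.2 from rfl] at this
    rwa [this]
  rw [pullKernel_loss hω hf hT hp ha hU,
    pullKernel_loss hω hf hT hp (a := reflect (red p) a) ha hU', crossCoef_reflect,
    paramPt_reflect, reflect_fst, ← smul_add, neg_div, neg_div, neg_mul, neg_mul, tens_pair,
    smul_comm]
  congr 2
  have hr : rad (red p) ≠ 0 := norm_ne_zero_iff.2 hp
  have hr' : ‖bar a.1‖ ≠ 0 := norm_ne_zero_iff.2 ha
  have hc := crossCoef_sq hω hp ha
  have hρ := relSpeed_sq (ω := ω) (red p) (paramPt ω (red p) a)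
  have h1 : crossCoef p a / rad (red p) * (crossCoef p a / ‖bar a.1‖) =
      rad (red p) * ‖bar a.1‖ * Real.sin (phi ω (red p) (paramPt ω (red p) a)) ^ 2 /
        ‖zvec ω (red p) (paramPt ω (red p) a)‖ ^ 2 := by
    rw [div_mul_div_comm, ← sq, hc]; field_simp
  have h2 : crossCoef p a / rad (red p) * ((p.2 2 - a.1 2) /
        relSpeed ω (red p) (paramPt ω (red p) a)) *
      (crossCoef p a / ‖bar a.1‖ * ((p.2 2 - a.1 2) /
        relSpeed ω (red p) (paramPt ω (red p) a))) =
      rad (red p) * ‖bar a.1‖ * Real.sin (phi ω (red p) (paramPt ω (red p) a)) ^ 2 *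
        (p.2 2 - a.1 2) ^ 2 / (‖zvec ω (red p) (paramPt ω (red p) a)‖ ^ 2 *
          (‖zvec ω (red p) (paramPt ω (red p) a)‖ ^ 2 + (p.2 2 - a.1 2) ^ 2)) := by
    rw [show dv3 (red p) (paramPt ω (red p) a) = p.2 2 - a.1 2 from rfl] at hρ
    rw [mul_mul_mul_comm, h1, div_mul_div_comm, ← sq, ← sq, hρ, div_mul_div_comm]
  rw [h1, h2]
  rfl

end

/-! ### Measurability of the coefficients -/

lemma continuous_pt (x3 : ℝ) : Continuous fun q : R2 × R3 => pt q x3 := by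
  unfold pt; fun_prop

lemma continuous_gradV {f : Phase → ℝ} (hf : ContDiff ℝ 1 f) : Continuous (gradV f) := by
  refine (PiLp.continuous_toLp 2 _).comp (continuous_pi (X := Phase) (f := fun p i => gradV f p i)
    fun i => ?_)
  simp only [gradV_apply (hf.differentiable (by norm_num)), dV]
  have := hf.continuous_fderiv (by norm_num)
  fun_prop

lemma continuous_gradX {f : Phase → ℝ} (hf : ContDiff ℝ 1 f) : Continuous (gradX f) := by
  refine (PiLp.continuous_toLp 2 _).comp (continuous_pi (X := Phase) (f := fun p i => gradX f p i)
    fun i => ?_)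
  have h : ∀ p, gradX f p i = fderiv ℝ f p (EuclideanSpace.single i 1, 0) := fun p => by
    rw [← inner_gradX (hf.differentiable (by norm_num)), EuclideanSpace.inner_single_right]
    simp
  simp only [h]
  have := hf.continuous_fderiv (by norm_num)
  fun_prop

lemma continuous_gradOmega {f : Phase → ℝ} (hf : ContDiff ℝ 1 f) (ω : ℝ) :
    Continuous (gradOmega ω f) := by
  have h1 := continuous_gradX hf
  have h2 := continuous_gradV hf
  unfold gradOmega
  fun_prop

lemma Measurable.smulPhase {X : Type*} [MeasurableSpace X] {c : X → ℝ} {a : X → Phase}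
    (hc : Measurable c) (ha : Measurable a) : Measurable fun x => c x • a x := hc.smul ha

lemma measurable_tens {X : Type*} [MeasurableSpace X] {a b y : X → Phase} (ha : Measurable a)
    (hb : Measurable b) (hy : Measurable y) : Measurable fun x => tens (a x) (b x) (y x) := by
  unfold tens dot
  exact ((Measurable.inner (𝕜 := ℝ) hb.fst hy.fst).add
    (Measurable.inner (𝕜 := ℝ) hb.snd hy.snd)).smul ha

@[fun_prop] lemma continuous_dv3 (q : R2 × R3) : Continuous (dv3 q) := by
  unfold dv3; fun_prop

@[fun_prop] lemma continuous_relSpeed (ω : ℝ) (q : R2 × R3) : Continuous (relSpeed ω q) := by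
  unfold relSpeed; fun_prop

@[fun_prop] lemma measurable_phi (ω : ℝ) (q : R2 × R3) : Measurable (phi ω q) := by
  unfold phi angle
  have h : Measurable fun q' => (rad q ^ 2 + rad q' ^ 2 - ‖zvec ω q q'‖ ^ 2) /
      (2 * rad q * rad q') := by
    have h1 : Measurable rad := continuous_rad.measurable
    have h2 : Measurable fun q' => ‖zvec ω q q'‖ := Continuous.measurable (by fun_prop)
    fun_prop
  exact Real.continuous_arccos.measurable.comp h

@[fun_prop] lemma measurable_rad : Measurable rad := continuous_rad.measurable

@[fun_prop] lemma measurable_dirA : Measurable dirA := by unfold dirA; fun_prop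

@[fun_prop] lemma measurable_dirB : Measurable dirB := by unfold dirB; fun_prop

@[fun_prop] lemma measurable_zvec (ω : ℝ) (q : R2 × R3) : Measurable (zvec ω q) :=
  Continuous.measurable (by fun_prop)

@[fun_prop] lemma measurable_dv3 (q : R2 × R3) : Measurable (dv3 q) := (continuous_dv3 q).measurable

@[fun_prop] lemma measurable_relSpeed (ω : ℝ) (q : R2 × R3) : Measurable (relSpeed ω q) :=
  (continuous_relSpeed ω q).measurable

@[fun_prop] lemma measurable_dirZ (ω : ℝ) (q : R2 × R3) : Measurable (dirZ ω q) := by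
  unfold dirZ; fun_prop

@[fun_prop] lemma measurable_dirW (ω : ℝ) (q : R2 × R3) : Measurable (dirW ω q) := by
  unfold dirW; fun_prop

lemma measurable_Aplus (ω : ℝ) (q : R2 × R3) {y : R2 × R3 → Phase} (hy : Measurable y) :
    Measurable fun q' => Aplus ω q q' (y q') := by
  simp only [Aplus]
  refine Measurable.add (Measurable.add (Measurable.add ?_ ?_) ?_) ?_
  · refine Measurable.smulPhase ?_ (measurable_tens ?_ ?_ hy) <;> fun_prop
  · refine measurable_tens ?_ ?_ hy <;> fun_prop
  · refine Measurable.smulPhase ?_ (measurable_tens ?_ ?_ hy) <;> fun_prop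
  · refine measurable_tens ?_ ?_ hy <;> fun_prop

lemma measurable_Aminus (ω : ℝ) (q : R2 × R3) {y : R2 × R3 → Phase} (hy : Measurable y) :
    Measurable fun q' => Aminus ω q q' (y q') := by
  simp only [Aminus]
  refine Measurable.add (Measurable.add (Measurable.add ?_ ?_) ?_) ?_
  · refine Measurable.smulPhase ?_ (measurable_tens ?_ ?_ hy) <;> fun_prop
  · refine measurable_tens ?_ ?_ hy <;> fun_prop
  · refine Measurable.smulPhase ?_ (measurable_tens ?_ ?_ hy) <;> fun_prop
  · refine measurable_tens ?_ ?_ hy <;> fun_prop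

/-! ### Transfer of integrals -/

lemma measurePreserving_relVel (v : R3) :
    MeasurePreserving (fun y : Torus × R3 => (y.1, rot3 y.1 v - y.2))
      (haarT.prod volume) (haarT.prod volume) := by
  refine (MeasurePreserving.id haarT).skew_product (g := fun t w => rot3 t v - w)
    (Continuous.measurable (by fun_prop)) (Filter.Eventually.of_forall fun t => ?_)
  exact (Measure.measurePreserving_sub_left volume (rot3 t v)).map_eq

/-- The difference `U` is the horizontal part of `R_t v - w` with `w = R_s v'`; in the variables
`(t, w)` this vector is Lebesgue distributed for each `t`, hence almost surely not vertical. -/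
lemma ae_param (q : R2 × R3) : ∀ᵐ a : Param ∂paramMeasure,
    bar a.1 ≠ 0 ∧ rotT a.2.1 (bar q.2) - rotT a.2.2 (bar a.1) ≠ 0 := by
  have h1 : ∀ᵐ a : Param ∂paramMeasure, bar a.1 ≠ 0 :=
    Measure.quasiMeasurePreserving_fst.ae ae_bar_ne_zero
  have h3 : ∀ᵐ y : Torus × R3 ∂(haarT.prod volume), bar (rot3 y.1 q.2 - y.2) ≠ 0 := by
    exact (Measure.quasiMeasurePreserving_snd.comp
      (measurePreserving_relVel q.2).quasiMeasurePreserving).ae ae_bar_ne_zero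
  have h4 := measurePreserving_paramVel.quasiMeasurePreserving.ae h3
  filter_upwards [h1, h4] with a ha1 ha2
  refine ⟨ha1, ?_⟩
  simpa [paramVel, bar_sub] using ha2

/-- The integrand is not a function of `paramPt`, but its mean with its reflection is. The
reflection preserves the measure, so the mean has the same integral, and `map_paramPt` turns it into
an integral over `(x̄', v')`. -/
theorem transfer_paramPt {ω : ℝ} (hω : ω ≠ 0) {q : R2 × R3} (hq : bar q.2 ≠ 0)
    {k : Torus × R3 → Phase} {E : R2 × R3 → Phase} (hE : Measurable E)
    (hk : Integrable k (haarT.prod volume))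
    (h : ∀ᵐ a ∂paramMeasure, k (paramVel a) + k (paramVel (reflect q a)) =
      (2 : ℝ) • E (paramPt ω q a)) :
    Integrable (fun q' => chi (rad q) (rad q') (zvec ω q q') • E q') ∧
      ω ^ 2 • ∫ q', chi (rad q) (rad q') (zvec ω q q') • E q' =
        ∫ y, k y ∂(haarT.prod volume) := by
  have hmeas := (continuous_paramPt ω q).measurable
  have hχ := measurable_chi ω q
  have hk1 : Integrable (fun a => k (paramVel a)) paramMeasure :=
    measurePreserving_paramVel.integrable_comp_of_integrable hk
  have hk2 : Integrable (fun a => k (paramVel (reflect q a))) paramMeasure :=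
    (measurePreserving_reflect q).integrable_comp_of_integrable hk1
  have e1 : ∫ a, k (paramVel a) ∂paramMeasure = ∫ y, k y ∂(haarT.prod volume) := by
    rw [← measurePreserving_paramVel.map_eq,
      integral_map continuous_paramVel.aemeasurable]
    rw [measurePreserving_paramVel.map_eq]; exact hk.1
  have e2 : ∫ a, k (paramVel (reflect q a)) ∂paramMeasure =
      ∫ a, k (paramVel a) ∂paramMeasure := by
    conv_rhs => rw [← (measurePreserving_reflect q).map_eq]
    rw [integral_map (measurePreserving_reflect q).measurable.aemeasurable]
    rw [(measurePreserving_reflect q).map_eq]; exact hk1.1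
  have hE1 : (fun a => E (paramPt ω q a)) =ᵐ[paramMeasure]
      fun a => (2 : ℝ)⁻¹ • (k (paramVel a) + k (paramVel (reflect q a))) := by
    filter_upwards [h] with a ha
    rw [ha, smul_smul, inv_mul_cancel₀ two_ne_zero, one_smul]
  have hEi : Integrable (fun a => E (paramPt ω q a)) paramMeasure :=
    ((hk1.add hk2).smul (2 : ℝ)⁻¹).congr hE1.symm
  have hEint : ∫ a, E (paramPt ω q a) ∂paramMeasure = ∫ y, k y ∂(haarT.prod volume) := by
    rw [integral_congr_ae hE1, integral_smul, integral_add hk1 hk2, e2, e1, ← two_smul ℝ, smul_smul,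
      inv_mul_cancel₀ two_ne_zero, one_smul]
  have hdm : Measurable fun q' => ENNReal.ofReal (ω ^ 2 * chi (rad q) (rad q') (zvec ω q q')) := by
    fun_prop
  have hlt : ∀ᵐ q' : R2 × R3,
      ENNReal.ofReal (ω ^ 2 * chi (rad q) (rad q') (zvec ω q q')) < ⊤ :=
    Filter.Eventually.of_forall fun _ => ENNReal.ofReal_lt_top
  have htoReal : ∀ q', (ENNReal.ofReal (ω ^ 2 * chi (rad q) (rad q') (zvec ω q q'))).toReal =
      ω ^ 2 * chi (rad q) (rad q') (zvec ω q q') := fun q' =>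
    ENNReal.toReal_ofReal (mul_nonneg (sq_nonneg _) (chi_nonneg _ _ _))
  have hmap : Integrable E (Measure.map (paramPt ω q) paramMeasure) :=
    (integrable_map_measure hE.aestronglyMeasurable hmeas.aemeasurable).2 hEi
  have hmapint : ∫ q', E q' ∂(Measure.map (paramPt ω q) paramMeasure) =
      ∫ a, E (paramPt ω q a) ∂paramMeasure :=
    integral_map hmeas.aemeasurable hE.aestronglyMeasurable
  rw [map_paramPt hω hq] at hmap hmapint
  rw [integrable_withDensity_iff_integrable_smul' hdm hlt] at hmap
  rw [integral_withDensity_eq_integral_toReal_smul hdm hlt, hEint] at hmapint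
  simp only [htoReal, mul_smul] at hmap hmapint
  refine ⟨?_, ?_⟩
  · have := hmap.smul (ω ^ 2)⁻¹
    refine this.congr (Filter.Eventually.of_forall fun q' => ?_)
    simp only [Pi.smul_apply, smul_smul]
    rw [← mul_assoc, inv_mul_cancel₀ (pow_ne_zero 2 hω), one_mul]
  · rw [← hmapint, integral_smul]

/-! ### Integrability of the pulled-back kernels -/

lemma norm_S_le (w y : R3) : ‖S w y‖ ≤ 2 * ‖y‖ := by
  rw [S]
  refine (norm_sub_le _ _).trans ?_
  have h : ‖(inner ℝ w y / ‖w‖ ^ 2) • w‖ ≤ ‖y‖ := by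
    rcases eq_or_ne w 0 with rfl | hw
    · simp
    have hw' : 0 < ‖w‖ := norm_pos_iff.2 hw
    rw [norm_smul, norm_div, Real.norm_eq_abs, norm_pow, norm_norm, div_mul_eq_mul_div,
      div_le_iff₀ (by positivity)]
    calc |inner ℝ w y| * ‖w‖ ≤ (‖w‖ * ‖y‖) * ‖w‖ := by
          gcongr; exact abs_real_inner_le_norm w y
      _ = ‖y‖ * ‖w‖ ^ 2 := by ring
  linarith

lemma exists_bound_torus {E : Type*} [NormedAddCommGroup E] {g : Torus → E} (hg : Continuous g) :
    ∃ C, ∀ t, ‖g t‖ ≤ C := by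
  obtain ⟨C, hC⟩ := isCompact_univ.exists_bound_of_continuousOn hg.continuousOn
  exact ⟨C, fun t => hC t trivial⟩

lemma measurable_S {X : Type*} [MeasurableSpace X] {w y : X → R3} (hw : Measurable w)
    (hy : Measurable y) : Measurable fun x => S (w x) (y x) := by
  unfold S
  exact hy.sub (((Measurable.inner (𝕜 := ℝ) hw hy).div (hw.norm.pow_const 2)).smul hw)

/-- In the relative velocity `R_t v - w` the kernel no longer depends on `t`; the decay of `Y` in
`w` pays for its growth, and the pulled-back frames are bounded because the circle is compact. -/
lemma integrable_pullKernel {N : ℕ} {σ : ℝ → ℝ} (hσ : ModerateCross N σ) {ω : ℝ}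
    {Y : Phase → R3 → R3} (hY : Continuous fun x : Phase × R3 => Y x.1 x.2) (p : Phase) {C : ℝ}
    (hC : ∀ t w, (1 + ‖w‖) ^ N * ‖Y (flow ω t p) w‖ ≤ C) :
    Integrable (pullKernel ω (fun p w => σ ‖p.2 - w‖ • S (p.2 - w) (Y p w)) p)
      (haarT.prod volume) := by
  have hC0 : 0 ≤ C := le_trans (by positivity) (hC 0 0)
  obtain ⟨B, hB⟩ := exists_bound_torus (g := fun t => flowL 1 (-t)) (by fun_prop)
  have hB0 : 0 ≤ B := (norm_nonneg _).trans (hB 0)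
  have hdom : Integrable (fun y : Torus × R3 =>
      |σ ‖rot3 y.1 p.2 - y.2‖| / (1 + ‖rot3 y.1 p.2 - y.2‖) ^ N) (haarT.prod volume) := by
    have h1 : Integrable (fun y : Torus × R3 => |σ ‖y.2‖| / (1 + ‖y.2‖) ^ N)
        (haarT.prod volume) := hσ.2.comp_snd haarT
    exact (measurePreserving_relVel p.2).integrable_comp_of_integrable h1
  refine (hdom.const_mul (B * (2 * (C * (1 + ‖p.2‖) ^ N)))).mono' ?_
    (Filter.Eventually.of_forall fun y => ?_)
  · have hrel : Measurable fun y : Torus × R3 => (flow ω y.1 p).2 - y.2 :=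
      Continuous.measurable (by fun_prop)
    have hYm : Measurable fun y : Torus × R3 => Y (flow ω y.1 p) y.2 :=
      Continuous.measurable (hY.comp (by fun_prop : Continuous fun y : Torus × R3 =>
        ((flow ω y.1 p, y.2) : Phase × R3)))
    have hker : Measurable fun y : Torus × R3 => σ ‖(flow ω y.1 p).2 - y.2‖ •
        S ((flow ω y.1 p).2 - y.2) (Y (flow ω y.1 p) y.2) :=
      (hσ.1.comp hrel.norm).smul (measurable_S hrel hYm)
    have hfl : Continuous fun x : Torus × R3 => flowL 1 (-x.1) (0, x.2) := by
      simp only [flowL_apply]; fun_prop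
    exact (hfl.measurable.comp (measurable_fst.prodMk hker)).aestronglyMeasurable
  · have h1 : ‖σ ‖(flow ω y.1 p).2 - y.2‖ • Y (flow ω y.1 p) y.2‖ ≤ C * (1 + ‖p.2‖) ^ N *
        (|σ ‖rot3 y.1 p.2 - y.2‖| / (1 + ‖rot3 y.1 p.2 - y.2‖) ^ N) := by
      have := norm_smul_le_of_weight (c := σ ‖(flow ω y.1 p).2 - y.2‖) (v := rot3 y.1 p.2)
        (w := rot3 y.1 p.2 - y.2) (N := N) (C := C) (a := Y (flow ω y.1 p) y.2)
        (by rw [sub_sub_cancel]; exact hC y.1 y.2)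
      rwa [norm_rot3] at this
    rw [pullKernel]
    refine ((flowL 1 (-y.1)).le_opNorm _).trans ?_
    have h2 : ‖((0, σ ‖(flow ω y.1 p).2 - y.2‖ •
        S ((flow ω y.1 p).2 - y.2) (Y (flow ω y.1 p) y.2)) : Phase)‖ ≤
        2 * (C * (1 + ‖p.2‖) ^ N *
        (|σ ‖rot3 y.1 p.2 - y.2‖| / (1 + ‖rot3 y.1 p.2 - y.2‖) ^ N)) := by
      rw [Prod.norm_def, norm_zero, max_eq_right (norm_nonneg _), ← S_smul]
      exact (norm_S_le _ _).trans (by gcongr)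
    calc _ ≤ B * (2 * (C * (1 + ‖p.2‖) ^ N *
        (|σ ‖rot3 y.1 p.2 - y.2‖| / (1 + ‖rot3 y.1 p.2 - y.2‖) ^ N))) := by
          gcongr; exact hB _
      _ = _ := by ring

lemma norm_gradV_le {f : Phase → ℝ} (hf : Differentiable ℝ f) (p : Phase) :
    ‖gradV f p‖ ≤ ‖fderiv ℝ f p‖ := by
  rcases eq_or_ne (gradV f p) 0 with h | h
  · rw [h, norm_zero]; exact norm_nonneg _
  have h1 := inner_gradV hf p (gradV f p)
  rw [real_inner_self_eq_norm_sq] at h1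
  have h2 : ‖fderiv ℝ f p (0, gradV f p)‖ ≤ ‖fderiv ℝ f p‖ * ‖gradV f p‖ := by
    refine ((fderiv ℝ f p).le_opNorm _).trans_eq ?_
    rw [Prod.norm_def, norm_zero, max_eq_right (norm_nonneg _)]
  rw [← h1, norm_pow, norm_norm, sq] at h2
  exact le_of_mul_le_mul_right h2 (norm_pos_iff.2 h)

section

variable {N : ℕ} {σ : ℝ → ℝ} (hσ : ModerateCross N σ) {f : Phase → ℝ} (hf : Regular f)
include hσ hf

lemma integrable_pullKernel_gain (ω : ℝ) (p : Phase) :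
    Integrable (pullKernel ω (gainKernel σ f) p) (haarT.prod volume) := by
  have hg := continuous_gradV (hf.contDiff.of_le (by norm_num))
  have hfc := hf.contDiff.continuous
  obtain ⟨R, hR⟩ := exists_bound_torus (g := fun t => (flow ω t p).1) (by fun_prop)
  obtain ⟨C, hC⟩ := hf.decay.2 N R
  obtain ⟨C', hC'⟩ := hf.decay_fderiv.2 0 R
  have hC0 : 0 ≤ C := le_trans (by positivity) (hC _ 0 (hR 0))
  refine integrable_pullKernel (C := C * C') hσ (Y := fun p w => f (p.1, w) • gradV f p)
    (by fun_prop) p fun t w => ?_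
  rw [norm_smul, ← mul_assoc]
  have h2 := hC' _ (flow ω t p).2 (hR t)
  rw [pow_zero, one_mul] at h2
  exact mul_le_mul (hC _ w (hR t)) ((norm_gradV_le hf.differentiable _).trans h2)
    (norm_nonneg _) hC0

lemma integrable_pullKernel_loss (ω : ℝ) (p : Phase) :
    Integrable (pullKernel ω (lossKernel σ f) p) (haarT.prod volume) := by
  have hg := continuous_gradV (hf.contDiff.of_le (by norm_num))
  have hfc := hf.contDiff.continuous
  obtain ⟨R, hR⟩ := exists_bound_torus (g := fun t => (flow ω t p).1) (by fun_prop)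
  obtain ⟨C, hC⟩ := hf.decay_fderiv.2 N R
  obtain ⟨C', hC'⟩ := hf.decay.2 0 R
  have hC0 : 0 ≤ C := le_trans (by positivity) (hC _ 0 (hR 0))
  refine integrable_pullKernel (C := C' * C) hσ (Y := fun p w => f p • gradV f (p.1, w))
    (by fun_prop) p fun t w => ?_
  rw [norm_smul, mul_left_comm]
  have h2 := hC' _ (flow ω t p).2 (hR t)
  rw [pow_zero, one_mul] at h2
  refine mul_le_mul h2 (le_trans ?_ (hC _ w (hR t))) (by positivity)
    ((norm_nonneg _).trans h2)
  gcongr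
  exact norm_gradV_le hf.differentiable _

end

/-! ### Averaged fluxes -/

/-- The average over the circle of the pulled-back velocity field. -/
def avgFlux (ω : ℝ) (F : Phase → R3) (p : Phase) : Phase := ∫ t, pullBack ω F t p ∂haarT

lemma integral_pullKernel (ω : ℝ) {K : Phase → R3 → R3} (hK : ∀ p, Integrable (K p)) (p : Phase)
    (hi : Integrable (pullKernel ω K p) (haarT.prod volume)) :
    ∫ y, pullKernel ω K p y ∂(haarT.prod volume) = avgFlux ω (velFlux K) p := by
  rw [integral_prod _ hi, avgFlux]
  refine integral_congr_ae (Filter.Eventually.of_forall fun t => ?_)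
  simp only [pullKernel, pullBack, velFlux]
  have := ((flowL 1 (-t)).comp (ContinuousLinearMap.inr ℝ R3 R3)).integral_comp_comm
    (hK (flow ω t p))
  simpa using this

/-- `trP` as a continuous linear form. -/
def trPL : (Phase →L[ℝ] Phase) →L[ℝ] ℝ where
  toFun := trP
  map_add' := fun A B => by
    simp only [trP, add_apply, Prod.fst_add, Prod.snd_add, PiLp.add_apply,
      Finset.sum_add_distrib]; ring
  map_smul' := fun c A => by
    simp only [trP, smul_apply, Prod.smul_fst, Prod.smul_snd, PiLp.smul_apply,
      smul_eq_mul, ← Finset.mul_sum, RingHom.id_apply]; ring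
  cont := continuous_trP

lemma continuous_pullBackDeriv (ω : ℝ) {F : Phase → R3} (hF : ContDiff ℝ 1 F) :
    Continuous fun x : Torus × Phase => pullBackDeriv ω F x.1 x.2 := by
  have h1 := hF.continuous_fderiv (by norm_num)
  unfold pullBackDeriv
  have h2 : Continuous fun x : Torus × Phase => fderiv ℝ F (flow ω x.1 x.2) :=
    h1.comp (by fun_prop)
  fun_prop

lemma continuous_pullBack (ω : ℝ) {F : Phase → R3} (hF : Continuous F) (p : Phase) :
    Continuous fun t : Torus => pullBack ω F t p := by
  unfold pullBack
  simp only [flowL_apply]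
  fun_prop

lemma integrable_torus {E : Type*} [NormedAddCommGroup E] {g : Torus → E}
    (hg : Continuous g) : Integrable g haarT :=
  hg.integrable_of_hasCompactSupport (HasCompactSupport.of_compactSpace _)

lemma hasFDerivAt_avgFlux (ω : ℝ) {F : Phase → R3} (hF : ContDiff ℝ 1 F) (p : Phase) :
    HasFDerivAt (avgFlux ω F) (∫ t, pullBackDeriv ω F t p ∂haarT) p := by
  have hc := continuous_pullBackDeriv ω hF
  obtain ⟨C, hC⟩ := ((isCompact_univ (X := Torus)).prod
    (isCompact_closedBall p 1)).exists_bound_of_continuousOn hc.continuousOn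
  refine hasFDerivAt_integral_of_dominated_of_fderiv_le (F' := fun q t => pullBackDeriv ω F t q)
    (bound := fun _ => C) (Metric.closedBall_mem_nhds p one_pos) ?_ ?_ ?_ ?_ ?_ ?_
  · exact Filter.Eventually.of_forall fun q =>
      (continuous_pullBack ω hF.continuous q).aestronglyMeasurable
  · exact integrable_torus (continuous_pullBack ω hF.continuous p)
  · exact (hc.comp (by fun_prop : Continuous fun t : Torus => (t, p))).aestronglyMeasurable
  · exact Filter.Eventually.of_forall fun t q hq => hC (t, q) ⟨trivial, hq⟩
  · exact integrable_const C
  · exact Filter.Eventually.of_forall fun t q _ =>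
      hasFDerivAt_pullBack (hF.differentiable (by norm_num)) t q

/-- Differentiation under the circle integral, after which the trace, being linear and continuous,
is taken inside and evaluated by `trP_pullBackDeriv`. -/
lemma divOmega_avgFlux {ω : ℝ} (hω : ω ≠ 0) {F : Phase → R3} (hF : ContDiff ℝ 1 F) (p : Phase) :
    divOmega ω (avgFlux ω F) p = gyroAverage ω (divV F) p := by
  have hc : Continuous fun t : Torus => pullBackDeriv ω F t p :=
    Continuous.comp (g := fun x : Torus × Phase => pullBackDeriv ω F x.1 x.2)
      (f := fun t => (t, p)) (continuous_pullBackDeriv ω hF) (by fun_prop)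
  rw [divOmega_eq_trP, (hasFDerivAt_avgFlux ω hF p).fderiv, gyroAverage_eq_integral hω]
  have h1 : ∫ t, (dilL ω).comp (pullBackDeriv ω F t p) ∂haarT =
      (dilL ω).comp (∫ t, pullBackDeriv ω F t p ∂haarT) :=
    (ContinuousLinearMap.compL ℝ Phase Phase Phase (dilL ω)).integral_comp_comm
      (integrable_torus hc)
  have hc2 : Continuous fun t : Torus => (dilL ω).comp (pullBackDeriv ω F t p) := by fun_prop
  have h2 : ∫ t, trPL ((dilL ω).comp (pullBackDeriv ω F t p)) ∂haarT =
      trPL (∫ t, (dilL ω).comp (pullBackDeriv ω F t p) ∂haarT) :=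
    trPL.integral_comp_comm (integrable_torus hc2)
  rw [← h1]
  refine Eq.trans h2.symm (integral_congr_ae (Filter.Eventually.of_forall fun t => ?_))
  exact trP_pullBackDeriv (hF.differentiable (by norm_num)) t p

/-- The flux identity holds only where `v̄ ≠ 0`, but this set is open, so differentiability and
derivatives carry over. -/
lemma divergence_of_flux_eq {ω : ℝ} (hω : ω ≠ 0) {F : Phase → R3} (hF : ContDiff ℝ 1 F)
    {G : Phase → Phase} (hG : ∀ p, bar p.2 ≠ 0 → ω ^ 2 • G p = avgFlux ω F p)
    {p : Phase} (hp : bar p.2 ≠ 0) :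
    DifferentiableAt ℝ G p ∧
      gyroAverage ω (divV F) p = divOmega ω (fun p' => ω ^ 2 • G p') p := by
  have hopen : ∀ᶠ p' in nhds p, bar p'.2 ≠ 0 :=
    (isOpen_ne.preimage (by fun_prop : Continuous fun p' : Phase => bar p'.2)).mem_nhds hp
  have hd := hasFDerivAt_avgFlux ω hF p
  have he : (fun p' => ω ^ 2 • G p') =ᶠ[nhds p] avgFlux ω F := hopen.mono fun p' hp' => hG p' hp'
  refine ⟨?_, ?_⟩
  · have h1 : G =ᶠ[nhds p] fun p' => (ω ^ 2)⁻¹ • avgFlux ω F p' := hopen.mono fun p' hp' => by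
      simp only
      rw [← hG p' hp', smul_smul, inv_mul_cancel₀ (pow_ne_zero 2 hω), one_smul]
    exact DifferentiableAt.congr_of_eventuallyEq
      (hd.differentiableAt.const_smul (ω ^ 2)⁻¹) h1
  · rw [← divOmega_avgFlux hω hF, divOmega_eq_trP, divOmega_eq_trP, he.fderiv_eq]

section

variable {ω : ℝ} (hω : ω ≠ 0) {N : ℕ} {σ : ℝ → ℝ} (hσ : ModerateCross N σ) {f : Phase → ℝ}
  (hf : Regular f) (hT : ∀ p, transport ω f p = 0)
include hω hσ hf hT

lemma gainA_flux {p : Phase} (hp : bar p.2 ≠ 0) : Integrable (gainA ω σ f p) ∧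
    ω ^ 2 • phaseFlux (gainA ω σ f) p = avgFlux ω (velFlux (gainKernel σ f)) p := by
  have hE : Measurable fun q' => (σ (relSpeed ω (red p) q') * f (pt q' (p.1 2))) •
      Aplus ω (red p) q' (gradOmega ω f p) := by
    refine Measurable.smulPhase ?_ (measurable_Aplus ω (red p) measurable_const)
    exact (hσ.1.comp (measurable_relSpeed ω _)).mul
      (hf.contDiff.continuous.comp (continuous_pt _)).measurable
  have hi := integrable_pullKernel_gain hσ hf ω p
  obtain ⟨h1, h2⟩ := transfer_paramPt hω (q := red p) hp hE hi (by
    filter_upwards [ae_param (red p)] with a ha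
    exact pullKernel_gain_symm hω hf.differentiable hT hp ha.1 ha.2)
  have h3 : gainA ω σ f p = fun q' => chi (rad (red p)) (rad q') (zvec ω (red p) q') •
      ((σ (relSpeed ω (red p) q') * f (pt q' (p.1 2))) •
        Aplus ω (red p) q' (gradOmega ω f p)) := by
    funext q'
    rw [gainA, sigmaChi, smul_smul]
    congr 1
    ring
  refine ⟨h3 ▸ h1, ?_⟩
  rw [phaseFlux, h3, h2, integral_pullKernel ω (integrable_gainKernel hσ hf) p hi]

lemma lossA_flux {p : Phase} (hp : bar p.2 ≠ 0) : Integrable (lossA ω σ f p) ∧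
    ω ^ 2 • phaseFlux (lossA ω σ f) p = avgFlux ω (velFlux (lossKernel σ f)) p := by
  have hE : Measurable fun q' => (σ (relSpeed ω (red p) q') * f p) •
      Aminus ω (red p) q' (gradOmega ω f (pt q' (p.1 2))) := by
    refine Measurable.smulPhase ?_ (measurable_Aminus ω (red p) ?_)
    · exact (hσ.1.comp (measurable_relSpeed ω _)).mul_const _
    · exact ((continuous_gradOmega (hf.contDiff.of_le (by norm_num)) ω).comp
        (continuous_pt _)).measurable
  have hi := integrable_pullKernel_loss hσ hf ω p
  obtain ⟨h1, h2⟩ := transfer_paramPt hω (q := red p) hp hE hi (by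
    filter_upwards [ae_param (red p)] with a ha
    exact pullKernel_loss_symm hω hf.differentiable hT hp ha.1 ha.2)
  have h3 : lossA ω σ f p = fun q' => chi (rad (red p)) (rad q') (zvec ω (red p) q') •
      ((σ (relSpeed ω (red p) q') * f p) •
        Aminus ω (red p) q' (gradOmega ω f (pt q' (p.1 2)))) := by
    funext q'
    rw [lossA, sigmaChi, smul_smul]
    congr 1
    ring
  refine ⟨h3 ▸ h1, ?_⟩
  rw [phaseFlux, h3, h2, integral_pullKernel ω (integrable_lossKernel hσ hf) p hi]

end

/-! ### The form with the fields `ξⁱ` -/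

lemma zvec_swap (ω : ℝ) (q q' : R2 × R3) : zvec ω q' q = -zvec ω q q' := by
  rw [zvec, zvec, neg_sub]

lemma dv3_swap (q q' : R2 × R3) : dv3 q' q = -dv3 q q' := by rw [dv3, dv3, neg_sub]

lemma relSpeed_swap (ω : ℝ) (q q' : R2 × R3) : relSpeed ω q' q = relSpeed ω q q' := by
  rw [relSpeed, relSpeed, zvec_swap, dv3_swap, norm_neg, neg_sq]

lemma phi_swap (ω : ℝ) (q q' : R2 × R3) : phi ω q' q = phi ω q q' := by
  rw [phi, phi, angle, angle, zvec_swap, norm_neg, add_comm (rad q' ^ 2), mul_right_comm]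

lemma sigmaChi_swap (ω : ℝ) (σ : ℝ → ℝ) (q q' : R2 × R3) :
    sigmaChi ω σ q' q = sigmaChi ω σ q q' := by
  rw [sigmaChi, sigmaChi, relSpeed_swap, zvec_swap, chi_eq_chiRad, chi_eq_chiRad, norm_neg,
    chiRad, chiRad, abs_sub_comm, add_comm (rad q'), show (rad q' - rad q) ^ 2 =
      (rad q - rad q') ^ 2 by ring]

lemma dirZ_swap (ω : ℝ) (q q' : R2 × R3) : dirZ ω q' q = -dirZ ω q q' := by
  rw [dirZ, dirZ, zvec_swap, norm_neg]
  refine Phase.ext ?_ ?_ ?_ ?_ ?_ ?_ <;> simp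

lemma dirW_swap (ω : ℝ) (q q' : R2 × R3) : dirW ω q' q = dirW ω q q' := by
  rw [dirW, dirW, zvec_swap, norm_neg, relSpeed_swap, dv3_swap]
  refine Phase.ext ?_ ?_ ?_ ?_ ?_ ?_ <;> simp

lemma tens_smul_smul (c c' : ℝ) (a b y : Phase) :
    tens (c • a) (c' • b) y = (c * c') • tens a b y := by
  simp only [tens, dot_smul_left]; module

lemma tens_smul_right (c : ℝ) (a b y : Phase) : tens a (c • b) y = c • tens a b y := by
  simp only [tens, dot_smul_left]; module

lemma sigmaChi_nonneg {ω : ℝ} {σ : ℝ → ℝ} (hσ0 : ∀ ρ : ℝ, 0 < ρ → 0 ≤ σ ρ) (q q' : R2 × R3) :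
    0 ≤ sigmaChi ω σ q q' := by
  rw [sigmaChi, chi]
  split_ifs with h
  · have hz : 0 < ‖zvec ω q q'‖ := (abs_nonneg _).trans_lt h.1
    exact mul_nonneg (hσ0 _ (Real.sqrt_pos.2 (by positivity))) (by positivity)
  · simp

section

variable {ω : ℝ} {σ : ℝ → ℝ} (hσ0 : ∀ ρ : ℝ, 0 < ρ → 0 ≤ σ ρ)
include hσ0

/-- As `σ χ ≥ 0`, the two square roots multiply back to `σ χ`, and `A⁺` is already a sum of squares.
-/
lemma gainXi_eq_gainA (f : Phase → ℝ) : gainXi ω σ f = gainA ω σ f := by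
  funext p q'
  have hs := Real.mul_self_sqrt (sigmaChi_nonneg (ω := ω) hσ0 (red p) q')
  have hρ := relSpeed_sq (ω := ω) (red p) q'
  rw [gainXi, gainA]
  simp only [Fin.sum_univ_four, xi, Matrix.cons_val, tens_smul_smul, hs, Aplus, ← hρ]
  module

/-- Exchanging the points reverses `z` and `d`. The coefficient of `ξ¹` is odd in `d` and `c` is odd
in `z`, hence two minus signs; `ξ³` does not see the exchange, and in `ξ⁴` the sign of `d` is
absorbed in `r' - r cos φ` while `e` is even. -/
lemma lossXi_eq_lossA (f : Phase → ℝ) : lossXi ω σ f = lossA ω σ f := by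
  funext p q'
  have hs := Real.mul_self_sqrt (sigmaChi_nonneg (ω := ω) hσ0 (red p) q')
  have hρ := relSpeed_sq (ω := ω) (red p) q'
  rw [lossXi, lossA]
  have e2 : ((rad q' - rad (red p) * Real.cos (phi ω (red p) q')) / ‖zvec ω (red p) q'‖) •
      dirA q' + -dirZ ω (red p) q' =
      (-1 : ℝ) • (((rad (red p) * Real.cos (phi ω (red p) q') - rad q') /
        ‖zvec ω (red p) q'‖) • dirA q' + dirZ ω (red p) q') := by
    rw [← neg_sub (rad q'), neg_div]; module
  have e4 : (rad (red p) * Real.cos (phi ω (red p) q') - rad q') * -dv3 (red p) q' =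
      (rad q' - rad (red p) * Real.cos (phi ω (red p) q')) * dv3 (red p) q' := by ring
  simp only [Fin.sum_univ_four, xi, eps, Matrix.cons_val, sigmaChi_swap ω σ (red p) q', phi_swap ω (red p) q',
    zvec_swap ω (red p) q', dv3_swap (red p) q', relSpeed_swap ω (red p) q', dirZ_swap ω (red p) q',
    dirW_swap ω (red p) q', norm_neg, e2, e4, smul_smul, tens_smul_smul, Aminus, ← hρ]
  generalize Real.sqrt (sigmaChi ω σ (red p) q') = s at hs ⊢
  rw [← hs, tens_smul_right (-1)]
  module

end

/-! ### Rapid decay and polynomial growth with respect to a weight -/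

section

variable {ι E F : Type*} [NormedAddCommGroup E] [NormedAddCommGroup F]

/-- `g` decays faster than any power of the weight `W`. -/
def Dec (W : ι → ℝ) (g : ι → E) : Prop := ∀ n : ℕ, ∃ C : ℝ, ∀ i, W i ^ n * ‖g i‖ ≤ C

/-- `g` grows at most like a power of the weight `W`. -/
def Pol (W : ι → ℝ) (g : ι → E) : Prop := ∃ (n : ℕ) (C : ℝ), ∀ i, ‖g i‖ ≤ C * W i ^ n

variable {W : ι → ℝ} (hW : ∀ i, 1 ≤ W i)
include hW

lemma Dec.mono {g : ι → E} {h : ι → F} (hg : Dec W g) (hle : ∀ i, ‖h i‖ ≤ ‖g i‖) : Dec W h := by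
  intro n
  obtain ⟨C, hC⟩ := hg n
  refine ⟨C, fun i => le_trans ?_ (hC i)⟩
  have := hW i
  gcongr
  exact hle i

lemma Dec.add {g h : ι → E} (hg : Dec W g) (hh : Dec W h) : Dec W fun i => g i + h i := by
  intro n
  obtain ⟨C, hC⟩ := hg n
  obtain ⟨C', hC'⟩ := hh n
  refine ⟨C + C', fun i => ?_⟩
  have := hW i
  calc W i ^ n * ‖g i + h i‖ ≤ W i ^ n * (‖g i‖ + ‖h i‖) := by gcongr; exact norm_add_le _ _
    _ ≤ _ := by rw [mul_add]; exact add_le_add (hC i) (hC' i)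

omit hW in
lemma Dec.neg {g : ι → E} (hg : Dec W g) : Dec W fun i => -g i := by
  intro n
  obtain ⟨C, hC⟩ := hg n
  exact ⟨C, fun i => by rw [norm_neg]; exact hC i⟩

lemma Dec.sum {κ : Type*} {s : Finset κ} {g : κ → ι → E} (hg : ∀ j ∈ s, Dec W (g j)) :
    Dec W fun i => ∑ j ∈ s, g j i := by
  classical
  induction s using Finset.induction_on with
  | empty => exact fun n => ⟨0, fun i => by simp⟩
  | insert a s ha ih =>
    simp only [Finset.sum_insert ha]
    exact (hg a (Finset.mem_insert_self a s)).add hW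
      (ih fun j hj => hg j (Finset.mem_insert_of_mem hj))

lemma Pol.smul_dec [NormedSpace ℝ E] {c : ι → ℝ} {g : ι → E} (hc : Pol W c) (hg : Dec W g) :
    Dec W fun i => c i • g i := by
  obtain ⟨m, D, hD⟩ := hc
  intro n
  obtain ⟨C, hC⟩ := hg (n + m)
  refine ⟨|D| * C, fun i => ?_⟩
  have h1 := hW i
  have h2 : 0 ≤ W i := by linarith
  calc W i ^ n * ‖c i • g i‖ = W i ^ n * (‖c i‖ * ‖g i‖) := by rw [norm_smul]
    _ ≤ W i ^ n * ((|D| * W i ^ m) * ‖g i‖) := by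
        gcongr
        exact (hD i).trans (by gcongr; exact le_abs_self D)
    _ = |D| * (W i ^ (n + m) * ‖g i‖) := by rw [pow_add]; ring
    _ ≤ |D| * C := by gcongr; exact hC i

lemma Dec.smul_pol [NormedSpace ℝ E] {c : ι → ℝ} {g : ι → E} (hc : Dec W c) (hg : Pol W g) :
    Dec W fun i => c i • g i := by
  have hg' : Pol W fun i => ‖g i‖ := by
    obtain ⟨n, C, h⟩ := hg
    exact ⟨n, C, fun i => by rw [norm_norm]; exact h i⟩
  exact (hg'.smul_dec hW hc).mono hW fun i => by
    simp only [norm_smul, norm_norm]; rw [mul_comm]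

lemma Dec.bound {g : ι → E} (hg : Dec W g) (n : ℕ) : ∃ C, 0 ≤ C ∧ ∀ i, ‖g i‖ ≤ C * (W i ^ n)⁻¹ := by
  obtain ⟨C, hC⟩ := hg n
  refine ⟨|C|, abs_nonneg C, fun i => ?_⟩
  have h1 := hW i
  have h2 : 0 < W i ^ n := pow_pos (by linarith) n
  rw [← div_eq_mul_inv, le_div_iff₀ h2, mul_comm]
  exact (hC i).trans (le_abs_self C)

end

/-! ### Decay of the fluxes and of the kernel -/

section

variable {ι : Type*} {E F : Type*} [NormedAddCommGroup E] [NormedSpace ℝ E]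
  [NormedAddCommGroup F] [NormedSpace ℝ F]

/-- `G` decays along the family `P` of phase points, and in the velocity uniformly over the
positions of the family. -/
def Adm (P : ι → Phase) (W : ι → ℝ) (G : Phase → E) : Prop :=
  Dec W (fun i => G (P i)) ∧ ∀ n : ℕ, ∃ C : ℝ, ∀ i v, (1 + ‖v‖) ^ n * ‖G ((P i).1, v)‖ ≤ C

variable {P : ι → Phase} {W : ι → ℝ} (hW : ∀ i, 1 + ‖(P i).2‖ ≤ W i)

include hW in
lemma one_le_weight (i : ι) : 1 ≤ W i := by
  have := hW i
  have := norm_nonneg (P i).2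
  linarith

lemma Adm.clm {G : Phase → E} (hG : Adm P W G) (L : E →L[ℝ] F) : Adm P W fun p => L (G p) := by
  have key : ∀ (a C : ℝ) (y : E), 0 ≤ a → a * ‖y‖ ≤ C → a * ‖L y‖ ≤ ‖L‖ * C := by
    intro a C y ha h
    calc a * ‖L y‖ ≤ a * (‖L‖ * ‖y‖) := by gcongr; exact L.le_opNorm _
      _ = ‖L‖ * (a * ‖y‖) := by ring
      _ ≤ _ := by gcongr
  refine ⟨fun n => ?_, fun n => ?_⟩
  · obtain ⟨C', hC'⟩ := hG.1 n
    refine ⟨‖L‖ * |C'|, fun i => ?_⟩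
    rcases le_or_gt 0 (W i ^ n) with h | h
    · exact key _ _ _ h ((hC' i).trans (le_abs_self _))
    · exact (mul_nonpos_of_nonpos_of_nonneg h.le (norm_nonneg _)).trans (by positivity)
  · obtain ⟨C, hC⟩ := hG.2 n
    exact ⟨‖L‖ * C, fun i v => key _ _ _ (by positivity) (hC i v)⟩

include hW in
-- Convolution with a moderate kernel need not preserve decay, but it costs at most the power `N` of
-- the weight; in the flux each convolution is multiplied by a decaying factor.
lemma ModerateKernel.pol_velConv {N : ℕ} {k : R3 → ℝ} (hk : ModerateKernel N k) {G : Phase → E}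
    (hG : Adm P W G) : Pol W fun i => velConv k G (P i) := by
  obtain ⟨C, hC⟩ := hG.2 N
  refine ⟨N, |C| * ∫ w, |k w| / (1 + ‖w‖) ^ N, fun i => ?_⟩
  refine (hk.norm_velConv_le (fun v => (hC i v).trans (le_abs_self C))).trans ?_
  have h0 : 0 ≤ ∫ w, |k w| / (1 + ‖w‖) ^ N := integral_nonneg fun w => by positivity
  gcongr
  exact hW i

variable {N : ℕ} {σ : ℝ → ℝ} (hσ : ModerateCross N σ) {f : Phase → ℝ} (hf : Regular f)
  (h0 : Adm P W f) (h1 : Adm P W (fderiv ℝ f)) (h2 : Adm P W (fderiv ℝ (fderiv ℝ f)))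

omit [NormedAddCommGroup E] [NormedSpace ℝ E] [NormedAddCommGroup F] [NormedSpace ℝ F] in
include h1 in
lemma adm_dV (j : Fin 3) : Adm P W (dV f j) :=
  h1.clm (ContinuousLinearMap.apply ℝ ℝ ((0, EuclideanSpace.single j 1) : Phase))

include hf h2 in
lemma adm_fderiv_dV (j : Fin 3) : Adm P W (fderiv ℝ (dV f j)) := by
  rw [hf.fderiv_dV j]
  exact h2.clm (ContinuousLinearMap.compL ℝ Phase (Phase →L[ℝ] ℝ) ℝ
    (ContinuousLinearMap.apply ℝ ℝ ((0, EuclideanSpace.single j 1) : Phase)))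

include hσ hf in
lemma velFlux_fplKernel_apply (p : Phase) (i : Fin 3) :
    velFlux (fplKernel σ f) p i = ∑ j, (velConv (landau σ i j) f p * dV f j p -
      velConv (landau σ i j) (dV f j) p * f p) := by
  rw [velFlux_fplKernel hσ hf, PiLp.sub_apply, velFlux_gainKernel_apply hσ hf,
    velFlux_lossKernel_apply hσ hf, Finset.sum_sub_distrib]

include hW hσ hf h0 h1 in
lemma dec_velFlux (k : Fin 3) : Dec W fun i => velFlux (fplKernel σ f) (P i) k := by
  have hW1 := one_le_weight hW
  simp only [velFlux_fplKernel_apply hσ hf, sub_eq_add_neg]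
  refine Dec.sum hW1 fun j _ => Dec.add hW1 ?_ (Dec.neg ?_)
  · exact ((hσ.landau k j).pol_velConv hW h0).smul_dec hW1 (adm_dV h1 j).1
  · exact ((hσ.landau k j).pol_velConv hW (adm_dV h1 j)).smul_dec hW1 h0.1

include hσ hf in
lemma hasFDerivAt_velFlux_apply (p : Phase) (k : Fin 3) :
    HasFDerivAt (fun p => velFlux (fplKernel σ f) p k)
      (∑ j, ((velConv (landau σ k j) f p • fderiv ℝ (dV f j) p +
          dV f j p • velConv (landau σ k j) (fderiv ℝ f) p) +
        -(velConv (landau σ k j) (dV f j) p • fderiv ℝ f p +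
          f p • velConv (landau σ k j) (fderiv ℝ (dV f j)) p))) p := by
  simp only [velFlux_fplKernel_apply hσ hf, ← sub_eq_add_neg]
  refine HasFDerivAt.fun_sum fun j _ => ?_
  have hd : ∀ p, HasFDerivAt (dV f j) (fderiv ℝ (dV f j) p) p := fun p =>
    ((hf.contDiff_dV j).differentiable (by norm_num) p).hasFDerivAt
  exact (((hσ.landau k j).hasFDerivAt_velConv hf.decay hf.differentiable hf.decay_fderiv p).mul
    (hd p)).sub (((hσ.landau k j).hasFDerivAt_velConv (hf.decay_dV j)
      ((hf.contDiff_dV j).differentiable (by norm_num)) (hf.decay_fderiv_dV j) p).mul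
        (hf.differentiable p).hasFDerivAt)

include hW hσ hf h0 h1 h2 in
lemma dec_fderiv_velFlux (k : Fin 3) :
    Dec W fun i => fderiv ℝ (fun p => velFlux (fplKernel σ f) p k) (P i) := by
  have hW1 := one_le_weight hW
  simp only [(hasFDerivAt_velFlux_apply hσ hf _ k).fderiv]
  refine Dec.sum hW1 fun j _ => Dec.add hW1 (Dec.add hW1 ?_ ?_) (Dec.neg (Dec.add hW1 ?_ ?_))
  · exact ((hσ.landau k j).pol_velConv hW h0).smul_dec hW1 (adm_fderiv_dV hf h2 j).1
  · exact (adm_dV h1 j).1.smul_pol hW1 ((hσ.landau k j).pol_velConv hW h1)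
  · exact ((hσ.landau k j).pol_velConv hW (adm_dV h1 j)).smul_dec hW1 h1.1
  · exact h0.1.smul_pol hW1 ((hσ.landau k j).pol_velConv hW (adm_fderiv_dV hf h2 j))

include hσ hf in
lemma Q_eq_sum (p : Phase) : Q σ f p =
    ∑ k, fderiv ℝ (fun p => velFlux (fplKernel σ f) p k) p (0, EuclideanSpace.single k 1) := by
  have hd := (contDiff_velFlux_fplKernel hσ hf).differentiable (by norm_num) p
  rw [Q, divV]
  refine Finset.sum_congr rfl fun k _ => ?_
  rw [(fderiv_slice p hd).fderiv]
  have h : HasFDerivAt (fun p => velFlux (fplKernel σ f) p k)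
      ((EuclideanSpace.proj k : R3 →L[ℝ] ℝ).comp (fderiv ℝ (velFlux (fplKernel σ f)) p)) p :=
    (EuclideanSpace.proj k : R3 →L[ℝ] ℝ).hasFDerivAt.comp p hd.hasFDerivAt
  rw [h.fderiv]
  rfl

include hW hσ hf h0 h1 h2 in
lemma dec_Q : Dec W fun i => Q σ f (P i) := by
  have hW1 := one_le_weight hW
  simp only [Q_eq_sum hσ hf]
  refine Dec.sum hW1 fun k _ => (dec_fderiv_velFlux hW hσ hf h0 h1 h2 k).mono hW1 fun i => ?_
  refine (ContinuousLinearMap.le_opNorm _ _).trans ?_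
  have : ‖((0, EuclideanSpace.single k 1) : Phase)‖ = 1 := by simp [Prod.norm_def]
  rw [this, mul_one]

end

/-! ### Families of phase points -/

lemma adm_slice {E : Type*} [NormedAddCommGroup E] [NormedSpace ℝ E] {G : Phase → E}
    (hG : DecayV G) (x : R3) :
    Adm (fun v : R3 => ((x, v) : Phase)) (fun v => 1 + ‖v‖) G := by
  have h : ∀ n : ℕ, ∃ C : ℝ, ∀ v, (1 + ‖v‖) ^ n * ‖G (x, v)‖ ≤ C := fun n => by
    obtain ⟨C, hC⟩ := hG.2 n ‖x‖
    exact ⟨C, fun v => hC x v le_rfl⟩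
  exact ⟨h, fun n => (h n).imp fun C hC _ v => hC v⟩

/-- The weight `1 + |x̄| + |v|`. -/
def wt (q : R2 × R3) : ℝ := 1 + ‖q.1‖ + ‖q.2‖

lemma one_le_wt (q : R2 × R3) : 1 ≤ wt q := by
  have := norm_nonneg q.1
  have := norm_nonneg q.2
  unfold wt; linarith

/-- The bound for a velocity `v` unrelated to `q` is the hypothesis at `(x̄, v)`, whose weight
dominates `1 + |v|`. -/
lemma adm_height {E : Type*} [NormedAddCommGroup E] [NormedSpace ℝ E] {G : Phase → E} {x3 : ℝ}
    (h : ∀ n : ℕ, ∃ C : ℝ, ∀ q : R2 × R3, (1 + ‖q.1‖ + ‖q.2‖) ^ n * ‖G (pt q x3)‖ ≤ C) :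
    Adm (fun q => pt q x3) wt G := by
  refine ⟨h, fun n => ?_⟩
  obtain ⟨C, hC⟩ := h n
  refine ⟨C, fun q v => le_trans ?_ (hC (q.1, v))⟩
  have := norm_nonneg q.1
  simp only [pt]
  gcongr
  linarith

lemma dec_Q_height {N : ℕ} {σ : ℝ → ℝ} (hσ : ModerateCross N σ) {f : Phase → ℝ} (hf : Regular f)
    {x3 : ℝ} (h : RapidDecayAt f x3) : Dec wt fun q => Q σ f (pt q x3) := by
  refine dec_Q (P := fun q => pt q x3) ?_ hσ hf ?_ ?_ ?_
  · intro q
    have := norm_nonneg q.1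
    simp only [pt, wt]; linarith
  · exact adm_height fun n => by simpa using h n 0 (by norm_num)
  · exact adm_height fun n => by simpa [norm_iteratedFDeriv_one] using h n 1 (by norm_num)
  · exact adm_height fun n => by simpa [norm_iteratedFDeriv_two] using h n 2 (by norm_num)

/-! ### Integrability from decay -/

lemma integrable_of_dec_R3 {E : Type*} [NormedAddCommGroup E] {g : R3 → E}
    (hm : AEStronglyMeasurable g volume) (hg : Dec (fun v : R3 => 1 + ‖v‖) g) : Integrable g := by
  obtain ⟨C, -, hC⟩ := hg.bound (fun v => by have := norm_nonneg v; linarith) 4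
  have h := (integrable_one_add_norm (E := R3) (μ := volume) (r := 4)
    (by rw [finrank_euclideanSpace]; norm_num)).const_mul C
  refine h.mono' hm (Filter.Eventually.of_forall fun v => (hC v).trans_eq ?_)
  rw [Real.rpow_neg (by positivity)]
  norm_cast

lemma integrable_wt : Integrable fun q : R2 × R3 => (wt q ^ 6)⁻¹ := by
  have : (volume : Measure (R2 × R3)).IsAddHaarMeasure :=
    inferInstanceAs ((volume : Measure R2).prod (volume : Measure R3)).IsAddHaarMeasure
  -- The exponent `6` exceeds the dimension `5`.
  have h := integrable_one_add_norm (E := R2 × R3) (μ := volume) (r := 6)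
    (by simp; norm_num)
  have hc : Continuous fun q : R2 × R3 => (wt q ^ 6)⁻¹ := by
    refine Continuous.inv₀ (by unfold wt; fun_prop) fun q => ?_
    have := one_le_wt q
    positivity
  refine h.mono' hc.aestronglyMeasurable (Filter.Eventually.of_forall fun q => ?_)
  have h1 := one_le_wt q
  rw [Real.rpow_neg (by positivity), norm_inv, norm_pow, Real.norm_eq_abs,
    abs_of_pos (by linarith)]
  have h2 : 1 + ‖q‖ ≤ wt q := by
    rw [Prod.norm_def, wt, add_assoc]
    have := norm_nonneg q.1
    have := norm_nonneg q.2
    gcongr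
    exact max_le (by linarith) (by linarith)
  norm_cast
  gcongr

/-! ### The gyroaverage in the perpendicular variables -/

/-- The flow on `(x̄, v)`. -/
def flow2 (ω : ℝ) (t : Torus) (q : R2 × R3) : R2 × R3 :=
  (q.1 + ω⁻¹ • perp (bar q.2) - ω⁻¹ • perp (rotT t (bar q.2)), rot3 t q.2)

lemma flow_pt (ω : ℝ) (t : Torus) (q : R2 × R3) (x3 : ℝ) :
    flow ω t (pt q x3) = pt (flow2 ω t q) x3 := by
  simp [flow, pt, flow2]

lemma flow2_neg_flow2 (ω : ℝ) (t : Torus) (q : R2 × R3) : flow2 ω (-t) (flow2 ω t q) = q := by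
  simp [flow2]

@[fun_prop] lemma Continuous.flow2' {X : Type*} [TopologicalSpace X] {ω : ℝ} {a : X → Torus}
    {b : X → R2 × R3} (ha : Continuous a) (hb : Continuous b) :
    Continuous fun x => flow2 ω (a x) (b x) := by
  unfold flow2; fun_prop

/-- The velocity is rotated and, for each velocity, the position is translated. -/
lemma measurePreserving_flow2 (ω : ℝ) (t : Torus) : MeasurePreserving (flow2 ω t) := by
  have h1 : MeasurePreserving (fun y : R3 × R2 =>
      (rot3 t y.1, y.2 + ω⁻¹ • perp (bar y.1) - ω⁻¹ • perp (rotT t (bar y.1)))) := by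
    refine (measurePreserving_rot3 t).skew_product (μc := (volume : Measure R2))
      (g := fun v x => x + ω⁻¹ • perp (bar v) - ω⁻¹ • perp (rotT t (bar v)))
      (Continuous.measurable (by fun_prop)) (Filter.Eventually.of_forall fun v => ?_)
    have := (measurePreserving_add_right (volume : Measure R2)
      (ω⁻¹ • perp (bar v) - ω⁻¹ • perp (rotT t (bar v)))).map_eq
    simpa [add_sub_assoc] using this
  exact (Measure.measurePreserving_swap (μ := (volume : Measure R3)) (ν := (volume : Measure R2))).comp
    (h1.comp (Measure.measurePreserving_swap (μ := (volume : Measure R2))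
      (ν := (volume : Measure R3))))

/-- The flow preserves `|v|` and displaces `x̄` by at most two gyroradii, each at most `|ω⁻¹| |v|`.
-/
lemma wt_le_flow2 (ω : ℝ) (t : Torus) (q : R2 × R3) :
    wt q ≤ (1 + 2 * |ω⁻¹|) * wt (flow2 ω t q) := by
  have h1 : ‖(flow2 ω t q).2‖ = ‖q.2‖ := norm_rot3 t q.2
  have h2 : ‖q.1‖ ≤ ‖(flow2 ω t q).1‖ + 2 * |ω⁻¹| * ‖q.2‖ := by
    have h3 : q.1 = (flow2 ω t q).1 + (ω⁻¹ • perp (rotT t (bar q.2)) - ω⁻¹ • perp (bar q.2)) := by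
      simp only [flow2]; abel
    have h4 : ‖ω⁻¹ • perp (rotT t (bar q.2)) - ω⁻¹ • perp (bar q.2)‖ ≤ 2 * |ω⁻¹| * ‖q.2‖ := by
      refine (norm_sub_le _ _).trans ?_
      rw [norm_smul, norm_smul, norm_perp, norm_perp, norm_rotT, Real.norm_eq_abs]
      have := mul_le_mul_of_nonneg_left (norm_bar_le q.2) (abs_nonneg ω⁻¹)
      linarith
    calc ‖q.1‖ = _ := congrArg _ h3
      _ ≤ _ := norm_add_le _ _
      _ ≤ _ := by gcongr
  have h5 := abs_nonneg ω⁻¹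
  have h6 := norm_nonneg (flow2 ω t q).1
  have h7 := norm_nonneg q.2
  unfold wt
  rw [h1]
  nlinarith [mul_nonneg h5 h6, mul_nonneg h5 h7]

/-- Averaging against `ψ`: the flow is transferred to `ψ`. -/
theorem integral_gyroAverage_smul {ω : ℝ} (hω : ω ≠ 0) {E : Type*} [NormedAddCommGroup E]
    [NormedSpace ℝ E] [CompleteSpace E] {u : Phase → ℝ} (hu : Continuous u) {x3 : ℝ}
    (hdec : Dec wt fun q => u (pt q x3)) {ψ : R2 × R3 → E} (hψ : Continuous ψ) (hpol : Pol wt ψ) :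
    Integrable (fun q => gyroAverage ω u (pt q x3) • ψ q) ∧
      ∫ q, gyroAverage ω u (pt q x3) • ψ q =
        ∫ t, (∫ x : R2, ∫ v : R3, u (pt (x, v) x3) • ψ (flow2 ω (-t) (x, v))) ∂haarT := by
  have hpt : Continuous fun q : R2 × R3 => pt q x3 := continuous_pt x3
  set H : (R2 × R3) × Torus → E := fun y => u (pt (flow2 ω y.2 y.1) x3) • ψ y.1 with hH
  have hHc : Continuous H := by
    have h1 : Continuous fun y : (R2 × R3) × Torus => u (pt (flow2 ω y.2 y.1) x3) :=
      hu.comp (hpt.comp (by fun_prop))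
    exact h1.smul (hψ.comp continuous_fst)
  have hHi : Integrable H ((volume : Measure (R2 × R3)).prod haarT) := by
    obtain ⟨m, D, hD⟩ := hpol
    -- The power `m` absorbs the growth of `ψ`, and `6` leaves the integrable weight.
    obtain ⟨C, hC0, hC⟩ := hdec.bound one_le_wt (6 + m)
    set B := (1 + 2 * |ω⁻¹|) with hB
    have hB0 : 0 < B := by positivity
    have hdom : Integrable (fun y : (R2 × R3) × Torus =>
        (C * B ^ (6 + m) * |D|) * (wt y.1 ^ 6)⁻¹) ((volume : Measure (R2 × R3)).prod haarT) :=
      (integrable_wt.comp_fst haarT).const_mul _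
    refine hdom.mono' hHc.aestronglyMeasurable (Filter.Eventually.of_forall fun y => ?_)
    have h1 := one_le_wt y.1
    have h2 := one_le_wt (flow2 ω y.2 y.1)
    have h3 := wt_le_flow2 ω y.2 y.1
    have h0 : 0 < wt y.1 := by linarith
    have h0' : 0 < wt (flow2 ω y.2 y.1) := by linarith
    have h4 : (wt (flow2 ω y.2 y.1) ^ (6 + m))⁻¹ ≤ B ^ (6 + m) * (wt y.1 ^ (6 + m))⁻¹ := by
      rw [← div_eq_mul_inv, le_div_iff₀ (by positivity), inv_mul_eq_div,
        div_le_iff₀ (by positivity), ← mul_pow]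
      gcongr
    rw [hH, norm_smul]
    calc ‖u (pt (flow2 ω y.2 y.1) x3)‖ * ‖ψ y.1‖
        ≤ (C * (B ^ (6 + m) * (wt y.1 ^ (6 + m))⁻¹)) * (|D| * wt y.1 ^ m) := by
          have h5 := (hC (flow2 ω y.2 y.1)).trans (mul_le_mul_of_nonneg_left h4 hC0)
          have h6 : ‖ψ y.1‖ ≤ |D| * wt y.1 ^ m :=
            (hD y.1).trans (by gcongr; exact le_abs_self D)
          exact mul_le_mul h5 h6 (norm_nonneg _) (by positivity)
      _ = (C * B ^ (6 + m) * |D|) * (wt y.1 ^ 6)⁻¹ := by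
          rw [pow_add (wt y.1)]; field_simp
  have havg : ∀ q, gyroAverage ω u (pt q x3) • ψ q = ∫ t, H (q, t) ∂haarT := fun q => by
    rw [gyroAverage_eq_integral hω, ← integral_smul_const]
    simp only [flow_pt, hH]
  refine ⟨?_, ?_⟩
  · simp only [havg]
    exact hHi.integral_prod_left
  · simp only [havg]
    rw [integral_integral_swap (f := fun q t => H (q, t)) hHi]
    have h_int := hHi.prod_left_ae
    refine integral_congr_ae ?_
    filter_upwards [h_int] with t ht
    have h1 : ∀ q, H (q, t) = (fun q => u (pt q x3) • ψ (flow2 ω (-t) q)) (flow2 ω t q) := by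
      intro q; simp only [hH, flow2_neg_flow2]
    have hc : Continuous fun q => u (pt q x3) • ψ (flow2 ω (-t) q) :=
      (hu.comp hpt).smul (hψ.comp (by fun_prop))
    have hmp := measurePreserving_flow2 ω t
    have h2 : ∫ q, H (q, t) = ∫ q, u (pt q x3) • ψ (flow2 ω (-t) q) := by
      simp only [h1]
      conv_rhs => rw [← hmp.map_eq]
      rw [integral_map hmp.measurable.aemeasurable hc.aestronglyMeasurable]
    have h3 : Integrable (fun q => u (pt q x3) • ψ (flow2 ω (-t) q)) volume := by
      refine (hmp.integrable_comp hc.aestronglyMeasurable).1 (ht.congr ?_)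
      exact Filter.Eventually.of_forall fun q => h1 q
    simp only [h2]
    rw [Measure.volume_eq_prod, integral_prod _ h3]

/-! ### The weak form of the kernel in the velocity variable -/

/-- The weight `1 + |v|`. -/
def vw (v : R3) : ℝ := 1 + ‖v‖

lemma one_le_vw (v : R3) : 1 ≤ vw v := by
  have := norm_nonneg v
  unfold vw; linarith

lemma integrable_cross {N : ℕ} {σ : ℝ → ℝ} (hσ : ModerateCross N σ) {A B : R3 → ℝ}
    (hA : Continuous A) (hB : Continuous B) (hAd : Dec vw A) (hBd : Dec vw B) :
    Integrable fun y : R3 × R3 => σ ‖y.1 - y.2‖ * (A y.1 * B y.2) := by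
  have hmeas : Measurable fun y : R3 × R3 => σ ‖y.2‖ * (A y.1 * B (y.1 - y.2)) :=
    (hσ.1.comp (by fun_prop)).mul (Continuous.measurable (by fun_prop))
  have h1 : Integrable fun y : R3 × R3 => σ ‖y.2‖ * (A y.1 * B (y.1 - y.2)) := by
    -- After `v' = v - w`, the power `N` pays for the factor lost in `norm_smul_le_of_weight` and
    -- `4` gives integrability on `ℝ³`; the bound is then a product of a function of `v` and one of
    -- `w`.
    obtain ⟨C, hC0, hC⟩ := hAd.bound one_le_vw (N + 4)
    obtain ⟨C', hC'⟩ := hBd N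
    have hi : Integrable fun v : R3 => (vw v ^ 4)⁻¹ := by
      have h := integrable_one_add_norm (E := R3) (μ := volume) (r := 4)
        (by rw [finrank_euclideanSpace]; norm_num)
      refine h.congr (Filter.Eventually.of_forall fun v => ?_)
      simp only [vw]
      rw [Real.rpow_neg (by positivity)]
      norm_cast
    have hdom := (hi.const_mul (C * C')).mul_prod hσ.2
    refine hdom.mono' hmeas.aestronglyMeasurable (Filter.Eventually.of_forall fun y => ?_)
    have h2 := norm_smul_le_of_weight (c := σ ‖y.2‖) (hC' (y.1 - y.2))
    have h3 := hC y.1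
    have h4 : 0 < vw y.1 := by have := one_le_vw y.1; linarith
    calc ‖σ ‖y.2‖ * (A y.1 * B (y.1 - y.2))‖
        = ‖A y.1‖ * ‖σ ‖y.2‖ • B (y.1 - y.2)‖ := by
          simp only [norm_mul, smul_eq_mul]; ring
      _ ≤ (C * (vw y.1 ^ (N + 4))⁻¹) *
            (C' * (1 + ‖y.1‖) ^ N * (|σ ‖y.2‖| / (1 + ‖y.2‖) ^ N)) := by gcongr
      _ = _ := by
          change _ * (C' * vw y.1 ^ N * _) = _
          rw [pow_add]; field_simp
  have hmp : MeasurePreserving (fun y : R3 × R3 => (y.1, y.1 - y.2)) := by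
    refine (MeasurePreserving.id (volume : Measure R3)).skew_product
      (μc := (volume : Measure R3)) (g := fun v v' => v - v')
      (Continuous.measurable (by fun_prop)) (Filter.Eventually.of_forall fun v => ?_)
    exact (Measure.measurePreserving_sub_left (volume : Measure R3) v).map_eq
  have := (hmp.integrable_comp hmeas.aestronglyMeasurable).2 h1
  refine this.congr (Filter.Eventually.of_forall fun y => ?_)
  simp [Function.comp]

lemma S_neg (w y : R3) : S (-w) y = S w y := by
  simp [S, neg_div]

lemma fplKernel_swap (σ : ℝ → ℝ) (f : Phase → ℝ) (x v v' : R3) :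
    fplKernel σ f (x, v') v = -fplKernel σ f (x, v) v' := by
  have h : f (x, v) • gradV f (x, v') - f (x, v') • gradV f (x, v) =
      (-1 : ℝ) • (f (x, v') • gradV f (x, v) - f (x, v) • gradV f (x, v')) := by module
  simp only [fplKernel]
  rw [h, ← neg_sub v v', norm_neg, S_neg, S_smul]
  simp

lemma norm_fplKernel_le (σ : ℝ → ℝ) (f : Phase → ℝ) (x v v' : R3) :
    ‖fplKernel σ f (x, v) v'‖ ≤ 2 * |σ ‖v - v'‖| *
      (|f (x, v')| * ‖gradV f (x, v)‖ + |f (x, v)| * ‖gradV f (x, v')‖) := by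
  simp only [fplKernel]
  rw [norm_smul, Real.norm_eq_abs]
  calc _ ≤ |σ ‖v - v'‖| * (2 * (|f (x, v')| * ‖gradV f (x, v)‖ +
        |f (x, v)| * ‖gradV f (x, v')‖)) := by
        gcongr
        refine (norm_S_le _ _).trans ?_
        gcongr
        refine (norm_sub_le _ _).trans ?_
        rw [norm_smul, norm_smul, Real.norm_eq_abs, Real.norm_eq_abs]
    _ = _ := by ring

section

variable {N : ℕ} {σ : ℝ → ℝ} (hσ : ModerateCross N σ) {f : Phase → ℝ} (hf : Regular f) (x : R3)
  {ψ : R3 → ℝ} (hψ : ContDiff ℝ 1 ψ) (hpol : Pol vw ψ)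
  (hd0 : Dec vw fun v => ‖fderiv ℝ ψ v‖ * f (x, v))
  (hd1 : Dec vw fun v => ‖fderiv ℝ ψ v‖ * ‖gradV f (x, v)‖)

include hf in
lemma dec_slice : Dec vw fun v => f (x, v) := (adm_slice hf.decay x).1

include hf in
lemma dec_gradV_slice : Dec vw fun v => gradV f (x, v) :=
  (adm_slice hf.decay_fderiv x).1.mono one_le_vw fun _ => norm_gradV_le hf.differentiable _

include hσ hf in
lemma measurable_fplKernel_slice :
    Measurable fun y : R3 × R3 => fplKernel σ f (x, y.1) y.2 := by
  have hg := continuous_gradV (hf.contDiff.of_le (by norm_num))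
  have hc := hf.contDiff.continuous
  unfold fplKernel
  refine (hσ.1.comp (by fun_prop)).smul (measurable_S (by fun_prop) (Continuous.measurable ?_))
  fun_prop

include hσ hf hψ hd0 hd1 in
-- Decay is asked only of `|∇ψ| f` and `|∇ψ| |∇_v f|`, not of `∇ψ`, so that `ψ = ln f` is admissible
-- although its gradient need not grow polynomially.
lemma integrable_of_le_fderiv_mul_fplKernel {H : R3 × R3 → ℝ} (hH : Measurable H)
    (hle : ∀ y, ‖H y‖ ≤ ‖fderiv ℝ ψ y.1‖ * ‖fplKernel σ f (x, y.1) y.2‖) : Integrable H := by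
  have hg := continuous_gradV (hf.contDiff.of_le (by norm_num))
  have hc := hf.contDiff.continuous
  have hψ' := hψ.continuous_fderiv (by norm_num)
  have h1 := integrable_cross hσ (by fun_prop) (by fun_prop) hd1 (dec_slice hf x)
  have h2 := integrable_cross hσ (by fun_prop) (by fun_prop) hd0
    ((dec_gradV_slice hf x).mono one_le_vw (h := fun v => ‖gradV f (x, v)‖) fun v => by simp)
  refine ((h1.norm.add h2.norm).const_mul 2).mono' hH.aestronglyMeasurable
    (Filter.Eventually.of_forall fun y => (hle y).trans ?_)
  refine (mul_le_mul_of_nonneg_left (norm_fplKernel_le σ f x y.1 y.2) (norm_nonneg _)).trans_eq ?_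
  simp only [Pi.add_apply, norm_mul, Real.norm_eq_abs, abs_norm]
  ring

include hσ hf hψ hpol hd0 hd1 in
-- Integration by parts in each velocity component, followed by Fubini to write the flux as an
-- integral over `v'`.
theorem integral_Q_mul : ∫ v, Q σ f (x, v) * ψ v = -∫ y : R3 × R3,
    fderiv ℝ ψ y.1 (fplKernel σ f (x, y.1) y.2) := by
  have hψ' := hψ.continuous_fderiv (by norm_num)
  have hK := measurable_fplKernel_slice hσ hf x
  have hFc := contDiff_velFlux_fplKernel hσ hf
  have hW : ∀ v : R3, 1 + ‖((x, v) : Phase).2‖ ≤ vw v := fun v => le_rfl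
  have hAi : ∀ k : Fin 3, Integrable fun y : R3 × R3 =>
      fderiv ℝ ψ y.1 (EuclideanSpace.single k 1) * fplKernel σ f (x, y.1) y.2 k := by
    intro k
    refine integrable_of_le_fderiv_mul_fplKernel hσ hf x hψ hd0 hd1 ?_ fun y => ?_
    · refine Measurable.mul (Continuous.measurable (by fun_prop)) ?_
      exact (continuous_coord_R3 k).measurable.comp hK
    · rw [norm_mul]
      gcongr
      · refine (ContinuousLinearMap.le_opNorm _ _).trans_eq ?_
        simp
      · exact abs_coord_le_R3 _ k
  have hFk : ∀ k : Fin 3, ContDiff ℝ 1 fun v : R3 => velFlux (fplKernel σ f) (x, v) k := by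
    intro k
    have : ContDiff ℝ 1 fun p => velFlux (fplKernel σ f) p k := (contDiff_euclidean.1 hFc) k
    exact this.comp (contDiff_prodMk_right x)
  have hder : ∀ (k : Fin 3) (v : R3), fderiv ℝ (fun p => velFlux (fplKernel σ f) p k) (x, v)
      (0, EuclideanSpace.single k 1) =
      fderiv ℝ (fun v : R3 => velFlux (fplKernel σ f) (x, v) k) v (EuclideanSpace.single k 1) := by
    intro k v
    have h := fderiv_slice (x, v) (hasFDerivAt_velFlux_apply hσ hf (x, v) k).differentiableAt
    rw [h.fderiv]
    rfl
  have hflux : ∀ (k : Fin 3) (v : R3), velFlux (fplKernel σ f) (x, v) k =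
      ∫ v', fplKernel σ f (x, v) v' k := fun k v => by
    rw [velFlux, eval_integral_piLp fun i => (integrable_fplKernel hσ hf (x, v)).eval_piLp i]
  have hi1 : ∀ k : Fin 3, Integrable fun v =>
      ψ v * fderiv ℝ (fun v : R3 => velFlux (fplKernel σ f) (x, v) k) v
        (EuclideanSpace.single k 1) := by
    intro k
    have hc := (hFk k).continuous_fderiv (by norm_num)
    have hψc := hψ.continuous
    refine integrable_of_dec_R3 (Continuous.aestronglyMeasurable (by fun_prop)) ?_
    refine Pol.smul_dec (W := vw) one_le_vw hpol ?_
    refine (dec_fderiv_velFlux hW hσ hf (adm_slice hf.decay x) (adm_slice hf.decay_fderiv x)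
      (adm_slice hf.decay_fderiv2 x) k).mono one_le_vw fun v => ?_
    rw [← hder]
    refine (ContinuousLinearMap.le_opNorm _ _).trans_eq ?_
    simp [Prod.norm_def]
  have hi2 : ∀ k : Fin 3, Integrable fun v => ψ v * velFlux (fplKernel σ f) (x, v) k := by
    intro k
    have hc := (hFk k).continuous
    have hψc := hψ.continuous
    refine integrable_of_dec_R3 (Continuous.aestronglyMeasurable (by fun_prop)) ?_
    exact Pol.smul_dec (W := vw) one_le_vw hpol
      (dec_velFlux hW hσ hf (adm_slice hf.decay x) (adm_slice hf.decay_fderiv x) k)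
  have hA' : ∀ k : Fin 3, ∀ v, fderiv ℝ ψ v (EuclideanSpace.single k 1) *
      velFlux (fplKernel σ f) (x, v) k = ∫ v', fderiv ℝ ψ v (EuclideanSpace.single k 1) *
        fplKernel σ f (x, v) v' k := fun k v => by rw [hflux, integral_const_mul]
  have hparts : ∀ k : Fin 3,
      ∫ v, ψ v * fderiv ℝ (fun v : R3 => velFlux (fplKernel σ f) (x, v) k) v
        (EuclideanSpace.single k 1) =
      -∫ y : R3 × R3, fderiv ℝ ψ y.1 (EuclideanSpace.single k 1) *
        fplKernel σ f (x, y.1) y.2 k := by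
    intro k
    rw [integral_mul_fderiv_eq_neg_fderiv_mul_of_integrable _ (hi1 k) (hi2 k)
      (fun v _ => hψ.differentiable (by norm_num) v)
      (fun v _ => (hFk k).differentiable (by norm_num) v)]
    · simp only [hA' k]
      rw [Measure.volume_eq_prod, integral_prod _ (hAi k)]
    · simp only [hA' k]
      exact (hAi k).integral_prod_left
  have hQ : ∀ v, Q σ f (x, v) * ψ v = ∑ k, ψ v *
      fderiv ℝ (fun v : R3 => velFlux (fplKernel σ f) (x, v) k) v (EuclideanSpace.single k 1) := by
    intro v
    rw [Q_eq_sum hσ hf, mul_comm, Finset.mul_sum]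
    simp only [hder]
  simp only [hQ]
  rw [integral_finsetSum _ fun k _ => hi1 k]
  simp only [hparts]
  rw [Finset.sum_neg_distrib, ← integral_finsetSum _ fun k _ => hAi k]
  congr 1
  refine integral_congr_ae (Filter.Eventually.of_forall fun y => ?_)
  have hb : fplKernel σ f (x, y.1) y.2 =
      ∑ k, fplKernel σ f (x, y.1) y.2 k • (EuclideanSpace.single k 1 : R3) := by
    have := (EuclideanSpace.basisFun (Fin 3) ℝ).sum_repr (fplKernel σ f (x, y.1) y.2)
    simpa using this.symm
  change _ = fderiv ℝ ψ y.1 (fplKernel σ f (x, y.1) y.2)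
  conv_rhs => rw [hb]
  simp only [map_sum, map_smul, smul_eq_mul]
  exact Finset.sum_congr rfl fun k _ => mul_comm _ _

include hσ hf hψ hpol hd0 hd1 in
/-- The symmetric weak form of the kernel. -/
theorem integral_Q_mul_symm : ∫ v, Q σ f (x, v) * ψ v = -(1 / 2) * ∫ y : R3 × R3,
    (fderiv ℝ ψ y.1 - fderiv ℝ ψ y.2) (fplKernel σ f (x, y.1) y.2) := by
  have hψ' := hψ.continuous_fderiv (by norm_num)
  have hK := measurable_fplKernel_slice hσ hf x
  have hI : Integrable fun y : R3 × R3 => fderiv ℝ ψ y.1 (fplKernel σ f (x, y.1) y.2) := by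
    refine integrable_of_le_fderiv_mul_fplKernel hσ hf x hψ hd0 hd1 ?_ fun y =>
      ContinuousLinearMap.le_opNorm _ _
    have h : Continuous fun y : (R3 →L[ℝ] ℝ) × R3 => y.1 y.2 := by fun_prop
    exact h.measurable.comp ((hψ'.comp continuous_fst).measurable.prodMk hK)
  have hswap : ∀ y : R3 × R3, fderiv ℝ ψ y.2 (fplKernel σ f (x, y.1) y.2) =
      -(fun y : R3 × R3 => fderiv ℝ ψ y.1 (fplKernel σ f (x, y.1) y.2)) y.swap := by
    intro y
    simp only [Prod.fst_swap, Prod.snd_swap]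
    rw [fplKernel_swap σ f x y.1 y.2, map_neg, neg_neg]
  have hI' : Integrable fun y : R3 × R3 => fderiv ℝ ψ y.2 (fplKernel σ f (x, y.1) y.2) := by
    simp only [hswap]
    exact (Integrable.swap (μ := (volume : Measure R3)) (ν := (volume : Measure R3)) hI).neg
  have h2 : ∫ y : R3 × R3, fderiv ℝ ψ y.2 (fplKernel σ f (x, y.1) y.2) =
      -∫ y : R3 × R3, fderiv ℝ ψ y.1 (fplKernel σ f (x, y.1) y.2) := by
    simp only [hswap]
    rw [integral_neg, Measure.volume_eq_prod, integral_prod_swap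
      (fun y : R3 × R3 => fderiv ℝ ψ y.1 (fplKernel σ f (x, y.1) y.2))]
  rw [integral_Q_mul hσ hf x hψ hpol hd0 hd1]
  simp only [sub_apply]
  rw [integral_sub hI hI', h2]
  ring

end

/-! ### The gradient of a positive function -/

/-- A descent step: Taylor's formula gives `0 < f(v - M⁻¹ y) ≤ f(v) - |y|² / (2M)` with `y = ∇_v f`.
The bound `|y| ≤ M` keeps the step within the unit ball, where the second derivative is controlled.
-/
lemma sq_norm_gradV_le {f : Phase → ℝ} (hf : ContDiff ℝ 2 f) {x v : R3} (hpos : ∀ u, 0 < f (x, u))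
    {M : ℝ} (hM : 0 < M) (h1 : ‖gradV f (x, v)‖ ≤ M)
    (h2 : ∀ u ∈ Metric.closedBall v 1, ‖fderiv ℝ (fderiv ℝ f) (x, u)‖ ≤ M) :
    ‖gradV f (x, v)‖ ^ 2 ≤ 2 * M * f (x, v) := by
  set y := gradV f (x, v) with hy
  have hfd : Differentiable ℝ f := hf.differentiable (by norm_num)
  have hder : ∀ s : ℝ, HasDerivAt (fun s : ℝ => f (x, v - s • y) + s * ‖y‖ ^ 2 -
      M * s ^ 2 / 2 * ‖y‖ ^ 2)
      (fderiv ℝ f (x, v - s • y) (0, -y) + ‖y‖ ^ 2 - M * s * ‖y‖ ^ 2) s := by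
    intro s
    have ha : HasDerivAt (fun s : ℝ => ((x, v - s • y) : Phase)) (0, -y) s := by
      refine (hasDerivAt_const s x).prodMk ?_
      simpa using ((hasDerivAt_id s).smul_const y).const_sub v
    have hb := (hfd (x, v - s • y)).hasFDerivAt.comp_hasDerivAt s ha
    have hc : HasDerivAt (fun s : ℝ => s * ‖y‖ ^ 2) (‖y‖ ^ 2) s := by
      simpa using (hasDerivAt_id s).mul_const (‖y‖ ^ 2)
    have hd : HasDerivAt (fun s : ℝ => M * s ^ 2 / 2 * ‖y‖ ^ 2) (M * s * ‖y‖ ^ 2) s := by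
      refine ((((hasDerivAt_pow 2 s).const_mul M).div_const 2).mul_const
        (‖y‖ ^ 2)).congr_deriv ?_
      push_cast
      ring
    exact (hb.add hc).sub hd
  have hneg : ∀ s ∈ Icc (0 : ℝ) M⁻¹,
      fderiv ℝ f (x, v - s • y) (0, -y) + ‖y‖ ^ 2 - M * s * ‖y‖ ^ 2 ≤ 0 := by
    intro s hs
    have hsy : ‖s • y‖ ≤ 1 := by
      rw [norm_smul, Real.norm_eq_abs, abs_of_nonneg hs.1]
      calc s * ‖y‖ ≤ M⁻¹ * M := mul_le_mul hs.2 h1 (norm_nonneg _) (by positivity)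
        _ = 1 := inv_mul_cancel₀ hM.ne'
    -- The second derivative is bounded only at the fixed position `x`, hence the convex set `{x} ×
    -- ball`.
    have hmvt := Convex.norm_image_sub_le_of_norm_fderiv_le (𝕜 := ℝ) (f := fderiv ℝ f) (C := M)
      (s := ({x} : Set R3) ×ˢ Metric.closedBall v 1) (x := (x, v)) (y := (x, v - s • y))
      (fun p _ => (contDiff_fderiv hf).differentiable (by norm_num) p)
      (fun p hp => by
        obtain ⟨hp1, hp2⟩ := hp
        have : p = (x, p.2) := Prod.ext hp1 rfl
        rw [this]
        exact h2 _ hp2)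
      ((convex_singleton x).prod (convex_closedBall v 1))
      ⟨rfl, Metric.mem_closedBall_self zero_le_one⟩
      ⟨rfl, by rw [Metric.mem_closedBall, dist_eq_norm]; simpa using hsy⟩
    have he : ‖((x, v - s • y) : Phase) - (x, v)‖ = s * ‖y‖ := by
      simp [Prod.norm_def, norm_smul, abs_of_nonneg hs.1]
      exact mul_nonneg hs.1 (norm_nonneg _)
    rw [he] at hmvt
    have hy2 : fderiv ℝ f (x, v) (0, -y) = -‖y‖ ^ 2 := by
      rw [← inner_gradV hfd, ← hy, inner_neg_right, real_inner_self_eq_norm_sq]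
    have hle := (le_abs_self _).trans ((fderiv ℝ f (x, v - s • y) - fderiv ℝ f (x, v)).le_opNorm
      ((0, -y) : Phase))
    have hn : ‖((0, -y) : Phase)‖ = ‖y‖ := by simp [Prod.norm_def]
    rw [hn, sub_apply, hy2] at hle
    have := mul_le_mul_of_nonneg_right hmvt (norm_nonneg y)
    nlinarith
  have hanti : AntitoneOn (fun s : ℝ => f (x, v - s • y) + s * ‖y‖ ^ 2 -
      M * s ^ 2 / 2 * ‖y‖ ^ 2) (Icc 0 M⁻¹) := by
    refine antitoneOn_of_hasDerivWithinAt_nonpos (convex_Icc _ _)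
      (fun s _ => (hder s).continuousAt.continuousWithinAt)
      (fun s _ => (hder s).hasDerivWithinAt) fun s hs => hneg s (interior_subset hs)
  have h := hanti (left_mem_Icc.2 (by positivity)) (right_mem_Icc.2 (by positivity))
    (inv_nonneg.2 hM.le)
  have hp := hpos (v - M⁻¹ • y)
  simp only [zero_smul, sub_zero, zero_mul, add_zero] at h
  have h3 : M⁻¹ * ‖y‖ ^ 2 - M * M⁻¹ ^ 2 / 2 * ‖y‖ ^ 2 < f (x, v) := by
    norm_num at h
    simp only [inv_pow] at h ⊢
    linarith
  have h4 : M⁻¹ * ‖y‖ ^ 2 - M * M⁻¹ ^ 2 / 2 * ‖y‖ ^ 2 = ‖y‖ ^ 2 / (2 * M) := by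
    field_simp; ring
  rw [h4, div_lt_iff₀ (by positivity)] at h3
  linarith

/-- Apply `sq_norm_gradV_le` with `M` proportional to `(1 + |v|)⁻ⁿ`; the factor `2ⁿ` compares the
weights at `v` and at points of the unit ball around it. -/
lemma dec_sq_gradV_div {f : Phase → ℝ} (hf : Regular f) {x : R3} (hpos : ∀ u, 0 < f (x, u)) :
    Dec vw fun v => ‖gradV f (x, v)‖ ^ 2 / f (x, v) := by
  intro n
  obtain ⟨C₁, hC₁⟩ := dec_gradV_slice hf x n
  obtain ⟨C₂, hC₂⟩ := (adm_slice hf.decay_fderiv2 x).1 n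
  set C := max 1 (max C₁ C₂) with hC
  have hC0 : 0 < C := lt_of_lt_of_le one_pos (le_max_left _ _)
  refine ⟨2 * (2 ^ n * C), fun v => ?_⟩
  have hv : 0 < vw v := by have := one_le_vw v; linarith
  have hvn : 0 < vw v ^ n := pow_pos hv n
  have h2n : (1 : ℝ) ≤ 2 ^ n := one_le_pow₀ (by norm_num)
  have key : ‖gradV f (x, v)‖ ^ 2 ≤ 2 * (2 ^ n * C / vw v ^ n) * f (x, v) := by
    refine sq_norm_gradV_le hf.contDiff hpos (by positivity) ?_ fun u hu => ?_
    · rw [le_div_iff₀ hvn, mul_comm]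
      have : C ≤ 2 ^ n * C := le_mul_of_one_le_left hC0.le h2n
      exact (hC₁ v).trans (((le_max_left _ _).trans (le_max_right _ _)).trans this)
    · have hu' : vw v ≤ 2 * (1 + ‖u‖) := by
        rw [Metric.mem_closedBall, dist_eq_norm] at hu
        have := norm_le_norm_add_norm_sub u v
        have := norm_nonneg u
        unfold vw; linarith
      rw [le_div_iff₀ hvn, mul_comm]
      calc vw v ^ n * ‖fderiv ℝ (fderiv ℝ f) (x, u)‖
          ≤ (2 * (1 + ‖u‖)) ^ n * ‖fderiv ℝ (fderiv ℝ f) (x, u)‖ := by gcongr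
        _ = 2 ^ n * ((1 + ‖u‖) ^ n * ‖fderiv ℝ (fderiv ℝ f) (x, u)‖) := by rw [mul_pow]; ring
        _ ≤ 2 ^ n * C := by
            gcongr
            exact (hC₂ u).trans ((le_max_right _ _).trans (le_max_right _ _))
  have hfv := hpos v
  rw [Real.norm_eq_abs, abs_of_nonneg (by positivity), ← mul_div_assoc, div_le_iff₀ hfv]
  calc vw v ^ n * ‖gradV f (x, v)‖ ^ 2
      ≤ vw v ^ n * (2 * (2 ^ n * C / vw v ^ n) * f (x, v)) := by gcongr
    _ = _ := by field_simp

/-! ### Local conservation laws and entropy dissipation -/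

lemma inner_S_self_nonneg (w y : R3) : 0 ≤ inner ℝ y (S w y) := by
  rw [S, inner_sub_right, inner_smul_right, real_inner_self_eq_norm_sq, real_inner_comm]
  rcases eq_or_ne w 0 with rfl | hw
  · simp
  have hw' : 0 < ‖w‖ ^ 2 := by positivity
  have h : (inner ℝ w y) ^ 2 ≤ ‖w‖ ^ 2 * ‖y‖ ^ 2 := by
    rw [← mul_pow, ← sq_abs]
    gcongr
    exact abs_real_inner_le_norm w y
  rw [sub_nonneg, div_mul_eq_mul_div, div_le_iff₀ hw']
  rw [real_inner_comm]
  nlinarith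

lemma inner_S (w y : R3) : inner ℝ w (S w y) = 0 := by
  rw [S, inner_sub_right, inner_smul_right, real_inner_self_eq_norm_sq]
  rcases eq_or_ne w 0 with rfl | hw
  · simp
  have : ‖w‖ ^ 2 ≠ 0 := by positivity
  field_simp
  ring

section

variable {N : ℕ} {σ : ℝ → ℝ} (hσ : ModerateCross N σ) {f : Phase → ℝ} (hf : Regular f) (x : R3)

include hσ hf in
-- The gradient is constant, so its difference at the two velocities is zero.
lemma integral_Q_mul_affine (c : ℝ) (L : R3 →L[ℝ] ℝ) : ∫ v, Q σ f (x, v) * (c + L v) = 0 := by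
  have hψ : ContDiff ℝ 1 fun v => c + L v := contDiff_const.add L.contDiff
  have hd : ∀ v, fderiv ℝ (fun v => c + L v) v = L := fun v => (L.hasFDerivAt.const_add c).fderiv
  have hL : Pol vw fun _ : R3 => ‖L‖ := ⟨0, ‖L‖, fun _ => by simp⟩
  rw [integral_Q_mul_symm hσ hf x hψ ?_ ?_ ?_]
  · simp [hd]
  · refine ⟨1, |c| + ‖L‖, fun v => ?_⟩
    have h1 := L.le_opNorm v
    have h2 := norm_nonneg v
    have h3 := norm_nonneg L
    have h4 := abs_nonneg c
    refine (norm_add_le _ _).trans ?_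
    rw [Real.norm_eq_abs c, vw, pow_one]
    nlinarith [mul_nonneg h4 h2]
  · simp only [hd]
    exact hL.smul_dec one_le_vw (dec_slice hf x)
  · simp only [hd]
    exact hL.smul_dec one_le_vw ((dec_gradV_slice hf x).mono one_le_vw
      (h := fun v => ‖gradV f (x, v)‖) fun v => by simp)

lemma hasFDerivAt_energy (v : R3) :
    HasFDerivAt (fun v : R3 => ‖v‖ ^ 2 / 2) (innerSL ℝ v) v := by
  have h := (hasStrictFDerivAt_norm_sq v).hasFDerivAt.mul_const (2⁻¹ : ℝ)
  simp only [div_eq_mul_inv]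
  refine h.congr_fderiv ?_
  ext y
  simp

include hσ hf in
-- The difference of the gradients is `v - v'`, which is orthogonal to the range of `S(v - v')`.
lemma integral_Q_mul_energy : ∫ v, Q σ f (x, v) * (‖v‖ ^ 2 / 2) = 0 := by
  have hψ : ContDiff ℝ 1 fun v : R3 => ‖v‖ ^ 2 / 2 := (contDiff_norm_sq ℝ).div_const 2
  have hd : ∀ v : R3, fderiv ℝ (fun v : R3 => ‖v‖ ^ 2 / 2) v = innerSL ℝ v := fun v =>
    (hasFDerivAt_energy v).fderiv
  have hL : Pol vw fun v : R3 => ‖innerSL ℝ v‖ := ⟨1, 1, fun v => by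
    rw [norm_norm, innerSL_apply_norm]; simp [vw]⟩
  rw [integral_Q_mul_symm hσ hf x hψ ?_ ?_ ?_]
  · have h : ∀ y : R3 × R3, (innerSL ℝ y.1 - innerSL ℝ y.2) (fplKernel σ f (x, y.1) y.2) = 0 := by
      intro y
      rw [← map_sub, innerSL_apply_apply, fplKernel, inner_smul_right, inner_S, mul_zero]
    simp only [hd, h]
    simp
  · refine ⟨2, 1, fun v => ?_⟩
    have h2 := norm_nonneg v
    rw [Real.norm_eq_abs, abs_of_nonneg (by positivity), vw]
    nlinarith
  · simp only [hd]
    exact hL.smul_dec one_le_vw (dec_slice hf x)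
  · simp only [hd]
    exact hL.smul_dec one_le_vw ((dec_gradV_slice hf x).mono one_le_vw
      (h := fun v => ‖gradV f (x, v)‖) fun v => by simp)

include hf in
lemma fderiv_log_slice (hpos : ∀ v, 0 < f (x, v)) (v y : R3) :
    fderiv ℝ (fun v => Real.log (f (x, v))) v y = inner ℝ ((f (x, v))⁻¹ • gradV f (x, v)) y := by
  have h := (fderiv_slice (x, v) (hf.differentiable (x, v))).log (hpos v).ne'
  rw [h.fderiv, inner_smul_left, inner_gradV hf.differentiable]
  simp

/-- The bracket in the kernel is `f f'` times the difference of the gradients of `ln f`, so the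
expression is the nonnegative quadratic form of `S` at that difference. -/
lemma inner_entropy_nonneg (hσ0 : ∀ ρ : ℝ, 0 < ρ → 0 ≤ σ ρ) (hpos : ∀ v, 0 < f (x, v))
    (v v' : R3) : 0 ≤ inner ℝ ((f (x, v))⁻¹ • gradV f (x, v) - (f (x, v'))⁻¹ • gradV f (x, v'))
      (fplKernel σ f (x, v) v') := by
  -- The diagonal is separate because `σ` has a sign only at positive arguments.
  rcases eq_or_ne v v' with rfl | hne
  · simp
  have h1 := hpos v
  have h2 := hpos v'
  have hb : f (x, v') • gradV f (x, v) - f (x, v) • gradV f (x, v') =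
      (f (x, v) * f (x, v')) •
        ((f (x, v))⁻¹ • gradV f (x, v) - (f (x, v'))⁻¹ • gradV f (x, v')) := by
    rw [smul_sub, smul_smul, smul_smul]
    congr 2 <;> field_simp
  simp only [fplKernel]
  rw [hb, S_smul, inner_smul_right, inner_smul_right]
  have h3 := hσ0 ‖v - v'‖ (norm_pos_iff.2 (sub_ne_zero.2 hne))
  have h4 := inner_S_self_nonneg (v - v')
    ((f (x, v))⁻¹ • gradV f (x, v) - (f (x, v'))⁻¹ • gradV f (x, v'))
  positivity

include hσ hf in
-- With `ψ = ln f` the two decay conditions of the weak form concern `|∇_v f|` and `|∇_v f|² / f`;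
-- the second is `dec_sq_gradV_div`.
lemma integral_Q_mul_log_nonpos (hσ0 : ∀ ρ : ℝ, 0 < ρ → 0 ≤ σ ρ) (hpos : ∀ v, 0 < f (x, v))
    (hlog : Pol vw fun v => Real.log (f (x, v))) :
    ∫ v, Q σ f (x, v) * Real.log (f (x, v)) ≤ 0 := by
  have hψ : ContDiff ℝ 1 fun v => Real.log (f (x, v)) :=
    (((hf.contDiff.of_le (by norm_num)).comp (contDiff_prodMk_right x))).log
      fun v => (hpos v).ne'
  have hd := fderiv_log_slice hf x hpos
  have hn : ∀ v, ‖fderiv ℝ (fun v => Real.log (f (x, v))) v‖ ≤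
      (f (x, v))⁻¹ * ‖gradV f (x, v)‖ := by
    intro v
    have h1 := hpos v
    refine ContinuousLinearMap.opNorm_le_bound _ (by positivity) fun y => ?_
    rw [hd]
    refine (norm_inner_le_norm _ _).trans_eq ?_
    rw [norm_smul, norm_inv, Real.norm_eq_abs, abs_of_pos h1]
  rw [integral_Q_mul_symm hσ hf x hψ hlog ?_ ?_]
  · have h : 0 ≤ ∫ y : R3 × R3, (fderiv ℝ (fun v => Real.log (f (x, v))) y.1 -
        fderiv ℝ (fun v => Real.log (f (x, v))) y.2) (fplKernel σ f (x, y.1) y.2) := by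
      refine integral_nonneg fun y => ?_
      simp only [sub_apply, hd, Pi.zero_apply]
      rw [← inner_sub_left]
      exact inner_entropy_nonneg x hσ0 hpos y.1 y.2
    linarith
  · refine (dec_gradV_slice hf x).mono one_le_vw fun v => ?_
    have h1 := hpos v
    rw [norm_mul, norm_norm, Real.norm_eq_abs, abs_of_pos h1]
    calc _ ≤ (f (x, v))⁻¹ * ‖gradV f (x, v)‖ * f (x, v) := by gcongr; exact hn v
      _ = _ := by field_simp
  · refine (dec_sq_gradV_div hf hpos).mono one_le_vw fun v => ?_
    have h1 := hpos v
    rw [norm_mul, norm_norm, norm_norm, Real.norm_eq_abs, abs_of_nonneg (by positivity)]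
    calc _ ≤ (f (x, v))⁻¹ * ‖gradV f (x, v)‖ * ‖gradV f (x, v)‖ := by gcongr; exact hn v
      _ = _ := by field_simp

end

/-! ### Conservation laws and entropy dissipation of the averaged kernel -/

section

variable {ω : ℝ} (hω : ω ≠ 0) {N : ℕ} {σ : ℝ → ℝ} (hσ : ModerateCross N σ) {f : Phase → ℝ}
  (hf : Regular f)

include hσ hf in
lemma continuous_Q : Continuous (Q σ f) := continuous_divV (contDiff_velFlux_fplKernel hσ hf)

variable {x3 : ℝ} (h3 : RapidDecayAt f x3)
include hω hσ hf h3

lemma gyroAverage_mass : Integrable (fun q : R2 × R3 => gyroAverage ω (Q σ f) (pt q x3)) ∧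
    ∫ q : R2 × R3, gyroAverage ω (Q σ f) (pt q x3) = 0 := by
  have h := integral_gyroAverage_smul hω (continuous_Q hσ hf) (dec_Q_height hσ hf h3)
    (ψ := fun _ => (1 : ℝ)) continuous_const ⟨0, 1, fun q => by simp⟩
  simp only [smul_eq_mul, mul_one] at h
  refine ⟨h.1, h.2.trans ?_⟩
  have h0 : ∀ x : R2, ∫ v : R3, Q σ f (pt (x, v) x3) = 0 := fun x => by
    simpa [pt] using integral_Q_mul_affine hσ hf (lift x x3) 1 0
  simp [h0]

lemma gyroAverage_momentum :
    Integrable (fun q : R2 × R3 => gyroAverage ω (Q σ f) (pt q x3) • q.2) ∧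
      ∫ q : R2 × R3, gyroAverage ω (Q σ f) (pt q x3) • q.2 = 0 := by
  have h := integral_gyroAverage_smul hω (continuous_Q hσ hf) (dec_Q_height hσ hf h3)
    (ψ := fun q : R2 × R3 => q.2) continuous_snd ⟨1, 1, fun q => by
      have := norm_nonneg q.1
      rw [wt, pow_one, one_mul]; linarith⟩
  refine ⟨h.1, h.2.trans ?_⟩
  have h0 : ∀ (t : Torus) (x : R2),
      ∫ v : R3, Q σ f (pt (x, v) x3) • (flow2 ω (-t) (x, v)).2 = 0 := by
    intro t x
    -- Along the flow the velocity is rotated, so each component of the transported test function is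
    -- still linear in `v`.
    let R : R3 →L[ℝ] R3 := (rot3Equiv (-t)).toContinuousLinearEquiv
    have h_int : Integrable fun v : R3 => Q σ f (lift x x3, v) • R v := by
      have hc := continuous_Q hσ hf
      refine integrable_of_dec_R3 (Continuous.aestronglyMeasurable (by fun_prop)) ?_
      refine Dec.smul_pol (W := vw) one_le_vw ?_ ⟨1, ‖R‖, fun v => ?_⟩
      · exact dec_Q (P := fun v : R3 => ((lift x x3, v) : Phase)) (W := vw) (fun v => le_rfl) hσ hf
          (adm_slice hf.decay _) (adm_slice hf.decay_fderiv _) (adm_slice hf.decay_fderiv2 _)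
      · refine (R.le_opNorm v).trans ?_
        gcongr
        rw [vw, pow_one]; linarith
    change ∫ v : R3, Q σ f (lift x x3, v) • R v = 0
    ext i
    rw [eval_integral_piLp fun i => h_int.eval_piLp i]
    simpa using integral_Q_mul_affine hσ hf (lift x x3) 0
      ((EuclideanSpace.proj i : R3 →L[ℝ] ℝ).comp R)
  simp [h0]

lemma gyroAverage_energy :
    Integrable (fun q : R2 × R3 => ‖q.2‖ ^ 2 / 2 * gyroAverage ω (Q σ f) (pt q x3)) ∧
      ∫ q : R2 × R3, ‖q.2‖ ^ 2 / 2 * gyroAverage ω (Q σ f) (pt q x3) = 0 := by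
  have h := integral_gyroAverage_smul hω (continuous_Q hσ hf) (dec_Q_height hσ hf h3)
    (ψ := fun q : R2 × R3 => ‖q.2‖ ^ 2 / 2) (by fun_prop) ⟨2, 1, fun q => by
      have h1 := norm_nonneg q.1
      have h2 := norm_nonneg q.2
      rw [Real.norm_eq_abs, abs_of_nonneg (by positivity), wt]
      nlinarith [mul_nonneg h1 h2]⟩
  simp only [smul_eq_mul] at h
  simp only [mul_comm (‖_‖ ^ 2 / 2)]
  refine ⟨h.1, h.2.trans ?_⟩
  have h0 : ∀ (t : Torus) (x : R2),
      ∫ v : R3, Q σ f (pt (x, v) x3) * (‖(flow2 ω (-t) (x, v)).2‖ ^ 2 / 2) = 0 := by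
    intro t x
    simp only [flow2, norm_rot3]
    exact integral_Q_mul_energy hσ hf (lift x x3)
  simp [h0]

lemma gyroAverage_entropy (hσ0 : ∀ ρ : ℝ, 0 < ρ → 0 ≤ σ ρ)
    (hT : ∀ p : Phase, transport ω f p = 0) (hlog : LogTempered f x3) :
    Integrable (fun q : R2 × R3 =>
        Real.log (f (pt q x3)) * gyroAverage ω (Q σ f) (pt q x3)) ∧
      ∫ q : R2 × R3, Real.log (f (pt q x3)) * gyroAverage ω (Q σ f) (pt q x3) ≤ 0 := by
  obtain ⟨hpos, k, C, hC⟩ := hlog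
  have hc := hf.contDiff.continuous
  have h := integral_gyroAverage_smul hω (continuous_Q hσ hf) (dec_Q_height hσ hf h3)
    (ψ := fun q : R2 × R3 => Real.log (f (pt q x3)))
    ((hc.comp (continuous_pt x3)).log fun q => (hpos q).ne') ⟨k, C, hC⟩
  simp only [smul_eq_mul] at h
  simp only [mul_comm (Real.log _)]
  refine ⟨h.1, h.2.trans_le ?_⟩
  -- `ln f` is constant along the flow, so the transported test function is `ln f` itself and the
  -- local entropy inequality applies at each position.
  simp only [← flow_pt, flow_invariant hω hf.differentiable hT]
  refine integral_nonpos fun t => integral_nonpos fun x => ?_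
  refine integral_Q_mul_log_nonpos hσ hf (lift x x3) hσ0 (fun v => hpos (x, v))
    ⟨k, |C| * (1 + ‖x‖) ^ k, fun v => (hC (x, v)).trans ?_⟩
  -- At fixed `x̄` the growth in `(x̄, v)` becomes growth in `v` alone.
  have h1 : 1 + ‖x‖ + ‖v‖ ≤ (1 + ‖x‖) * vw v := by
    unfold vw
    nlinarith [mul_nonneg (norm_nonneg x) (norm_nonneg v)]
  rw [mul_assoc, ← mul_pow]
  gcongr
  exact le_abs_self C

end

/-! ### The kernel as the difference of its gain and loss parts -/

section

variable {N : ℕ} {σ : ℝ → ℝ} (hσ : ModerateCross N σ) {f : Phase → ℝ} (hf : Regular f)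

include hσ hf in
lemma Q_eq_sub (p : Phase) : Q σ f p = Qgain σ f p - Qloss σ f p := by
  have h1 := differentiable_slice (contDiff_velFlux_gainKernel hσ hf) p.1
  have h2 := differentiable_slice (contDiff_velFlux_lossKernel hσ hf) p.1
  simp only [Q, Qgain, Qloss, divV, velFlux_fplKernel hσ hf, ← Finset.sum_sub_distrib]
  rw [((h1 p.2).hasFDerivAt.fun_sub (h2 p.2).hasFDerivAt).fderiv]
  rfl

include hσ hf in
lemma gyroAverage_Q_eq_sub {ω : ℝ} (hω : ω ≠ 0) (p : Phase) :
    gyroAverage ω (Q σ f) p = gyroAverage ω (Qgain σ f) p - gyroAverage ω (Qloss σ f) p := by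
  have hg : Continuous (Qgain σ f) := continuous_divV (contDiff_velFlux_gainKernel hσ hf)
  have hl : Continuous (Qloss σ f) := continuous_divV (contDiff_velFlux_lossKernel hσ hf)
  simp only [gyroAverage_eq_integral hω, Q_eq_sub hσ hf]
  exact integral_sub (integrable_torus (by fun_prop)) (integrable_torus (by fun_prop))

end

lemma divOmega_const_smul (ω c : ℝ) {F : Phase → Phase} {p : Phase}
    (hF : DifferentiableAt ℝ F p) : divOmega ω (fun p' => c • F p') p = c * divOmega ω F p := by
  simp only [divOmega]
  rw [(hF.hasFDerivAt.fun_const_smul c).fderiv]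
  simp only [smul_apply, Prod.smul_fst, Prod.smul_snd, PiLp.smul_apply, smul_eq_mul,
    ← Finset.mul_sum]
  ring

end FPL

end


/-! ### Assembly of the proposition. -/

theorem mainTheorem2
    (ω : ℝ) (hω : ω ≠ 0)
    (σ : ℝ → ℝ) (hσm : Measurable σ) (hσ0 : ∀ ρ : ℝ, 0 < ρ → 0 ≤ σ ρ)
    (hσ : ∃ N : ℕ, IntegrableOn (fun ρ : ℝ => σ ρ * ρ ^ 2 / (1 + ρ) ^ N) (Ioi 0))
    (f : FPL.Phase → ℝ) (hf : ContDiff ℝ 2 f) (hdecay : FPL.RapidDecayV f)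
    (hT : ∀ p : FPL.Phase, FPL.transport ω f p = 0) :
    -- the kernel and its gain and loss parts are well defined
    ((∀ p : FPL.Phase,
        Integrable (FPL.gainKernel σ f p) ∧ Integrable (FPL.lossKernel σ f p) ∧
        Integrable (FPL.fplKernel σ f p)) ∧
      (∀ x : FPL.R3,
        Differentiable ℝ (fun v : FPL.R3 => FPL.velFlux (FPL.gainKernel σ f) (x, v)) ∧
        Differentiable ℝ (fun v : FPL.R3 => FPL.velFlux (FPL.lossKernel σ f) (x, v)) ∧
        Differentiable ℝ (fun v : FPL.R3 => FPL.velFlux (FPL.fplKernel σ f) (x, v))) ∧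
      Continuous (FPL.Qgain σ f) ∧ Continuous (FPL.Qloss σ f) ∧ Continuous (FPL.Q σ f)) ∧
    -- the explicit divergence forms
    (∀ p : FPL.Phase, FPL.bar p.2 ≠ 0 →
      (Integrable (FPL.gainA ω σ f p) ∧
        DifferentiableAt ℝ (FPL.phaseFlux (FPL.gainA ω σ f)) p ∧
        FPL.gyroAverage ω (FPL.Qgain σ f) p =
          FPL.divOmega ω (fun p' => ω ^ 2 • FPL.phaseFlux (FPL.gainA ω σ f) p') p) ∧
      (Integrable (FPL.lossA ω σ f p) ∧
        DifferentiableAt ℝ (FPL.phaseFlux (FPL.lossA ω σ f)) p ∧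
        FPL.gyroAverage ω (FPL.Qloss σ f) p =
          FPL.divOmega ω (fun p' => ω ^ 2 • FPL.phaseFlux (FPL.lossA ω σ f) p') p) ∧
      (Integrable (FPL.gainXi ω σ f p) ∧ Integrable (FPL.lossXi ω σ f p) ∧
        DifferentiableAt ℝ (FPL.phaseFlux (FPL.gainXi ω σ f)) p ∧
        DifferentiableAt ℝ (FPL.phaseFlux (FPL.lossXi ω σ f)) p ∧
        (ω ^ 2)⁻¹ * FPL.gyroAverage ω (FPL.Q σ f) p =
          FPL.divOmega ω (FPL.phaseFlux (FPL.gainXi ω σ f)) p -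
            FPL.divOmega ω (FPL.phaseFlux (FPL.lossXi ω σ f)) p)) ∧
    -- conservation laws and entropy dissipation at fixed `x₃`
    (∀ x3 : ℝ, FPL.RapidDecayAt f x3 →
      (Integrable (fun q : FPL.R2 × FPL.R3 =>
          FPL.gyroAverage ω (FPL.Q σ f) (FPL.pt q x3)) ∧
        ∫ q : FPL.R2 × FPL.R3, FPL.gyroAverage ω (FPL.Q σ f) (FPL.pt q x3) = 0) ∧
      (Integrable (fun q : FPL.R2 × FPL.R3 =>
          FPL.gyroAverage ω (FPL.Q σ f) (FPL.pt q x3) • q.2) ∧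
        ∫ q : FPL.R2 × FPL.R3, FPL.gyroAverage ω (FPL.Q σ f) (FPL.pt q x3) • q.2 = 0) ∧
      (Integrable (fun q : FPL.R2 × FPL.R3 =>
          ‖q.2‖ ^ 2 / 2 * FPL.gyroAverage ω (FPL.Q σ f) (FPL.pt q x3)) ∧
        ∫ q : FPL.R2 × FPL.R3,
          ‖q.2‖ ^ 2 / 2 * FPL.gyroAverage ω (FPL.Q σ f) (FPL.pt q x3) = 0) ∧
      (FPL.LogTempered f x3 →
        Integrable (fun q : FPL.R2 × FPL.R3 =>
          Real.log (f (FPL.pt q x3)) * FPL.gyroAverage ω (FPL.Q σ f) (FPL.pt q x3)) ∧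
        ∫ q : FPL.R2 × FPL.R3,
          Real.log (f (FPL.pt q x3)) * FPL.gyroAverage ω (FPL.Q σ f) (FPL.pt q x3) ≤ 0)) := by
  obtain ⟨N, hN⟩ := hσ
  have hσ' := FPL.moderateCross_of_integrableOn hσm hN
  have hfR := FPL.regular_of_rapidDecayV hf hdecay
  have hcg := FPL.contDiff_velFlux_gainKernel hσ' hfR
  have hcl := FPL.contDiff_velFlux_lossKernel hσ' hfR
  have hcq := FPL.contDiff_velFlux_fplKernel hσ' hfR
  refine ⟨⟨fun p => ⟨FPL.integrable_gainKernel hσ' hfR p, FPL.integrable_lossKernel hσ' hfR p,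
      FPL.integrable_fplKernel hσ' hfR p⟩,
    fun x => ⟨FPL.differentiable_slice hcg x, FPL.differentiable_slice hcl x,
      FPL.differentiable_slice hcq x⟩,
    FPL.continuous_divV hcg, FPL.continuous_divV hcl, FPL.continuous_divV hcq⟩,
    fun p hp => ?_, fun x3 h3 => ⟨FPL.gyroAverage_mass hω hσ' hfR h3,
      FPL.gyroAverage_momentum hω hσ' hfR h3, FPL.gyroAverage_energy hω hσ' hfR h3,
      FPL.gyroAverage_entropy hω hσ' hfR h3 hσ0 hT⟩⟩
  have hg := FPL.gainA_flux hω hσ' hfR hT hp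
  have hl := FPL.lossA_flux hω hσ' hfR hT hp
  have hg' := FPL.divergence_of_flux_eq hω hcg
    (fun p hp => (FPL.gainA_flux hω hσ' hfR hT hp).2) hp
  have hl' := FPL.divergence_of_flux_eq hω hcl
    (fun p hp => (FPL.lossA_flux hω hσ' hfR hT hp).2) hp
  refine ⟨⟨hg.1, hg'⟩, ⟨hl.1, hl'⟩, ?_⟩
  rw [FPL.gainXi_eq_gainA hσ0, FPL.lossXi_eq_lossA hσ0]
  refine ⟨hg.1, hl.1, hg'.1, hl'.1, ?_⟩
  have e1 : FPL.gyroAverage ω (FPL.Qgain σ f) p = _ := hg'.2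
  have e2 : FPL.gyroAverage ω (FPL.Qloss σ f) p = _ := hl'.2
  rw [FPL.gyroAverage_Q_eq_sub hσ' hfR hω, e1, e2, FPL.divOmega_const_smul _ _ hg'.1,
    FPL.divOmega_const_smul _ _ hl'.1, ← mul_sub, inv_mul_cancel_left₀ (pow_ne_zero 2 hω)]
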